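/- Let $N\ge1$, $T>0$, and let $$u'(t)=-i\bigl(-\tfrac12\Delta+V_R(t)-iV_I\bigr)u(t),\qquad t\in[0,T],\qquad u(0)=u_0\neq0,$$ be the finite-difference discretization, on $N$ equidistant grid points with mesh width $1/N$, of the one-dimensional Schrödinger equation with a complex absorbing potential. Here $-\frac12\Delta$ is the tridiagonal $N\times N$ matrix with diagonal entries $N^2$ and off-diagonal entries $-N^2/2$, $V_R(t)$ is a real diagonal matrix that is continuously differentiable in $t$, and $V_I$ is a time-independent nonnegative diagonal matrix. Write $H(t)=-\frac12\Delta+V_R(t)$, let $\|\cdot\|$ be the Euclidean norm of vectors and the spectral norm of matrices, and $|v\rangle=v/\|v\|$. The oracles are unitaries with $O_{V_I}:|r\rangle|0\rangle\mapsto|r\rangle|V_I(r)\rangle$, $O_{V_R}:|r\rangle|s\rangle|0\rangle\mapsto|r\rangle|s\rangle|V_R(r,sT/m)\rangle$ for $0\le s<m$, and $O_{\rm prep}:|0\rangle\mapsto|u_0\rangle$, where $|V_I(r)\rangle$ and $|V_R(r,t)\rangle$ hold finite encodings of the values up to an error $\delta$; nothing is assumed about their action on other inputs. An algorithm is a sequence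 of oracle-independent unitaries and of (workspace-controlled) queries to the oracles or their inverses, followed by a measurement of all registers except the grid register. There are universal constants $C,p>0$ and $k\in\mathbb N$ such that the following holds. Let $\epsilon>0$, $q\ge1$, $h,v_R',v_I\ge0$, and put $X=2+q\,(1+Th)(1+v_R')(1+v_I)/\epsilon$. For every number format of the oracles and every time grid with $m\ge CX^k$ points, there is a quantum algorithm that uses at most $$C\,q\,(1+Th)\,(\log X)^k$$ queries to $O_{V_I}$ and $O_{V_R}$ in total and at most $C\,q$ queries to $O_{\rm prep}$, such that for all problems of the above form with $\|u_0\|/\|u(T)\|\le q$, $\max_t\|H(t)\|\le h$, $\max_t\|V_R'(t)\|\le v_R'$, $\|V_I\|\le v_I$, and all oracles for them with $\delta\le 1/(CX^k)$, a flag indicates success with probability at least $p$, and in the case of success the grid register is, up to a global phase, in a state within distance $\epsilon$ of $|u(T)\rangle$. That is, $|u(T)\rangle$ is prepared to within $\epsilon$ with $\Omega(1)$ success probability, using $$\widetilde{\mathcal O}\!\left(\frac{\|u_0\|}{\|u(T)\|}\,T\max_t\|H(t)\|\;\mathrm{polylog}\!\left(\frac{\max_t\|V_R'(t)\|\,\|V_I\|}{\epsilon}\right)\right)$$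 queries to $O_{V_I}$ and $O_{V_R}$ and $\mathcal O(\|u_0\|/\|u(T)\|)$ queries to $O_{\rm prep}$. Moreover, $\max_t\|H(t)\|\le C\,(N^2+\max_t\|V_R(t)\|)$. -/

import Mathlib

open scoped Matrix.Norms.L2Operator

noncomputable section

namespace CAP

/-! ### The spatially discretized Schrödinger equation with a complex absorbing potential -/

/-- The second-order central-difference Laplacian on `N` equidistant grid points with mesh width
`1 / N` and zero boundary values: `(Δ v) r = (v (r - 1) - 2 * v r + v (r + 1)) / (1 / N) ^ 2`. -/
def discreteLaplacian (N : ℕ) : Matrix (Fin N) (Fin N) ℂ :=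
  Matrix.of fun i j =>
    (N : ℂ) ^ 2 *
      (if i = j then -2 else if (i : ℕ) + 1 = j ∨ (j : ℕ) + 1 = i then 1 else 0)

/-- The diagonal matrix of a real potential on the grid. -/
def potential {N : ℕ} (V : Fin N → ℝ) : Matrix (Fin N) (Fin N) ℂ :=
  Matrix.diagonal fun r => (V r : ℂ)

/-- The Hamiltonian `H = -Δ / 2 + V` on the grid. -/
def hamiltonian {N : ℕ} (V : Fin N → ℝ) : Matrix (Fin N) (Fin N) ℂ :=
  -((1 / 2 : ℂ) • discreteLaplacian N) + potential V

/-- `max_{0 ≤ t ≤ T} ‖F t‖`, with the spectral (ℓ² operator) norm. -/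
def maxNorm {N : ℕ} (T : ℝ) (F : ℝ → Matrix (Fin N) (Fin N) ℂ) : ℝ :=
  sSup ((fun t => ‖F t‖) '' Set.Icc 0 T)

/-- The data of the discretized initial value problem
`u' = -i (-Δ / 2 + V_R(t) - i V_I) u` on `[0, T]`, together with its solution `u`:
a continuously differentiable real potential `V_R`, a nonnegative time-independent absorbing
potential `V_I`, and a nonzero initial value `u 0`. -/
structure Problem (N : ℕ) (T : ℝ) where
  VR : ℝ → Fin N → ℝ
  VI : Fin N → ℝ
  u : ℝ → EuclideanSpace ℂ (Fin N)
  contDiffOn_VR : ContDiffOn ℝ 1 VR (Set.Icc 0 T)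
  VI_nonneg : ∀ r, 0 ≤ VI r
  u_zero_ne : u 0 ≠ 0
  solves : ∀ t ∈ Set.Icc 0 T,
    HasDerivWithinAt u
      (-Complex.I • Matrix.toEuclideanCLM (n := Fin N) (𝕜 := ℂ)
        (hamiltonian (VR t) - Complex.I • potential VI) (u t))
      (Set.Icc 0 T) t

/-- `max_t ‖H(t)‖`. -/
def Problem.maxH {N : ℕ} {T : ℝ} (P : Problem N T) : ℝ :=
  maxNorm T fun t => hamiltonian (P.VR t)

/-- `max_t ‖V_R(t)‖`. -/
def Problem.maxVR {N : ℕ} {T : ℝ} (P : Problem N T) : ℝ :=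
  maxNorm T fun t => potential (P.VR t)

/-- `max_t ‖V_R'(t)‖`, the prime being the time derivative. -/
def Problem.maxVR' {N : ℕ} {T : ℝ} (P : Problem N T) : ℝ :=
  maxNorm T fun t => potential (derivWithin P.VR (Set.Icc 0 T) t)

/-! ### Oracles -/

/-- Three unitaries: `VI` acts on a grid register and a word register, `VR` on a grid register,
a time register and a word register, and `prep` on a grid register.  Words are elements of
`Fin D` (a register of `b` bits has `D = 2 ^ b`). -/
structure Oracles (N m D : ℕ) where
  VI : Matrix.unitaryGroup (Fin N × Fin D) ℂ
  VR : Matrix.unitaryGroup (Fin N × Fin m × Fin D) ℂ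
  prep : Matrix.unitaryGroup (Fin N) ℂ

/-- The oracles belong to the problem `P`:
* `|r⟩|0⟩ ↦ |r⟩|y⟩`, where the word `y` represents `V_I(r)` up to an error `δ`,
* `|r⟩|s⟩|0⟩ ↦ |r⟩|s⟩|y⟩`, where the word `y` represents `V_R(r, s T / m)` up to an error `δ`,
* `|0⟩ ↦ u(0) / ‖u(0)‖`.
The word `y` represents the real number `val y`.  Nothing is assumed about the action of the
oracles on other vectors. -/
structure Oracles.Encodes {N m D : ℕ} [NeZero N] [NeZero D] {T : ℝ} (O : Oracles N m D)
    (P : Problem N T) (val : Fin D → ℝ) (δ : ℝ) : Prop where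
  VI_spec : ∀ r : Fin N, ∃ y : Fin D, |val y - P.VI r| ≤ δ ∧
    (O.VI : Matrix (Fin N × Fin D) (Fin N × Fin D) ℂ).mulVec (Pi.single (r, 0) 1)
      = Pi.single (r, y) 1
  VR_spec : ∀ (r : Fin N) (s : Fin m), ∃ y : Fin D,
    |val y - P.VR ((s : ℝ) * T / (m : ℝ)) r| ≤ δ ∧
    (O.VR : Matrix (Fin N × Fin m × Fin D) (Fin N × Fin m × Fin D) ℂ).mulVec
        (Pi.single (r, s, 0) 1)
      = Pi.single (r, s, y) 1
  prep_spec : ∀ r : Fin N,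
    (O.prep : Matrix (Fin N) (Fin N) ℂ).mulVec (Pi.single 0 1) r = P.u 0 r / (‖P.u 0‖ : ℂ)

/-! ### Quantum query algorithms -/

/-- Computational basis of the machine: grid register, time register, word register, and a
workspace of arbitrary finite dimension `a + 1`. -/
abbrev Basis (N m D a : ℕ) : Type := Fin N × Fin m × Fin D × Fin (a + 1)

/-- One step of a query algorithm: a unitary that does not depend on the oracles, or a query to
one of the oracles.  A query is controlled by the workspace (it is carried out on the workspace
basis states `w` with `c w = true`) and applies the oracle, or its inverse if `inv = true`. -/
inductive Step (N m D a : ℕ) : Type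
  | gate (U : Matrix.unitaryGroup (Basis N m D a) ℂ)
  | queryVI (c : Fin (a + 1) → Bool) (inv : Bool)
  | queryVR (c : Fin (a + 1) → Bool) (inv : Bool)
  | queryPrep (c : Fin (a + 1) → Bool) (inv : Bool)

/-- `G` or its inverse. -/
def orInv {ι : Type} [Fintype ι] [DecidableEq ι] (G : Matrix.unitaryGroup ι ℂ) (inv : Bool) :
    Matrix ι ι ℂ :=
  if inv then ((G⁻¹ : Matrix.unitaryGroup ι ℂ) : Matrix ι ι ℂ) else (G : Matrix ι ι ℂ)

/-- The action of a step on a state vector; a query acts as the identity on all registers that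
the oracle does not involve. -/
def Step.act {N m D a : ℕ} (O : Oracles N m D) :
    Step N m D a → (Basis N m D a → ℂ) → (Basis N m D a → ℂ)
  | .gate U, ψ => (U : Matrix (Basis N m D a) (Basis N m D a) ℂ).mulVec ψ
  | .queryVI c inv, ψ => fun x =>
      if c x.2.2.2 then
        ∑ z : Fin N × Fin D,
          orInv O.VI inv (x.1, x.2.2.1) z * ψ (z.1, x.2.1, z.2, x.2.2.2)
      else ψ x
  | .queryVR c inv, ψ => fun x =>
      if c x.2.2.2 then
        ∑ z : Fin N × Fin m × Fin D,
          orInv O.VR inv (x.1, x.2.1, x.2.2.1) z * ψ (z.1, z.2.1, z.2.2, x.2.2.2)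
      else ψ x
  | .queryPrep c inv, ψ => fun x =>
      if c x.2.2.2 then
        ∑ z : Fin N, orInv O.prep inv x.1 z * ψ (z, x.2)
      else ψ x

/-- Is the step a query to one of the two potential oracles (or its inverse)? -/
def Step.isPotentialQuery {N m D a : ℕ} : Step N m D a → Bool
  | .queryVI _ _ => true
  | .queryVR _ _ => true
  | _ => false

/-- Is the step a query to the state preparation oracle (or its inverse)? -/
def Step.isPrepQuery {N m D a : ℕ} : Step N m D a → Bool
  | .queryPrep _ _ => true
  | _ => false

/-- A quantum query algorithm.  At the end, all registers but the grid register are measured in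
the computational basis, and `flag` tells which outcomes count as a success. -/
structure Algorithm (N m D : ℕ) where
  work : ℕ
  steps : List (Step N m D work)
  flag : Fin m × Fin D × Fin (work + 1) → Bool

namespace Algorithm

variable {N m D : ℕ}

/-- Total number of queries to `O_{V_I}` and `O_{V_R}`. -/
def potentialQueries (A : Algorithm N m D) : ℕ := A.steps.countP Step.isPotentialQuery

/-- Number of queries to the state preparation oracle. -/
def prepQueries (A : Algorithm N m D) : ℕ := A.steps.countP Step.isPrepQuery

/-- The state before the measurement: the steps are carried out in order, starting from the
basis state `|0⟩|0⟩|0⟩|0⟩`. -/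
def finalState [NeZero N] [NeZero m] [NeZero D] (A : Algorithm N m D) (O : Oracles N m D) :
    Basis N m D A.work → ℂ :=
  A.steps.foldl (fun ψ s => s.act O ψ) (Pi.single (0, 0, 0, 0) 1)

/-- The unnormalized state of the grid register after the measurement outcome `x`. -/
def outcome [NeZero N] [NeZero m] [NeZero D] (A : Algorithm N m D) (O : Oracles N m D)
    (x : Fin m × Fin D × Fin (A.work + 1)) : EuclideanSpace ℂ (Fin N) :=
  WithLp.toLp 2 fun r => A.finalState O (r, x)

/-- The probability that the flag indicates success. -/
def successProb [NeZero N] [NeZero m] [NeZero D] (A : Algorithm N m D) (O : Oracles N m D) : ℝ :=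
  ∑ x with A.flag x = true, ‖A.outcome O x‖ ^ 2

/-- With probability at least `p` the flag indicates success, and whenever it does, the state of
the grid register is, up to a global phase, within distance `ε` of the state `v / ‖v‖`. -/
def Prepares [NeZero N] [NeZero m] [NeZero D] (A : Algorithm N m D) (O : Oracles N m D)
    (v : EuclideanSpace ℂ (Fin N)) (ε p : ℝ) : Prop :=
  p ≤ A.successProb O ∧
    ∀ x, A.flag x = true → A.outcome O x ≠ 0 →
      ∃ z : ℂ, ‖z‖ = 1 ∧
        ‖z • ((‖A.outcome O x‖⁻¹ : ℝ) : ℂ) • A.outcome O x - ((‖v‖⁻¹ : ℝ) : ℂ) • v‖ ≤ ε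

end Algorithm

/-- The argument of the logarithms:
`2 + q (1 + T h) (1 + ‖V_R'‖) (1 + ‖V_I‖) / ε`. -/
def sizeParam (T ε q h vR' vI : ℝ) : ℝ :=
  2 + q * (1 + T * h) * (1 + vR') * (1 + vI) / ε

end CAP

end

/-! Split `[0, T]` into `L = r * n` steps of length `τ`. One step of the equation is, up to second
order, the Euler step `1 - iτH` followed by the damping `diag (1 - τ V_I)`. The difficulty is to
realize this non-unitary product with a query cost governed by `T ‖H‖` alone, in which `‖V_I‖`
enters only through logarithms.

Dilation: in step `j` the damping becomes a rotation between the environment state `none` and a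
fresh level `some j`, with cosine `1 - τ V_I(r)`. Amplitude that has left `none` never returns, so
the `none` component is exactly the damped product (`dilation`).

Interaction picture: since `V_I` does not depend on time, the product of the first `j` rotations at
the grid point `r` depends only on the word for `V_I(r)` and costs two queries, whatever `j` is
(`Scheme.cumDamp_eq`). Conjugating with it (`interaction_picture`) leaves one cumulative damping and
a product of factors `1 + x G_j` with `x = 8hτ`, where each `G_j` is skew-adjoint and the average of
four unitaries; `V_I` no longer affects the norm of `G_j`.

Segments: `r` of order `T h` makes `n x ≤ 1/2`. The product over a segment is expanded and cut off
after `κ` factors with error `2 ^ (-κ)` (`norm_ordProd_sub_dysonSum_le`). The truncated sum is a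
linear combination of unitaries of weight at most two, and one round of oblivious amplitude
amplification makes it deterministic (`amplify_mul_inj`). A segment costs `18 κ` queries with `κ` of
order `log X`. The number `n` costs no queries, so it is taken so large that all discretization
errors are negligible.

Final amplification: the wanted amplitude, halved on purpose, is close to `‖u(T)‖ / (2 ‖u_0‖)`,
which is at least `1 / (2q)`. Since only this lower bound is known, the number of Grover rounds is
drawn uniformly from `0, …, M - 1` with `M` about `4q`; the success probability is then at least
`1/4`, and every successful outcome carries the same state up to phase (`randomGrover_good`).

The degenerate cases `N = 1`, `ε ≥ 2` and `h < N ^ 2 / 2` (no problem satisfies the last one if `N ≥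
2`) need no steps at all. -/

noncomputable section
namespace CAP

open Matrix

/-! ### Circuits on the workspace with clean query registers -/

section Circuits

variable {N m D a : ℕ}

/-- The part of the oracles an algorithm may rely on: the words written by the two potential
oracles, and the preparation unitary. -/
structure OracleData (N m D : ℕ) where
  yI : Fin N → Fin D
  yR : Fin N → Fin m → Fin D
  prep : unitaryGroup (Fin N) ℂ

/-- The oracles write the words prescribed by the data. -/
structure Oracles.Matches [NeZero D] (O : Oracles N m D) (d : OracleData N m D) : Prop where
  VI : ∀ r, (O.VI : Matrix (Fin N × Fin D) (Fin N × Fin D) ℂ) *ᵥ (Pi.single (r, 0) 1)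
    = Pi.single (r, d.yI r) 1
  VR : ∀ r s, (O.VR : Matrix (Fin N × Fin m × Fin D) (Fin N × Fin m × Fin D) ℂ) *ᵥ
    (Pi.single (r, s, 0) 1) = Pi.single (r, s, d.yR r s) 1
  prep : O.prep = d.prep

theorem unitary_col {ι : Type} [Fintype ι] [DecidableEq ι] (U : unitaryGroup ι ℂ) {i j : ι}
    (h : (U : Matrix ι ι ℂ) *ᵥ Pi.single i 1 = Pi.single j 1) (x : ι) :
    orInv U false x i = if x = j then 1 else 0 := by
  have := congrFun h x
  simpa [orInv, Pi.single_apply] using this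

/-- Unitarity turns the known columns of an oracle into known columns of its inverse. This is what
allows words to be erased although nothing is known about the oracle on other inputs. -/
theorem unitary_col_inv {ι : Type} [Fintype ι] [DecidableEq ι] (U : unitaryGroup ι ℂ) {i j : ι}
    (h : (U : Matrix ι ι ℂ) *ᵥ Pi.single i 1 = Pi.single j 1) (x : ι) :
    orInv U true x j = if x = i then 1 else 0 := by
  have h2 : ((U⁻¹ : unitaryGroup ι ℂ) : Matrix ι ι ℂ) *ᵥ Pi.single j 1 = Pi.single i 1 := by
    rw [← h, mulVec_mulVec]
    have : ((U⁻¹ : unitaryGroup ι ℂ) : Matrix ι ι ℂ) * (U : Matrix ι ι ℂ) = 1 := by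
      simp
    rw [this, one_mulVec]
  have := congrFun h2 x
  rw [mulVec_single_one] at this
  rwa [Pi.single_apply] at this

/-- The machine state in which the time and word registers hold functions `s`, `y` of the
remaining registers. -/
def spread {S : Type} (e : S ≃ Fin N × Fin (a + 1)) (s : S → Fin m) (y : S → Fin D)
    (ψ : S → ℂ) : Basis N m D a → ℂ :=
  fun x => if x.2.1 = s (e.symm (x.1, x.2.2.2)) ∧ x.2.2.1 = y (e.symm (x.1, x.2.2.2)) then
    ψ (e.symm (x.1, x.2.2.2)) else 0

variable {S : Type} (e : S ≃ Fin N × Fin (a + 1))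

/-- The matrix of the oracle is summed over all grid points at a fixed workspace state, so the
content of the time register must not vary with the grid point; this is `hs`. The oracle for `V_R`
involves the time register itself and needs no such condition. -/
theorem queryVI_spread [NeZero D] {O : Oracles N m D} {d : OracleData N m D} (hO : O.Matches d)
    (s : S → Fin m) (hs : ∀ z z', (e z).2 = (e z').2 → s z = s z') (ψ : S → ℂ) :
    (Step.queryVI (fun _ => true) false).act O (spread e s 0 ψ)
      = spread e s (fun z => d.yI (e z).1) ψ := by
  funext ⟨r, t, y, w⟩
  simp only [Step.act, if_true, spread, Pi.zero_apply, Fintype.sum_prod_type]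
  have key : ∀ r', s (e.symm (r', w)) = s (e.symm (r, w)) := fun r' => hs _ _ (by simp)
  simp only [key]
  by_cases ht : t = s (e.symm (r, w))
  · simp only [ht, true_and]
    simp only [mul_ite, mul_zero, Finset.sum_ite_eq', Finset.mem_univ, if_true]
    simp only [unitary_col _ (hO.VI _), Prod.mk.injEq, ite_mul, one_mul, zero_mul,
      Equiv.apply_symm_apply]
    simp [ite_and]
  · simp [ht]

theorem queryVI_inv_spread [NeZero D] {O : Oracles N m D} {d : OracleData N m D}
    (hO : O.Matches d)
    (s : S → Fin m) (hs : ∀ z z', (e z).2 = (e z').2 → s z = s z') (ψ : S → ℂ) :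
    (Step.queryVI (fun _ => true) true).act O (spread e s (fun z => d.yI (e z).1) ψ)
      = spread e s 0 ψ := by
  funext ⟨r, t, y, w⟩
  simp only [Step.act, if_true, spread, Pi.zero_apply, Fintype.sum_prod_type]
  have key : ∀ r', s (e.symm (r', w)) = s (e.symm (r, w)) := fun r' => hs _ _ (by simp)
  simp only [key]
  by_cases ht : t = s (e.symm (r, w))
  · simp only [ht, true_and]
    simp only [mul_ite, mul_zero, Finset.sum_ite_eq', Finset.mem_univ, if_true,
      Equiv.apply_symm_apply]
    simp only [unitary_col_inv _ (hO.VI _), Prod.mk.injEq, ite_mul, one_mul, zero_mul]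
    simp [ite_and]
  · simp [ht]

theorem queryVR_spread [NeZero D] {O : Oracles N m D} {d : OracleData N m D} (hO : O.Matches d)
    (s : S → Fin m) (ψ : S → ℂ) :
    (Step.queryVR (fun _ => true) false).act O (spread e s 0 ψ)
      = spread e s (fun z => d.yR (e z).1 (s z)) ψ := by
  funext ⟨r, t, y, w⟩
  simp only [Step.act, if_true, spread, Pi.zero_apply, Fintype.sum_prod_type]
  simp only [ite_and, mul_ite, mul_zero, Equiv.apply_symm_apply]
  have : ∀ x x_1 : _, orInv O.VR false (r, t, y) (x, x_1, 0)
      = if r = x ∧ t = x_1 ∧ y = d.yR x x_1 then 1 else 0 := fun x x1 => by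
    rw [unitary_col _ (hO.VR _ _)]; simp only [Prod.mk.injEq]
  simp only [Finset.sum_ite_irrel, Finset.sum_const_zero, Finset.sum_ite_eq', Finset.mem_univ,
    if_true, this]
  simp only [ite_mul, one_mul, zero_mul, ite_and, Finset.sum_ite_eq, Finset.mem_univ, if_true]

theorem queryVR_inv_spread [NeZero D] {O : Oracles N m D} {d : OracleData N m D}
    (hO : O.Matches d) (s : S → Fin m) (ψ : S → ℂ) :
    (Step.queryVR (fun _ => true) true).act O (spread e s (fun z => d.yR (e z).1 (s z)) ψ)
      = spread e s 0 ψ := by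
  funext ⟨r, t, y, w⟩
  simp only [Step.act, if_true, spread, Pi.zero_apply, Fintype.sum_prod_type]
  simp only [ite_and, mul_ite, mul_zero, Equiv.apply_symm_apply]
  simp only [Finset.sum_ite_irrel, Finset.sum_const_zero, Finset.sum_ite_eq', Finset.mem_univ,
    if_true]
  have : ∀ x x_1 : _, orInv O.VR true (r, t, y) (x, x_1, d.yR x x_1)
      = if r = x ∧ t = x_1 ∧ y = 0 then 1 else 0 := fun x x1 => by
    rw [unitary_col_inv _ (hO.VR _ _)]; simp only [Prod.mk.injEq]
  simp only [this, ite_mul, one_mul, zero_mul, ite_and, Finset.sum_ite_eq, Finset.mem_univ,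
    if_true]

/-- A gate that applies a unitary to the grid and work registers, controlled by the time and
word registers. -/
def blockGate [Fintype S] [DecidableEq S] (U : Fin m × Fin D → unitaryGroup S ℂ) :
    unitaryGroup (Basis N m D a) ℂ :=
  ⟨(blockDiagonal fun k => (U k : Matrix S S ℂ)).submatrix
      (fun x => (e.symm (x.1, x.2.2.2), (x.2.1, x.2.2.1)))
      (fun x => (e.symm (x.1, x.2.2.2), (x.2.1, x.2.2.1))), by
    let f : Basis N m D a ≃ S × (Fin m × Fin D) :=
      ⟨fun x => (e.symm (x.1, x.2.2.2), (x.2.1, x.2.2.1)),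
        fun z => ((e z.1).1, z.2.1, z.2.2, (e z.1).2), fun x => by simp, fun z => by simp⟩
    change (blockDiagonal fun k => (U k : Matrix S S ℂ)).submatrix f f ∈ _
    rw [mem_unitaryGroup_iff, star_eq_conjTranspose, conjTranspose_submatrix,
      submatrix_mul_equiv, blockDiagonal_conjTranspose, ← blockDiagonal_mul]
    have : (fun k => (U k : Matrix S S ℂ) * (U k : Matrix S S ℂ)ᴴ) = 1 := by
      funext k
      exact mem_unitaryGroup_iff.1 (U k).2
    rw [this, blockDiagonal_one, submatrix_one_equiv]⟩

theorem blockGate_act [Fintype S] [DecidableEq S] (O : Oracles N m D)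
    (U : Fin m × Fin D → unitaryGroup S ℂ) (φ : Basis N m D a → ℂ) (x : Basis N m D a) :
    (Step.gate (blockGate e U)).act O φ x
      = ∑ z : S, (U (x.2.1, x.2.2.1) : Matrix S S ℂ) (e.symm (x.1, x.2.2.2)) z
        * φ ((e z).1, x.2.1, x.2.2.1, (e z).2) := by
  let f : Basis N m D a ≃ S × (Fin m × Fin D) :=
    ⟨fun x => (e.symm (x.1, x.2.2.2), (x.2.1, x.2.2.1)),
      fun z => ((e z.1).1, z.2.1, z.2.2, (e z.1).2), fun x => by simp, fun z => by simp⟩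
  simp only [Step.act, blockGate, mulVec, dotProduct]
  rw [← f.symm.sum_comp, Fintype.sum_prod_type]
  refine Finset.sum_congr rfl fun z _ => ?_
  rw [Finset.sum_eq_single (x.2.1, x.2.2.1)]
  · simp [submatrix_apply, f]
  · intro b _ hb
    simp [submatrix_apply, f, blockDiagonal_apply, hb.symm]
  · simp

/-- The gate may read the time and word registers, but it must not mix states with different
contents of them, since these contents would then cease to be functions of the remaining registers.
-/
theorem blockGate_spread [Fintype S] [DecidableEq S] (O : Oracles N m D)
    (U : Fin m × Fin D → unitaryGroup S ℂ) (s : S → Fin m) (y : S → Fin D)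
    (hU : ∀ k z z', (s z ≠ s z' ∨ y z ≠ y z') → (U k : Matrix S S ℂ) z z' = 0)
    (G : Matrix S S ℂ) (hG : ∀ z z', G z z' = (U (s z, y z) : Matrix S S ℂ) z z') (ψ : S → ℂ) :
    (Step.gate (blockGate e U)).act O (spread e s y ψ) = spread e s y (G *ᵥ ψ) := by
  funext ⟨r, t, w, o⟩
  rw [blockGate_act]
  simp only [spread, Prod.mk.eta, Equiv.symm_apply_apply, mulVec, dotProduct]
  set z0 := e.symm (r, o)
  split_ifs with h
  · refine Finset.sum_congr rfl fun z _ => ?_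
    rw [hG]
    by_cases hz : s z0 = s z ∧ y z0 = y z
    · simp [h.1, h.2, hz.1, hz.2]
    · rw [hU _ z0 z (by tauto), hU _ z0 z (by tauto)]; simp
  · refine Finset.sum_eq_zero fun z _ => ?_
    by_cases hz : s z0 = s z ∧ y z0 = y z
    · rw [if_neg, mul_zero]; rwa [← hz.1, ← hz.2]
    · rw [hU _ z0 z (by tauto)]; simp

/-- The permutation of the machine basis which exchanges the time `0` with the time `s z`. -/
def timePerm [NeZero m] (s : S → Fin m) : Equiv.Perm (Basis N m D a) where
  toFun x := (x.1, Equiv.swap 0 (s (e.symm (x.1, x.2.2.2))) x.2.1, x.2.2.1, x.2.2.2)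
  invFun x := (x.1, Equiv.swap 0 (s (e.symm (x.1, x.2.2.2))) x.2.1, x.2.2.1, x.2.2.2)
  left_inv x := by simp
  right_inv x := by simp

theorem permMatrix_mem_unitaryGroup {ι : Type} [Fintype ι] [DecidableEq ι] (σ : Equiv.Perm ι) :
    (σ.permMatrix ℂ) ∈ unitaryGroup ι ℂ := by
  rw [mem_unitaryGroup_iff, star_eq_conjTranspose, conjTranspose_permMatrix, ← permMatrix_mul]
  simp

/-- The gate that writes the time `s z` to the time register. -/
def timeGate [NeZero m] (s : S → Fin m) : unitaryGroup (Basis N m D a) ℂ :=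
  ⟨_, permMatrix_mem_unitaryGroup (timePerm e s)⟩

theorem timeGate_spread [NeZero m] (O : Oracles N m D) (s : S → Fin m) (y : S → Fin D)
    (ψ : S → ℂ) :
    (Step.gate (timeGate e s)).act O (spread e 0 y ψ) = spread e s y ψ := by
  funext ⟨r, t, w, o⟩
  simp only [Step.act, timeGate, permMatrix_mulVec, Function.comp, timePerm, Equiv.coe_fn_mk,
    spread, Pi.zero_apply]
  congr 2
  rw [Equiv.swap_apply_eq_iff, Equiv.swap_apply_left]

/-- Exchanging `0` and `s z` is an involution, so the gate that writes the time also erases it. -/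
theorem timeGate_spread' [NeZero m] (O : Oracles N m D) (s : S → Fin m) (y : S → Fin D)
    (ψ : S → ℂ) :
    (Step.gate (timeGate e s)).act O (spread e s y ψ) = spread e 0 y ψ := by
  funext ⟨r, t, w, o⟩
  simp only [Step.act, timeGate, permMatrix_mulVec, Function.comp, timePerm, Equiv.coe_fn_mk,
    spread, Pi.zero_apply]
  congr 2
  rw [Equiv.swap_apply_eq_iff, Equiv.swap_apply_right]

theorem queryPrep_spread (O : Oracles N m D) [Fintype S] [DecidableEq S] (inv : Bool)
    (s : Fin m) (y : Fin D) (G : Matrix S S ℂ)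
    (hG : ∀ z z', G z z' = if (e z).2 = (e z').2 then orInv O.prep inv (e z).1 (e z').1 else 0)
    (ψ : S → ℂ) :
    (Step.queryPrep (fun _ => true) inv).act O (spread e (fun _ => s) (fun _ => y) ψ)
      = spread e (fun _ => s) (fun _ => y) (G *ᵥ ψ) := by
  funext ⟨r, t, w, o⟩
  simp only [Step.act, spread, if_true, mulVec, dotProduct]
  split_ifs with h
  · rw [← e.symm.sum_comp, Fintype.sum_prod_type]
    refine Finset.sum_congr rfl fun z _ => ?_
    simp [hG]
  · simp

/-! ### Implementable families of unitaries -/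

/-- The steps `l` carry out the matrix `G d` on the grid and work registers, starting and ending
with clean time and word registers, for all oracles with data `d`. -/
def Realizes [NeZero m] [NeZero D] [Fintype S] (l : List (Step N m D a))
    (G : OracleData N m D → Matrix S S ℂ) : Prop :=
  ∀ (O : Oracles N m D) (d : OracleData N m D), O.Matches d → ∀ ψ : S → ℂ,
    l.foldl (fun φ s => s.act O φ) (spread e 0 0 ψ) = spread e 0 0 (G d *ᵥ ψ)

/-- The unitaries `G d` and their inverses can be implemented with at most `b` queries to the
potential oracles and `c` queries to the preparation oracle. -/
def Impl [NeZero m] [NeZero D] [Fintype S] [DecidableEq S]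
    (G : OracleData N m D → unitaryGroup S ℂ) (b c : ℕ) : Prop :=
  ∃ l l' : List (Step N m D a),
    Realizes e l (fun d => (G d : Matrix S S ℂ)) ∧
    Realizes e l' (fun d => ((G d)⁻¹ : unitaryGroup S ℂ)) ∧
    l.countP Step.isPotentialQuery ≤ b ∧ l'.countP Step.isPotentialQuery ≤ b ∧
    l.countP Step.isPrepQuery ≤ c ∧ l'.countP Step.isPrepQuery ≤ c

variable [NeZero m] [NeZero D] [Fintype S] [DecidableEq S]
variable {e} {G G' : OracleData N m D → unitaryGroup S ℂ} {b b' c c' : ℕ}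

theorem Impl.inv (h : Impl e G b c) : Impl e (fun d => (G d)⁻¹) b c := by
  obtain ⟨l, l', h1, h2, h3, h4, h5, h6⟩ := h
  exact ⟨l', l, h2, by simpa using h1, h4, h3, h6, h5⟩

theorem Impl.mul (h : Impl e G b c) (h' : Impl e G' b' c') :
    Impl e (fun d => G d * G' d) (b + b') (c + c') := by
  obtain ⟨l, l', h1, h2, h3, h4, h5, h6⟩ := h
  obtain ⟨k, k', g1, g2, g3, g4, g5, g6⟩ := h'
  refine ⟨k ++ l, l' ++ k', ?_, ?_, ?_, ?_, ?_, ?_⟩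
  · intro O d hO ψ
    rw [List.foldl_append, g1 O d hO, h1 O d hO, mulVec_mulVec]; rfl
  · intro O d hO ψ
    rw [List.foldl_append, h2 O d hO, g2 O d hO, mulVec_mulVec]
    simp only [_root_.mul_inv_rev]; rfl
  all_goals (rw [List.countP_append]; omega)

theorem Impl.mono (h : Impl e G b c) (hb : b ≤ b') (hc : c ≤ c') : Impl e G b' c' := by
  obtain ⟨l, l', h1, h2, h3, h4, h5, h6⟩ := h
  exact ⟨l, l', h1, h2, h3.trans hb, h4.trans hb, h5.trans hc, h6.trans hc⟩

theorem Impl.of_eq (h : Impl e G b c) (hG : ∀ d, G' d = G d) : Impl e G' b c := by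
  rwa [funext hG]

theorem realizes_gate (U : unitaryGroup S ℂ) :
    Realizes (m := m) (D := D) e [Step.gate (blockGate e fun _ => U)]
      (fun _ => (U : Matrix S S ℂ)) := by
  intro O d _ ψ
  simp only [List.foldl_cons, List.foldl_nil]
  exact blockGate_spread e O _ _ _ (by simp) _ (by simp) ψ

theorem Impl.gate (U : unitaryGroup S ℂ) : Impl (m := m) (D := D) e (fun _ => U) 0 0 :=
  ⟨_, _, realizes_gate U, realizes_gate U⁻¹, by simp [Step.isPotentialQuery],
    by simp [Step.isPotentialQuery], by simp [Step.isPrepQuery], by simp [Step.isPrepQuery]⟩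

/-- Compute the word, act under its control, uncompute. The unitary must preserve the grid point, so
that the word is still the correct one when it is erased. -/
theorem realizes_VI (U : Fin D → unitaryGroup S ℂ)
    (hU : ∀ y z z', (e z).1 ≠ (e z').1 → (U y : Matrix S S ℂ) z z' = 0)
    (G : OracleData N m D → Matrix S S ℂ)
    (hG : ∀ d z z', G d z z' = (U (d.yI (e z).1) : Matrix S S ℂ) z z') :
    Realizes e [Step.queryVI (fun _ => true) false, Step.gate (blockGate e fun k => U k.2),
      Step.queryVI (fun _ => true) true] G := by
  intro O d hO ψ
  simp only [List.foldl_cons, List.foldl_nil]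
  rw [queryVI_spread e hO _ (by simp), blockGate_spread e O _ _ _ ?_ (G d) ?_,
    queryVI_inv_spread e hO _ (by simp)]
  · intro k z z' h
    refine hU _ _ _ fun h' => ?_
    simp [h'] at h
  · intro z z'
    rw [hG]

theorem Impl.queryVI (U : Fin D → unitaryGroup S ℂ)
    (hU : ∀ y z z', (e z).1 ≠ (e z').1 → (U y : Matrix S S ℂ) z z' = 0)
    (hG : ∀ d z z', (G d : Matrix S S ℂ) z z' = (U (d.yI (e z).1) : Matrix S S ℂ) z z') :
    Impl e G 2 0 := by
  refine ⟨_, _, realizes_VI U hU _ hG, realizes_VI (fun y => (U y)⁻¹) ?_ _ ?_, ?_, ?_, ?_, ?_⟩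
  · intro y z z' h
    have := hU y z' z (Ne.symm h)
    simp [star_apply, this]
  · intro d z z'
    have h1 := hG d z' z
    -- The adjoint reads the word at the other index. At equal grid points both words agree; at
    -- different ones both entries vanish.
    by_cases hz : (e z).1 = (e z').1
    · simp [star_apply, h1, hz]
    · have h2 := hU (d.yI (e z').1) z' z (Ne.symm hz)
      have h3 := hU (d.yI (e z).1) z' z (Ne.symm hz)
      simp [star_apply, h1, h2, h3]
  all_goals simp [List.countP_cons, Step.isPotentialQuery, Step.isPrepQuery]

/-- The diagonal unitary with given phases. -/
def phaseGate {ι : Type} [Fintype ι] [DecidableEq ι] (φ : ι → unitary ℂ) : unitaryGroup ι ℂ :=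
  ⟨diagonal fun i => (φ i : ℂ), by
    rw [mem_unitaryGroup_iff, star_eq_conjTranspose, diagonal_conjTranspose, diagonal_mul_diagonal,
      ← diagonal_one]
    congr 1
    funext i
    exact Unitary.mul_star_self_of_mem (φ i).2⟩

theorem phaseGate_inv {ι : Type} [Fintype ι] [DecidableEq ι] (φ : ι → unitary ℂ) :
    (phaseGate φ)⁻¹ = phaseGate (fun i => (φ i)⁻¹) := by
  apply Subtype.ext
  change star (diagonal fun i => (φ i : ℂ)) = diagonal _
  rw [star_eq_conjTranspose, diagonal_conjTranspose]
  rfl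

theorem realizes_VR (s : S → Fin m) (φ : Fin D → S → unitary ℂ) :
    Realizes e [Step.gate (timeGate e s), Step.queryVR (fun _ => true) false,
      Step.gate (blockGate e fun k => phaseGate (φ k.2)),
      Step.queryVR (fun _ => true) true, Step.gate (timeGate e s)]
      (fun d => (phaseGate fun z => φ (d.yR (e z).1 (s z)) z : Matrix S S ℂ)) := by
  intro O d hO ψ
  simp only [List.foldl_cons, List.foldl_nil]
  rw [timeGate_spread, queryVR_spread e hO, blockGate_spread e O _ _ _ ?_
    (phaseGate fun z => φ (d.yR (e z).1 (s z)) z : unitaryGroup S ℂ) ?_, queryVR_inv_spread e hO,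
    timeGate_spread']
  · intro k z z' h
    have : z ≠ z' := by rintro rfl; simp at h
    simp [phaseGate, this]
  · intro z z'
    by_cases h : z = z'
    · subst h; simp [phaseGate]
    · simp [phaseGate, h]

theorem Impl.queryVR (s : S → Fin m) (φ : Fin D → S → unitary ℂ) :
    Impl e (fun d => phaseGate fun z => φ (d.yR (e z).1 (s z)) z) 2 0 := by
  refine ⟨_, [Step.gate (timeGate e s), Step.queryVR (fun _ => true) false,
      Step.gate (blockGate e fun k => phaseGate fun z => (φ k.2 z)⁻¹),
      Step.queryVR (fun _ => true) true, Step.gate (timeGate e s)],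
      realizes_VR s φ, ?_, ?_, ?_, ?_, ?_⟩
  · simp only [phaseGate_inv]
    exact realizes_VR s fun y z => (φ y z)⁻¹
  all_goals simp [List.countP_cons, Step.isPotentialQuery, Step.isPrepQuery]

theorem Impl.queryPrep
    (hG : ∀ d z z', (G d : Matrix S S ℂ) z z' =
      if (e z).2 = (e z').2 then (d.prep : Matrix (Fin N) (Fin N) ℂ) (e z).1 (e z').1 else 0) :
    Impl e G 0 1 := by
  refine ⟨[Step.queryPrep (fun _ => true) false], [Step.queryPrep (fun _ => true) true],
    ?_, ?_, ?_, ?_, ?_, ?_⟩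
  · intro O d hO ψ
    simp only [List.foldl_cons, List.foldl_nil]
    refine queryPrep_spread e O false 0 0 _ ?_ ψ
    intro z z'
    rw [hG, ← hO.prep]; rfl
  · intro O d hO ψ
    simp only [List.foldl_cons, List.foldl_nil]
    refine queryPrep_spread e O true 0 0 _ ?_ ψ
    intro z z'
    have := hG d z' z
    simp only [UnitaryGroup.inv_apply, star_apply, this, ← hO.prep, orInv, if_true]
    simp only [eq_comm (a := (e z').2)]
    split_ifs <;> simp
  all_goals simp [List.countP_cons, Step.isPotentialQuery, Step.isPrepQuery]

end Circuits

end CAP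
end

noncomputable section
namespace CAP

open Matrix

/-! ### Ordered products and their truncated expansion -/

section Dyson

variable {A : Type*}

/-- The ordered product `F (b - 1) * ⋯ * F a`. -/
def ordProd [Monoid A] (F : ℕ → A) (a b : ℕ) : A := ((List.Ico a b).map F).reverse.prod

theorem ordProd_self [Monoid A] (F : ℕ → A) (a : ℕ) : ordProd F a a = 1 := by simp [ordProd]

theorem ordProd_succ_top [Monoid A] (F : ℕ → A) {a b : ℕ} (h : a ≤ b) :
    ordProd F a (b + 1) = F b * ordProd F a b := by
  simp [ordProd, List.Ico.succ_top h]

theorem ordProd_succ_bot [Monoid A] (F : ℕ → A) {a b : ℕ} (h : a < b) :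
    ordProd F a b = ordProd F (a + 1) b * F a := by
  simp [ordProd, List.Ico.eq_cons h]

theorem ordProd_mul_ordProd [Monoid A] (F : ℕ → A) {a b c : ℕ} (h : a ≤ b) (h' : b ≤ c) :
    ordProd F b c * ordProd F a b = ordProd F a c := by
  rw [ordProd, ordProd, ordProd, ← List.prod_append, ← List.reverse_append, ← List.map_append,
    List.Ico.append_consecutive h h']

theorem ordProd_shift [Monoid A] (F : ℕ → A) (s n : ℕ) :
    ordProd (fun j => F (s + j)) 0 n = ordProd F s (s + n) := by
  induction n with
  | zero => simp [ordProd_self]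
  | succ n ih =>
    rw [ordProd_succ_top _ (Nat.zero_le _), ih, ← add_assoc, ordProd_succ_top _ (by omega)]

theorem norm_ordProd_le [NormedRing A] [NormOneClass A] {F : ℕ → A} {C : ℝ}
    (hF : ∀ j, ‖F j‖ ≤ C) {a b : ℕ} (hab : a ≤ b) : ‖ordProd F a b‖ ≤ C ^ (b - a) := by
  have hC : 0 ≤ C := (norm_nonneg _).trans (hF 0)
  induction b, hab using Nat.le_induction with
  | base => simp [ordProd_self]
  | succ b hab ih =>
    rw [ordProd_succ_top _ hab, show b + 1 - a = (b - a) + 1 by omega, pow_succ, mul_comm (C ^ _)]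
    exact (norm_mul_le _ _).trans (mul_le_mul (hF b) ih (norm_nonneg _) hC)

/-- Discrete Duhamel formula: the terms are sorted by the earliest position `j` at which `G j` is
chosen instead of `1`. -/
theorem ordProd_one_add [Ring A] (G : ℕ → A) {a n : ℕ} (h : a ≤ n) :
    ordProd (fun j => 1 + G j) a n
      = 1 + ∑ j ∈ Finset.Ico a n, ordProd (fun j => 1 + G j) (j + 1) n * G j := by
  induction h using Nat.decreasingInduction with
  | self => simp [ordProd_self]
  | of_succ a ha ih =>
    rw [Finset.sum_eq_sum_Ico_succ_bot ha, ordProd_succ_bot _ ha, mul_add, mul_one]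
    nth_rw 1 [ih]
    abel

/-- The four unitaries into which a step Hamiltonian is split are labelled by two bits. -/
abbrev Kind := Bool × Bool

/-- Coefficients of the truncated expansion: at most `κ` factors, at strictly increasing positions
from `a` on. -/
def dysonCoeff (n : ℕ) (x : ℝ) : (κ : ℕ) → ℕ → (Fin κ → Option (Fin n × Kind)) → ℝ
  | 0, _, _ => 1
  | κ + 1, a, σ =>
    match σ 0 with
    -- From position `n` on only empty slots have nonzero weight. Hence empty slots come last, and
    -- each product is counted once.
    | none => dysonCoeff n x κ n (Fin.tail σ)
    -- The factor `1 / 4` is there because a generator is the average of four unitaries.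
    | some (j, _) => if a ≤ j then x / 4 * dysonCoeff n x κ (j + 1) (Fin.tail σ) else 0

theorem dysonCoeff_nonneg (n : ℕ) {x : ℝ} (hx : 0 ≤ x) (κ a : ℕ)
    (σ : Fin κ → Option (Fin n × Kind)) : 0 ≤ dysonCoeff n x κ a σ := by
  induction κ generalizing a with
  | zero => simp [dysonCoeff]
  | succ κ ih =>
    simp only [dysonCoeff]
    split
    · exact ih _ _
    · split_ifs
      · exact mul_nonneg (by positivity) (ih _ _)
      · exact le_rfl

/-- The operator in a slot. -/
def slotOp [Monoid A] {n : ℕ} (g : ℕ → Kind → A) : Option (Fin n × Kind) → A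
  | none => 1
  | some (j, t) => g j t

/-- The product of the operators in all slots, slot `0` acting first. -/
def slotProd [Monoid A] {n κ : ℕ} (g : ℕ → Kind → A) (σ : Fin κ → Option (Fin n × Kind)) : A :=
  (List.ofFn fun i => slotOp g (σ i)).reverse.prod

theorem slotProd_succ [Monoid A] {n κ : ℕ} (g : ℕ → Kind → A)
    (σ : Fin (κ + 1) → Option (Fin n × Kind)) :
    slotProd g σ = slotProd g (Fin.tail σ) * slotOp g (σ 0) := by
  simp [slotProd, List.ofFn_succ, Fin.tail]

/-- The truncated expansion. -/
def dysonSum [Ring A] [Algebra ℝ A] (n : ℕ) (x : ℝ) (g : ℕ → Kind → A) (κ a : ℕ) : A :=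
  ∑ σ : Fin κ → Option (Fin n × Kind), dysonCoeff n x κ a σ • slotProd g σ

/-- Splitting off slot `0` gives the recursion of `ordProd_one_add`, truncated: the first summand is
`1` by `dysonSum_last`. -/
theorem dysonSum_succ [Ring A] [Algebra ℝ A] (n : ℕ) (x : ℝ) (g : ℕ → Kind → A) (κ a : ℕ) :
    dysonSum n x g (κ + 1) a = dysonSum n x g κ n +
      ∑ j ∈ Finset.Ico a n, dysonSum n x g κ (j + 1) * (x • (1 / 4 : ℝ) • ∑ t, g j t) := by
  have h1 : ∑ j ∈ Finset.Ico a n, dysonSum n x g κ (j + 1) * (x • (1 / 4 : ℝ) • ∑ t, g j t)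
      = ∑ j : Fin n, if a ≤ j then
          dysonSum n x g κ (j + 1) * (x • (1 / 4 : ℝ) • ∑ t, g j t) else 0 := by
    rw [Fin.sum_univ_eq_sum_range (fun j => if a ≤ j then
          dysonSum n x g κ (j + 1) * (x • (1 / 4 : ℝ) • ∑ t, g j t) else 0), ← Finset.sum_filter]
    congr 1
    ext j; simp [and_comm]
  rw [h1, dysonSum, ← (Fin.consEquiv fun _ => Option (Fin n × Kind)).sum_comp,
    Fintype.sum_prod_type, Fintype.sum_option]
  simp only [Fin.consEquiv_apply, slotProd_succ, dysonCoeff, Fin.cons_zero, slotOp,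
    mul_one]
  congr 1
  rw [Fintype.sum_prod_type]
  refine Finset.sum_congr rfl fun j _ => ?_
  split_ifs with h
  · simp only [Finset.smul_sum, Finset.mul_sum, dysonSum, Finset.sum_mul]
    refine Finset.sum_congr rfl fun t _ => Finset.sum_congr rfl fun σ _ => ?_
    rw [smul_mul_assoc, mul_smul_comm, mul_smul_comm, smul_smul, smul_smul]
    rw [show Fin.tail ((Fin.consEquiv fun _ => Option (Fin n × Kind)) (some (j, t), σ)) = σ
      from rfl]
    congr 1
    ring
  · simp

theorem dysonSum_last [Ring A] [Algebra ℝ A] (n : ℕ) (x : ℝ) (g : ℕ → Kind → A) (κ : ℕ) :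
    dysonSum n x g κ n = 1 := by
  induction κ with
  | zero => simp [dysonSum, dysonCoeff, slotProd]
  | succ κ ih => simp [dysonSum_succ, ih]

theorem dysonSum_zero [Ring A] [Algebra ℝ A] (n : ℕ) (x : ℝ) (g : ℕ → Kind → A) (a : ℕ) :
    dysonSum n x g 0 a = 1 := by
  simp [dysonSum, dysonCoeff, slotProd]

/-- The sum of the weights is the expansion with all unitaries replaced by the number `1`, so the
recursion applies: if the previous value is at most `2`, the next is at most `1 + n * (2 * x) ≤ 2`.
-/
theorem sum_dysonCoeff_mem (n : ℕ) {x : ℝ} (hx : 0 ≤ x) (hn : n * x ≤ 1 / 2) (κ a : ℕ)  :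
    ∑ σ, dysonCoeff n x κ a σ ∈ Set.Icc (1 : ℝ) 2 := by
  have h : ∑ σ, dysonCoeff n x κ a σ = dysonSum n x (fun _ _ => (1 : ℝ)) κ a := by
    have h1 : ∀ {κ} (σ : Fin κ → Option (Fin n × Kind)), slotProd (fun _ _ => (1 : ℝ)) σ = 1 := by
      intro κ σ
      have : ∀ o : Option (Fin n × Kind), slotOp (fun _ _ => (1 : ℝ)) o = 1 := by
        rintro (_ | _) <;> rfl
      simp [slotProd, this]
    simp [dysonSum, h1]
  rw [h]
  clear h
  induction κ generalizing a with
  | zero => simp [dysonSum_zero]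
  | succ κ ih =>
    rw [dysonSum_succ, dysonSum_last]
    have h2 : (∑ t : Kind, (1 : ℝ)) = 4 := by simp [Fintype.card_prod]
    simp only [h2, smul_eq_mul]
    have h3 : 0 ≤ ∑ j ∈ Finset.Ico a n,
        dysonSum n x (fun _ _ => (1 : ℝ)) κ (j + 1) * (x * (1 / 4 * 4)) :=
      Finset.sum_nonneg fun j _ => mul_nonneg (by linarith [(ih (j + 1)).1]) (by linarith)
    have h4 : ∑ j ∈ Finset.Ico a n,
        dysonSum n x (fun _ _ => (1 : ℝ)) κ (j + 1) * (x * (1 / 4 * 4))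
          ≤ ∑ j ∈ Finset.Ico a n, 2 * x := Finset.sum_le_sum fun j _ => by
      have := (ih (j + 1)).2
      nlinarith
    rw [Finset.sum_const, Nat.card_Ico, nsmul_eq_mul] at h4
    have h5 : ((n - a : ℕ) : ℝ) ≤ n := by exact_mod_cast Nat.sub_le _ _
    constructor
    · linarith
    · nlinarith [mul_le_mul_of_nonneg_right h5 hx]

variable [NormedRing A] [NormOneClass A] [NormedAlgebra ℝ A]

/-- Product and truncated sum obey the same recursion, so each additional slot multiplies the error
by at most `n * x ≤ 1 / 2`. The recursion starts from error `1`, as the products are bounded by `exp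
(1 / 2) ≤ 2`. -/
theorem norm_ordProd_sub_dysonSum_le {n : ℕ} {x : ℝ} (hx : 0 ≤ x) (hn : n * x ≤ 1 / 2)
    {g : ℕ → Kind → A} (hg : ∀ j t, ‖g j t‖ ≤ 1) (κ : ℕ) {a : ℕ} (ha : a ≤ n) :
    ‖ordProd (fun j => 1 + x • (1 / 4 : ℝ) • ∑ t, g j t) a n - dysonSum n x g κ a‖
      ≤ (1 / 2) ^ κ := by
  have hG : ∀ j, ‖x • (1 / 4 : ℝ) • ∑ t, g j t‖ ≤ x := fun j => by
    have h2 : (∑ t : Kind, (1 : ℝ)) = 4 := by simp [Fintype.card_prod]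
    have : ‖∑ t, g j t‖ ≤ 4 := h2 ▸ norm_sum_le_of_le _ fun t _ => hg j t
    rw [norm_smul, norm_smul, Real.norm_of_nonneg hx, Real.norm_of_nonneg (by norm_num)]
    nlinarith
  have key : ∀ (M : ℕ → A) (C : ℝ), (∀ j ≤ n, ‖M j‖ ≤ C) → ∀ a,
      ‖∑ j ∈ Finset.Ico a n, M (j + 1) * (x • (1 / 4 : ℝ) • ∑ t, g j t)‖ ≤ C / 2 := by
    intro M C hM a
    have hC : 0 ≤ C := (norm_nonneg _).trans (hM 0 (Nat.zero_le _))
    have h5 : ((n - a : ℕ) : ℝ) ≤ n := by exact_mod_cast Nat.sub_le _ _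
    calc _ ≤ ∑ j ∈ Finset.Ico a n, C * x := norm_sum_le_of_le _ fun j hj =>
          (norm_mul_le _ _).trans (mul_le_mul (hM _ (by simp at hj; omega)) (hG j)
            (norm_nonneg _) hC)
      _ = (n - a : ℕ) * x * C := by rw [Finset.sum_const, Nat.card_Ico, nsmul_eq_mul]; ring
      _ ≤ _ := by nlinarith [mul_le_mul_of_nonneg_right h5 hx]
  have hE : ∀ a ≤ n, ‖ordProd (fun j => 1 + x • (1 / 4 : ℝ) • ∑ t, g j t) a n‖ ≤ 2 := by
    intro a ha
    have h1 : ∀ j, ‖1 + x • (1 / 4 : ℝ) • ∑ t, g j t‖ ≤ 1 + x := fun j =>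
      (norm_add_le _ _).trans (by rw [norm_one]; linarith [hG j])
    refine (norm_ordProd_le h1 ha).trans ?_
    calc (1 + x) ^ (n - a) ≤ (1 + x) ^ n := pow_le_pow_right₀ (by linarith) (Nat.sub_le _ _)
      _ ≤ Real.exp x ^ n := pow_le_pow_left₀ (by linarith) (by linarith [Real.add_one_le_exp x]) _
      _ = Real.exp (n * x) := by rw [← Real.exp_nat_mul]
      _ ≤ Real.exp (1 / 2) := Real.exp_le_exp.2 hn
      _ ≤ 2 := by
        have h := Real.exp_bound_div_one_sub_of_interval (x := 1 / 2) (by norm_num) (by norm_num)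
        norm_num at h ⊢
        exact h
  induction κ generalizing a with
  | zero =>
    rw [dysonSum_zero, ordProd_one_add _ ha, add_sub_cancel_left]
    simpa using key (fun j => ordProd (fun j => 1 + x • (1 / 4 : ℝ) • ∑ t, g j t) j n) 2 hE a
  | succ κ ih =>
    rw [dysonSum_succ, dysonSum_last, ordProd_one_add _ ha, add_sub_add_left_eq_sub,
      ← Finset.sum_sub_distrib]
    simp only [← sub_mul]
    have := key (fun j => ordProd (fun j => 1 + x • (1 / 4 : ℝ) • ∑ t, g j t) j n
      - dysonSum n x g κ j) _ (fun j hj => ih hj) a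
    rw [pow_succ]
    simpa [div_eq_mul_inv] using this

end Dyson

end CAP
end

noncomputable section
namespace CAP

open Matrix

/-! ### Linear combinations of unitaries and oblivious amplitude amplification -/

section LCU

variable {Y I : Type} [Fintype Y] [DecidableEq Y] [Fintype I] [DecidableEq I]

omit [DecidableEq I] in
theorem l2_opNorm_le_one_of_isometry {V : Matrix I Y ℂ} (h : Vᴴ * V = 1) : ‖V‖ ≤ 1 := by
  have h1 : ‖(1 : Matrix Y Y ℂ)‖ ≤ 1 := by
    rcases isEmpty_or_nonempty Y with hY | hY
    · rw [Subsingleton.elim (1 : Matrix Y Y ℂ) 0, norm_zero]; exact zero_le_one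
    · exact norm_one.le
  have h2 := l2_opNorm_conjTranspose_mul_self V
  rw [h] at h2
  nlinarith [norm_nonneg V]

theorem l2_opNorm_unitary_le_one (U : unitaryGroup Y ℂ) : ‖(U : Matrix Y Y ℂ)‖ ≤ 1 :=
  l2_opNorm_le_one_of_isometry (mem_unitaryGroup_iff'.1 U.2)

/-- The embedding `ψ ↦ ψ ⊗ |i₀⟩`. -/
def inj (Y : Type) [DecidableEq Y] (i₀ : I) : Matrix (Y × I) Y ℂ :=
  Matrix.of fun p y => if p = (y, i₀) then 1 else 0

theorem mul_inj_apply {Z : Type} (i₀ : I) (M : Matrix Z (Y × I) ℂ) (z : Z) (y : Y) :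
    (M * inj Y i₀) z y = M z (y, i₀) := by
  simp [inj, mul_apply]

theorem inj_conjTranspose_mul_apply {Z : Type} (i₀ : I) (M : Matrix (Y × I) Z ℂ) (z : Z) (y : Y) :
    ((inj Y i₀)ᴴ * M) y z = M (y, i₀) z := by
  simp [inj, mul_apply, apply_ite]

theorem inj_isometry (i₀ : I) : (inj Y i₀)ᴴ * inj Y i₀ = 1 := by
  ext y y'
  rw [inj_conjTranspose_mul_apply]
  simp [inj, one_apply, Prod.ext_iff]

/-- The reflection `1 - 2 |i₀⟩⟨i₀|`. -/
def zeroReflection (Y : Type) [Fintype Y] [DecidableEq Y] (i₀ : I) : unitaryGroup (Y × I) ℂ :=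
  ⟨1 - (2 : ℂ) • (inj Y i₀ * (inj Y i₀)ᴴ), by
    have h := inj_isometry (Y := Y) i₀
    have h2 : inj Y i₀ * (inj Y i₀)ᴴ * (inj Y i₀ * (inj Y i₀)ᴴ) = inj Y i₀ * (inj Y i₀)ᴴ := by
      rw [Matrix.mul_assoc, ← Matrix.mul_assoc (inj Y i₀)ᴴ, h, Matrix.one_mul]
    rw [mem_unitaryGroup_iff, star_eq_conjTranspose, conjTranspose_sub, conjTranspose_one,
      conjTranspose_smul, conjTranspose_mul, conjTranspose_conjTranspose]
    simp only [sub_mul, mul_sub, one_mul, mul_one, smul_mul_assoc, mul_smul_comm, h2, star_ofNat]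
    module⟩

/-- Oblivious amplitude amplification: one round with the block encoding `B`. -/
def amplify (i₀ : I) (B : unitaryGroup (Y × I) ℂ) : unitaryGroup (Y × I) ℂ :=
  -(B * zeroReflection Y i₀ * B⁻¹ * zeroReflection Y i₀ * B)

/-- The amplitude `1 / 2` is `sin (π / 6)`, and one round triples the angle to `π / 2`. For unitary
`U` the round is therefore exact. As an algebraic identity this persists for every `U`, with the
defect `1 - Uᴴ * U` as the only error. -/
theorem amplify_mul_inj (i₀ : I) (B : unitaryGroup (Y × I) ℂ) {U : Matrix Y Y ℂ}
    (hU : (inj Y i₀)ᴴ * (B : Matrix (Y × I) (Y × I) ℂ) * inj Y i₀ = (1 / 2 : ℂ) • U) :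
    (amplify i₀ B : Matrix (Y × I) (Y × I) ℂ) * inj Y i₀ - inj Y i₀ * U
      = (B : Matrix (Y × I) (Y × I) ℂ) * inj Y i₀ * (1 - Uᴴ * U) := by
  set i := inj Y i₀
  set b : Matrix (Y × I) (Y × I) ℂ := (B : Matrix (Y × I) (Y × I) ℂ)
  have hb : bᴴ * b = 1 := mem_unitaryGroup_iff'.1 B.2
  have hb' : b * bᴴ = 1 := mem_unitaryGroup_iff.1 B.2
  have hU' : iᴴ * bᴴ * i = (1 / 2 : ℂ) • Uᴴ := by
    have := congrArg conjTranspose hU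
    rw [conjTranspose_mul, conjTranspose_mul, conjTranspose_conjTranspose, conjTranspose_smul]
      at this
    rw [Matrix.mul_assoc, this]
    simp
  have hi : iᴴ * i = 1 := inj_isometry i₀
  have e1 : (1 - (2 : ℂ) • (i * iᴴ)) * (b * i) = b * i - i * U := by
    rw [Matrix.sub_mul, Matrix.one_mul, Matrix.smul_mul, Matrix.mul_assoc, ← Matrix.mul_assoc iᴴ,
      hU, Matrix.mul_smul, smul_smul]
    norm_num
  have e2 : bᴴ * (b * i - i * U) = i - bᴴ * (i * U) := by
    rw [Matrix.mul_sub, ← Matrix.mul_assoc, hb, Matrix.one_mul]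
  have e3 : (1 - (2 : ℂ) • (i * iᴴ)) * (i - bᴴ * (i * U))
      = -i - bᴴ * (i * U) + i * (Uᴴ * U) := by
    have h1 : i * iᴴ * i = i := by rw [Matrix.mul_assoc, hi, Matrix.mul_one]
    have h2 : i * iᴴ * (bᴴ * (i * U)) = (1 / 2 : ℂ) • (i * (Uᴴ * U)) := by
      rw [Matrix.mul_assoc, ← Matrix.mul_assoc bᴴ, ← Matrix.mul_assoc iᴴ, ← Matrix.mul_assoc iᴴ,
        hU', Matrix.smul_mul, Matrix.mul_smul]
    rw [Matrix.sub_mul, Matrix.one_mul, Matrix.smul_mul, Matrix.mul_sub, h1, h2]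
    module
  have e4 : (amplify i₀ B : Matrix (Y × I) (Y × I) ℂ) * i
      = -(b * ((1 - (2 : ℂ) • (i * iᴴ)) * (bᴴ * ((1 - (2 : ℂ) • (i * iᴴ)) * (b * i))))) := by
    have : (amplify i₀ B : Matrix (Y × I) (Y × I) ℂ)
        = -(b * (1 - (2 : ℂ) • (i * iᴴ)) * bᴴ * (1 - (2 : ℂ) • (i * iᴴ)) * b) := rfl
    rw [this, Matrix.neg_mul]
    simp only [Matrix.mul_assoc]
  rw [e4, e1, e2, e3]
  have h5 : b * (bᴴ * (i * U)) = i * U := by rw [← Matrix.mul_assoc, hb', Matrix.one_mul]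
  simp only [Matrix.mul_add, Matrix.mul_sub, Matrix.mul_neg, h5, Matrix.mul_one, Matrix.mul_assoc]
  abel

/-- Controlled unitaries. -/
def blockU : (I → unitaryGroup Y ℂ) →* unitaryGroup (Y × I) ℂ where
  toFun V := ⟨blockDiagonal fun i => (V i : Matrix Y Y ℂ), by
    rw [mem_unitaryGroup_iff, star_eq_conjTranspose, blockDiagonal_conjTranspose,
      ← blockDiagonal_mul]
    have : (fun k => (V k : Matrix Y Y ℂ) * (V k : Matrix Y Y ℂ)ᴴ) = 1 := by
      funext k
      exact mem_unitaryGroup_iff.1 (V k).2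
    rw [this, blockDiagonal_one]⟩
  map_one' := Subtype.ext blockDiagonal_one
  map_mul' V V' := Subtype.ext (blockDiagonal_mul (fun i => (V i : Matrix Y Y ℂ))
    (fun i => (V' i : Matrix Y Y ℂ)))

theorem blockU_apply (V : I → unitaryGroup Y ℂ) :
    (blockU V : Matrix (Y × I) (Y × I) ℂ) = blockDiagonal fun i => (V i : Matrix Y Y ℂ) := rfl

/-- `1 ⊗ R`. -/
def tensorU (Y : Type) [Fintype Y] [DecidableEq Y] (R : unitaryGroup I ℂ) :
    unitaryGroup (Y × I) ℂ :=
  ⟨kroneckerMap (· * ·) (1 : Matrix Y Y ℂ) (R : Matrix I I ℂ),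
    kronecker_mem_unitary (one_mem _) R.2⟩

theorem tensorU_apply (R : unitaryGroup I ℂ) (y y' : Y) (i i' : I) :
    (tensorU Y R : Matrix (Y × I) (Y × I) ℂ) (y, i) (y', i')
      = if y = y' then (R : Matrix I I ℂ) i i' else 0 := by
  simp [tensorU, one_apply]

/-- Linear combination of the unitaries `V i`. -/
def lcu (R : unitaryGroup I ℂ) (V : I → unitaryGroup Y ℂ) : unitaryGroup (Y × I) ℂ :=
  (tensorU Y R)⁻¹ * blockU V * tensorU Y R

theorem inj_lcu_inj (i₀ : I) (R : unitaryGroup I ℂ) (V : I → unitaryGroup Y ℂ) (p : I → ℝ)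
    (hp : ∀ i, 0 ≤ p i) (hR : ∀ i, (R : Matrix I I ℂ) i i₀ = (√(p i) : ℝ)) :
    (inj Y i₀)ᴴ * (lcu R V : Matrix (Y × I) (Y × I) ℂ) * inj Y i₀
      = ∑ i, p i • (V i : Matrix Y Y ℂ) := by
  ext y y'
  rw [mul_inj_apply, inj_conjTranspose_mul_apply]
  have : (lcu R V : Matrix (Y × I) (Y × I) ℂ)
      = (tensorU Y R : Matrix (Y × I) (Y × I) ℂ)ᴴ
        * ((blockU V : Matrix (Y × I) (Y × I) ℂ) * (tensorU Y R : Matrix (Y × I) (Y × I) ℂ)) := by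
    rw [← Matrix.mul_assoc]; rfl
  rw [this, mul_apply, Fintype.sum_prod_type]
  simp only [conjTranspose_apply, tensorU_apply, mul_apply, Fintype.sum_prod_type, blockU_apply,
    blockDiagonal_apply, Matrix.sum_apply, Matrix.smul_apply]
  rw [Finset.sum_eq_single y (by intro b _ hb; simp [hb]) (by simp)]
  refine Finset.sum_congr rfl fun i _ => ?_
  rw [Finset.sum_eq_single y' (by intro b _ hb; simp [hb]) (by simp),
    Finset.sum_eq_single i (by intro b _ hb; simp [hb.symm]) (by simp)]
  simp only [if_true, hR, Complex.real_smul]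
  have h2 : ((√(p i) : ℝ) : ℂ) * ((√(p i) : ℝ) : ℂ) = (p i : ℂ) := by
    rw [← Complex.ofReal_mul, Real.mul_self_sqrt (hp i)]
  rw [← h2]
  simp only [RCLike.star_def, Complex.conj_ofReal]
  ring

theorem exists_unitary_col (i₀ : I) (v : I → ℂ) (hv : ∑ i, ‖v i‖ ^ 2 = 1) :
    ∃ R : unitaryGroup I ℂ, ∀ i, (R : Matrix I I ℂ) i i₀ = v i := by
  let w : EuclideanSpace ℂ I := WithLp.toLp 2 v
  have hw : ‖w‖ = 1 := by
    rw [EuclideanSpace.norm_eq]; simp [w, hv]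
  obtain ⟨b, hb⟩ := Orthonormal.exists_orthonormalBasis_extension_of_card_eq (𝕜 := ℂ)
    (E := EuclideanSpace ℂ I) (ι := I) (by simp) (v := fun _ => w) (s := {i₀})
    ⟨fun _ => by simp [hw], fun i j hij => (hij (Subsingleton.elim _ _)).elim⟩
  refine ⟨⟨_, (EuclideanSpace.basisFun I ℂ).toMatrix_orthonormalBasis_mem_unitary b⟩, fun i => ?_⟩
  have := hb i₀ rfl
  simp [Module.Basis.toMatrix_apply, this, w]

theorem exists_unitary_sqrt (i₀ : I) (p : I → ℝ) (hp : ∀ i, 0 ≤ p i) (h1 : ∑ i, p i = 1) :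
    ∃ R : unitaryGroup I ℂ, ∀ i, (R : Matrix I I ℂ) i i₀ = (√(p i) : ℝ) := by
  refine exists_unitary_col i₀ _ ?_
  rw [← h1]
  refine Finset.sum_congr rfl fun i _ => ?_
  rw [Complex.norm_real, Real.norm_eq_abs, sq_abs, Real.sq_sqrt (hp i)]

end LCU

/-! ### Products of nearly unitary operators -/

section NearlyUnitary

variable {A : Type*} [NormedRing A] [StarRing A]

/-- For skew-adjoint `G` the first-order terms cancel. So `L` steps deviate from unitarity by order
`L * x ^ 2`, which vanishes as the steps are refined. -/
theorem norm_star_one_add_smul_mul_sub_one_le [NormedAlgebra ℝ A] [StarModule ℝ A] {G : A} {x : ℝ}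
    (hG : star G = -G) (hG1 : ‖G‖ ≤ 1) : ‖star (1 + x • G) * (1 + x • G) - 1‖ ≤ x ^ 2 := by
  have h : star (1 + x • G) * (1 + x • G) - 1 = -(x ^ 2 • (G * G)) := by
    rw [star_add, star_one, star_smul, hG, star_trivial]
    simp only [mul_add, add_mul, mul_one, one_mul, smul_neg, neg_mul, smul_mul_assoc,
      mul_smul_comm, sq]
    module
  rw [h, norm_neg, norm_smul, Real.norm_of_nonneg (sq_nonneg x)]
  have : ‖G * G‖ ≤ 1 := (norm_mul_le _ _).trans (by nlinarith [norm_nonneg G])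
  nlinarith [sq_nonneg x]

variable [NormOneClass A] [CStarRing A]

theorem norm_star_ordProd_mul_sub_one_le {F : ℕ → A} {η : ℝ}
    (hF : ∀ j, ‖star (F j) * F j - 1‖ ≤ η) {a b : ℕ} (hab : a ≤ b) :
    ‖star (ordProd F a b) * ordProd F a b - 1‖ ≤ (1 + η) ^ (b - a) - 1 := by
  have hη : 0 ≤ η := (norm_nonneg _).trans (hF 0)
  induction b, hab using Nat.le_induction with
  | base => simp [ordProd_self]
  | succ b hab ih =>
    rw [ordProd_succ_top _ hab, show b + 1 - a = (b - a) + 1 by omega]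
    set E := ordProd F a b
    have h1 : star (F b * E) * (F b * E) - 1
        = star E * (star (F b) * F b - 1) * E + (star E * E - 1) := by
      rw [star_mul]; noncomm_ring
    have h2 : ‖E‖ * ‖E‖ ≤ (1 + η) ^ (b - a) := by
      rw [← CStarRing.norm_star_mul_self]
      calc ‖star E * E‖ = ‖(star E * E - 1) + 1‖ := by rw [sub_add_cancel]
        _ ≤ ‖star E * E - 1‖ + ‖(1 : A)‖ := norm_add_le _ _
        _ ≤ _ := by rw [norm_one]; linarith
    have h3 : ‖star E * (star (F b) * F b - 1) * E‖ ≤ η * (1 + η) ^ (b - a) := by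
      calc _ ≤ ‖star E‖ * ‖star (F b) * F b - 1‖ * ‖E‖ :=
            (norm_mul_le _ _).trans (mul_le_mul_of_nonneg_right (norm_mul_le _ _) (norm_nonneg _))
        _ = ‖star (F b) * F b - 1‖ * (‖E‖ * ‖E‖) := by rw [norm_star]; ring
        _ ≤ _ := mul_le_mul (hF b) h2 (by positivity) hη
    rw [h1, pow_succ]
    refine (norm_add_le _ _).trans ?_
    linarith

theorem norm_sq_ordProd_le {F : ℕ → A} {η : ℝ}
    (hF : ∀ j, ‖star (F j) * F j - 1‖ ≤ η) {a b : ℕ} (hab : a ≤ b) :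
    ‖ordProd F a b‖ ^ 2 ≤ (1 + η) ^ (b - a) := by
  rw [sq, ← CStarRing.norm_star_mul_self]
  calc _ = ‖(star (ordProd F a b) * ordProd F a b - 1) + 1‖ := by rw [sub_add_cancel]
    _ ≤ ‖star (ordProd F a b) * ordProd F a b - 1‖ + ‖(1 : A)‖ := norm_add_le _ _
    _ ≤ _ := by rw [norm_one]; linarith [norm_star_ordProd_mul_sub_one_le hF hab]

end NearlyUnitary

/-! ### One segment -/

section Segment

variable {Y : Type} [Fintype Y] [DecidableEq Y]

/-- The ancilla register of a segment. -/
abbrev Slots (n κ : ℕ) := (Fin κ → Option (Fin n × Kind)) × Bool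

instance (n κ : ℕ) : DecidableEq (Slots n κ) := instDecidableEqProd

/-- The zero state of the ancilla register of a segment. -/
def slot₀ (n κ : ℕ) : Slots n κ := (fun _ => none, false)

/-- The unitaries that enter the expansion of a segment. -/
def segmentTerm {n κ : ℕ} (g : ℕ → Kind → unitaryGroup Y ℂ) (σ : Slots n κ) : unitaryGroup Y ℂ :=
  (if σ.2 then -1 else 1) * slotProd g σ.1

/-- Amplification needs the block to be exactly half of the sum, while the weights add up to some
`w` in `[1, 2]`. The sign bit absorbs the difference: each coefficient is shared between the signs
`±` in the proportions `(2 / w ± 1) / 4`, which sum to `1 / w` and differ by `1 / 2`. -/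
theorem exists_segment_prep (n κ : ℕ) {x : ℝ} (hx : 0 ≤ x) (hn : n * x ≤ 1 / 2) :
    ∃ R : unitaryGroup (Slots n κ) ℂ, ∀ (Y : Type) [Fintype Y] [DecidableEq Y]
      (g : ℕ → Kind → unitaryGroup Y ℂ),
      (inj Y (slot₀ n κ))ᴴ * (lcu R (segmentTerm g) : Matrix (Y × Slots n κ) (Y × Slots n κ) ℂ) *
        inj Y (slot₀ n κ)
      = (1 / 2 : ℂ) • dysonSum n x (fun j t => (g j t : Matrix Y Y ℂ)) κ 0 := by
  obtain ⟨hw1, hw2⟩ := sum_dysonCoeff_mem n hx hn κ 0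
  set w := ∑ σ, dysonCoeff n x κ 0 σ with hw
  let p : Slots n κ → ℝ := fun σ =>
    dysonCoeff n x κ 0 σ.1 * ((2 / w + (if σ.2 then -1 else 1)) / 4)
  have hp : ∀ σ, 0 ≤ p σ := by
    intro σ
    refine mul_nonneg (dysonCoeff_nonneg n hx _ _ _) ?_
    have : 1 ≤ 2 / w := by rw [le_div_iff₀ (by linarith)]; linarith
    split_ifs <;> linarith
  have hp1 : ∑ σ, p σ = 1 := by
    rw [Fintype.sum_prod_type]
    simp only [p, Fintype.sum_bool]
    simp only [if_true, Bool.false_eq_true, if_false, ← mul_add]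
    rw [← Finset.sum_mul, ← hw]
    field_simp
    ring
  obtain ⟨R, hR⟩ := exists_unitary_sqrt (slot₀ n κ) p hp hp1
  refine ⟨R, fun Y _ _ g => ?_⟩
  rw [inj_lcu_inj _ _ _ p hp hR, Fintype.sum_prod_type, dysonSum, Finset.smul_sum]
  refine Finset.sum_congr rfl fun σ _ => ?_
  have hs : ((slotProd g σ : unitaryGroup Y ℂ) : Matrix Y Y ℂ)
      = slotProd (fun j t => (g j t : Matrix Y Y ℂ)) σ := by
    rw [slotProd, slotProd, Submonoid.coe_list_prod, List.map_reverse, List.map_ofFn]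
    congr 3
    funext i
    simp only [Function.comp]
    rcases σ i with _ | _ <;> rfl
  simp only [Fintype.sum_bool, segmentTerm, p, if_true, Bool.false_eq_true, if_false, one_mul,
    neg_mul, Unitary.coe_neg, hs]
  rw [smul_neg, ← neg_smul, ← add_smul,
    show (1 / 2 : ℂ) • dysonCoeff n x κ 0 σ • slotProd (fun j t => (g j t : Matrix Y Y ℂ)) σ
      = (1 / 2 : ℝ) • dysonCoeff n x κ 0 σ • slotProd (fun j t => (g j t : Matrix Y Y ℂ)) σ by
      ext i j; simp, smul_smul]
  congr 1
  ring

/-- The amplification identity is applied to the truncated sum `D`; its defect is small because `D`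
is close to the product `E`, which is nearly unitary. The constant is `6 = 2 + 3 + 1`: bounds for
`‖E‖` and `‖D‖` in the defect, and the final replacement of `D` by `E`. -/
theorem norm_amplify_segment_le [Nonempty Y] {n κ : ℕ} {x : ℝ} (hx : 0 ≤ x) (hn : n * x ≤ 1 / 2)
    {R : unitaryGroup (Slots n κ) ℂ} {g : ℕ → Kind → unitaryGroup Y ℂ}
    (hR : (inj Y (slot₀ n κ))ᴴ *
        (lcu R (segmentTerm g) : Matrix (Y × Slots n κ) (Y × Slots n κ) ℂ) * inj Y (slot₀ n κ)
      = (1 / 2 : ℂ) • dysonSum n x (fun j t => (g j t : Matrix Y Y ℂ)) κ 0)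
    {G : ℕ → Matrix Y Y ℂ} (hG : ∀ j, G j = (1 / 4 : ℝ) • ∑ t, (g j t : Matrix Y Y ℂ))
    (hGs : ∀ j, (G j)ᴴ = -G j) :
    ‖(amplify (slot₀ n κ) (lcu R (segmentTerm g)) :
          Matrix (Y × Slots n κ) (Y × Slots n κ) ℂ) * inj Y (slot₀ n κ)
        - inj Y (slot₀ n κ) * ordProd (fun j => 1 + x • G j) 0 n‖
      ≤ ((1 + x ^ 2) ^ n - 1) + 6 * (1 / 2) ^ κ := by
  set D := dysonSum n x (fun j t => (g j t : Matrix Y Y ℂ)) κ 0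
  set E := ordProd (fun j => 1 + x • G j) 0 n with hE
  have hg1 : ∀ j t, ‖(g j t : Matrix Y Y ℂ)‖ ≤ 1 := fun j t => l2_opNorm_unitary_le_one _
  have hG1 : ∀ j, ‖G j‖ ≤ 1 := fun j => by
    have h2 : (∑ t : Kind, (1 : ℝ)) = 4 := by simp [Fintype.card_prod]
    have : ‖∑ t, (g j t : Matrix Y Y ℂ)‖ ≤ 4 := h2 ▸ norm_sum_le_of_le _ fun t _ => hg1 j t
    rw [hG, norm_smul, Real.norm_of_nonneg (by norm_num)]
    linarith
  have h1 : ‖E - D‖ ≤ (1 / 2) ^ κ := by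
    have := norm_ordProd_sub_dysonSum_le hx hn hg1 κ (Nat.zero_le n)
    simpa only [← hG] using this
  have hF : ∀ j, ‖star (1 + x • G j) * (1 + x • G j) - 1‖ ≤ x ^ 2 := fun j =>
    norm_star_one_add_smul_mul_sub_one_le (hGs j) (hG1 j)
  have h2 : ‖Eᴴ * E - 1‖ ≤ (1 + x ^ 2) ^ n - 1 :=
    norm_star_ordProd_mul_sub_one_le hF (Nat.zero_le n)
  have h3 : ‖E‖ ≤ 2 := by
    have h4 := norm_sq_ordProd_le hF (Nat.zero_le n)
    rw [← hE, Nat.sub_zero] at h4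
    have h5 : (1 + x ^ 2) ^ n ≤ 4 := by
      calc (1 + x ^ 2) ^ n ≤ Real.exp (x ^ 2) ^ n :=
            pow_le_pow_left₀ (by positivity) (by linarith [Real.add_one_le_exp (x ^ 2)]) _
        _ = Real.exp (n * x ^ 2) := by rw [← Real.exp_nat_mul]
        _ ≤ Real.exp 1 := by
          refine Real.exp_le_exp.2 ?_
          rcases Nat.eq_zero_or_pos n with rfl | hpos
          · simp
          · have : (1 : ℝ) ≤ n := by exact_mod_cast hpos
            nlinarith
        _ ≤ 4 := by linarith [Real.exp_one_lt_d9]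
    nlinarith [norm_nonneg E]
  have h6 : ((1 : ℝ) / 2) ^ κ ≤ 1 := pow_le_one₀ (by norm_num) (by norm_num)
  have h7 : ‖D‖ ≤ 3 := by
    calc ‖D‖ = ‖E - (E - D)‖ := by rw [sub_sub_cancel]
      _ ≤ ‖E‖ + ‖E - D‖ := norm_sub_le _ _
      _ ≤ 3 := by linarith
  have h8 : ‖1 - Dᴴ * D‖ ≤ ((1 + x ^ 2) ^ n - 1) + 5 * (1 / 2) ^ κ := by
    have : 1 - Dᴴ * D = -(Eᴴ * E - 1) + ((E - D)ᴴ * E + Dᴴ * (E - D)) := by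
      rw [conjTranspose_sub]; noncomm_ring
    rw [this]
    refine (norm_add_le _ _).trans ?_
    rw [norm_neg]
    have h9 : ‖(E - D)ᴴ * E + Dᴴ * (E - D)‖ ≤ (1 / 2) ^ κ * 2 + 3 * (1 / 2) ^ κ := by
      refine (norm_add_le _ _).trans (add_le_add ?_ ?_)
      · refine (norm_mul_le _ _).trans ?_
        rw [l2_opNorm_conjTranspose]
        exact mul_le_mul h1 h3 (norm_nonneg _) (by positivity)
      · refine (norm_mul_le _ _).trans ?_
        rw [l2_opNorm_conjTranspose]
        exact mul_le_mul h7 h1 (norm_nonneg _) (by positivity)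
    linarith
  have hi : ‖inj Y (slot₀ n κ)‖ ≤ 1 := l2_opNorm_le_one_of_isometry (inj_isometry _)
  set i := inj Y (slot₀ n κ)
  have h10 := amplify_mul_inj (slot₀ n κ) (lcu R (segmentTerm g)) hR
  have h11 : (amplify (slot₀ n κ) (lcu R (segmentTerm g)) :
          Matrix (Y × Slots n κ) (Y × Slots n κ) ℂ) * i - i * E
      = (lcu R (segmentTerm g) : Matrix (Y × Slots n κ) (Y × Slots n κ) ℂ) * i * (1 - Dᴴ * D)
        - i * (E - D) := by
    rw [← h10, Matrix.mul_sub]; abel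
  rw [h11]
  refine (norm_sub_le _ _).trans ?_
  have h12 : ‖(lcu R (segmentTerm g) : Matrix (Y × Slots n κ) (Y × Slots n κ) ℂ) * i‖ ≤ 1 :=
    (l2_opNorm_mul _ _).trans
      (mul_le_one₀ (l2_opNorm_unitary_le_one _) (norm_nonneg _) hi)
  have h13 := l2_opNorm_mul
    ((lcu R (segmentTerm g) : Matrix (Y × Slots n κ) (Y × Slots n κ) ℂ) * i) (1 - Dᴴ * D)
  have h14 := l2_opNorm_mul i (E - D)
  have h15 : ‖i‖ * ‖E - D‖ ≤ 1 * (1 / 2) ^ κ := mul_le_mul hi h1 (norm_nonneg _) zero_le_one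
  have h16 := mul_le_mul h12 h8 (norm_nonneg _) zero_le_one
  linarith

/-- Telescoping: later circuits are unitary and do not enlarge an error, while the exact product
before it contributes the factor `C`. -/
theorem norm_ordProd_mul_inj_le {I : Type} [Fintype I] [DecidableEq I] (i₀ : I)
    (A : ℕ → unitaryGroup (Y × I) ℂ) (E : ℕ → Matrix Y Y ℂ) {η C : ℝ} {r : ℕ}
    (hA : ∀ k < r, ‖(A k : Matrix (Y × I) (Y × I) ℂ) * inj Y i₀ - inj Y i₀ * E k‖ ≤ η)
    (hE : ∀ k < r, ‖ordProd E 0 k‖ ≤ C) (hη : 0 ≤ η) :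
    ‖((ordProd A 0 r : unitaryGroup (Y × I) ℂ) : Matrix (Y × I) (Y × I) ℂ) * inj Y i₀
      - inj Y i₀ * ordProd E 0 r‖ ≤ r * (η * C) := by
  induction r with
  | zero => simp [ordProd_self]
  | succ r ih =>
    have ih' := ih (fun k hk => hA k (by omega)) (fun k hk => hE k (by omega))
    rw [ordProd_succ_top _ (Nat.zero_le _), ordProd_succ_top _ (Nat.zero_le _)]
    set Q := ((ordProd A 0 r : unitaryGroup (Y × I) ℂ) : Matrix (Y × I) (Y × I) ℂ)
    set i := inj Y i₀
    have : ((A r * ordProd A 0 r : unitaryGroup (Y × I) ℂ) : Matrix (Y × I) (Y × I) ℂ) * i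
        - i * (E r * ordProd E 0 r)
        = (A r : Matrix (Y × I) (Y × I) ℂ) * (Q * i - i * ordProd E 0 r)
          + ((A r : Matrix (Y × I) (Y × I) ℂ) * i - i * E r) * ordProd E 0 r := by
      rw [Submonoid.coe_mul, Matrix.mul_sub, Matrix.sub_mul]
      simp only [Matrix.mul_assoc]
      abel
    rw [this]
    refine (norm_add_le _ _).trans ?_
    have h1 := l2_opNorm_mul (A r : Matrix (Y × I) (Y × I) ℂ) (Q * i - i * ordProd E 0 r)
    have h2 := l2_opNorm_mul ((A r : Matrix (Y × I) (Y × I) ℂ) * i - i * E r) (ordProd E 0 r)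
    have h3 := mul_le_mul (l2_opNorm_unitary_le_one (A r)) ih' (norm_nonneg _) zero_le_one
    have h4 := mul_le_mul (hA r (by omega)) (hE r (by omega)) (norm_nonneg _) hη
    push_cast
    linarith

end Segment

end CAP
end

noncomputable section
namespace CAP

open Matrix

/-! ### Amplitude amplification with a random number of rounds -/

section Grover

variable {S : Type} [Fintype S] [DecidableEq S]

/-- The reflection that changes the sign of the basis states satisfying `P`. -/
def signGate (P : S → Prop) [DecidablePred P] : unitaryGroup S ℂ :=
  phaseGate fun z => if P z then -1 else 1

theorem signGate_mulVec (P : S → Prop) [DecidablePred P] (x : S → ℂ) :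
    (signGate P : Matrix S S ℂ) *ᵥ x = fun z => if P z then -x z else x z := by
  funext z
  change (diagonal _ *ᵥ x) z = _
  rw [mulVec_diagonal]
  by_cases h : P z <;> simp [h, Unitary.coe_neg]

/-- One round of amplitude amplification. -/
def groverStep (B : unitaryGroup S ℂ) (z₀ : S) (P : S → Prop) [DecidablePred P] :
    unitaryGroup S ℂ :=
  B * -signGate (· = z₀) * B⁻¹ * signGate P

/-- The part of a vector satisfying `P`. -/
def goodPart (P : S → Prop) [DecidablePred P] (x : S → ℂ) : S → ℂ := fun z => if P z then x z else 0

/-- Conjugated by `B`, the reflection in `z₀` becomes the reflection `x ↦ 2 ⟨b, x⟩ b - x` in the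
vector `b` (`hrefl`). Both reflections preserve the plane of the good and the bad part of `b`;
coordinates refer to these unnormalized parts, hence the powers of `s`. -/
theorem groverStep_mulVec (B : unitaryGroup S ℂ) (z₀ : S) (P : S → Prop) [DecidablePred P]
    (b : S → ℂ) (hb : b = (B : Matrix S S ℂ) *ᵥ Pi.single z₀ 1) (s : ℝ)
    (hs : ∑ z with P z, ‖b z‖ ^ 2 = s ^ 2) (α β : ℝ) :
    (groverStep B z₀ P : Matrix S S ℂ) *ᵥ
        ((α : ℂ) • goodPart P b + (β : ℂ) • (b - goodPart P b))
      = ((α * (1 - 2 * s ^ 2) + 2 * β * (1 - s ^ 2) : ℝ) : ℂ) • goodPart P b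
        + ((β * (1 - 2 * s ^ 2) - 2 * α * s ^ 2 : ℝ) : ℂ) • (b - goodPart P b) := by
  have hBB : (B : Matrix S S ℂ) * (B : Matrix S S ℂ)ᴴ = 1 := mem_unitaryGroup_iff.1 B.2
  have hBB' : (B : Matrix S S ℂ)ᴴ * (B : Matrix S S ℂ) = 1 := mem_unitaryGroup_iff'.1 B.2
  have hcol : ∀ z, b z = (B : Matrix S S ℂ) z z₀ := fun z => by
    rw [hb, mulVec_single_one]; rfl
  have hnorm : ∑ z, star (b z) * b z = 1 := by
    have := congrFun (congrFun hBB' z₀) z₀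
    simp only [mul_apply, conjTranspose_apply, one_apply_eq, ← hcol] at this
    exact this
  have hgood : ∑ z, star (b z) * goodPart P b z = (s : ℂ) ^ 2 := by
    rw [← Complex.ofReal_pow, ← hs, Complex.ofReal_sum, Finset.sum_filter]
    refine Finset.sum_congr rfl fun z _ => ?_
    simp only [goodPart]
    split_ifs
    · rw [RCLike.star_def, Complex.conj_mul', Complex.ofReal_pow]
    · simp
  have hrefl : ∀ x : S → ℂ, ((B * -signGate (· = z₀) * B⁻¹ : unitaryGroup S ℂ) : Matrix S S ℂ) *ᵥ x
      = (2 * ∑ z, star (b z) * x z) • b - x := by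
    intro x
    have h1 : ((B * -signGate (· = z₀) * B⁻¹ : unitaryGroup S ℂ) : Matrix S S ℂ)
        = -((B : Matrix S S ℂ) * (signGate (· = z₀) : Matrix S S ℂ) * (B : Matrix S S ℂ)ᴴ) := by
      rw [Submonoid.coe_mul, Submonoid.coe_mul, Unitary.coe_neg, mul_neg, neg_mul]; rfl
    have h2 : (signGate (· = z₀) : Matrix S S ℂ) *ᵥ ((B : Matrix S S ℂ)ᴴ *ᵥ x)
        = (B : Matrix S S ℂ)ᴴ *ᵥ x - (2 * ∑ z, star (b z) * x z) • Pi.single z₀ 1 := by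
      rw [signGate_mulVec]
      funext z
      by_cases hz : z = z₀
      · subst hz
        have : ((B : Matrix S S ℂ)ᴴ *ᵥ x) z = ∑ z, star (b z) * x z := by
          simp only [mulVec, dotProduct, conjTranspose_apply, hcol]
        simp only [if_true, Pi.sub_apply, this, Pi.smul_apply, Pi.single_eq_same, smul_eq_mul]
        ring
      · simp [hz]
    rw [h1, neg_mulVec, ← mulVec_mulVec, ← mulVec_mulVec, h2, mulVec_sub, mulVec_smul, ← hb,
      mulVec_mulVec, hBB, one_mulVec]
    abel
  have hsg : (signGate P : Matrix S S ℂ) *ᵥ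
        ((α : ℂ) • goodPart P b + (β : ℂ) • (b - goodPart P b))
      = -(α : ℂ) • goodPart P b + (β : ℂ) • (b - goodPart P b) := by
    rw [signGate_mulVec]
    funext z
    simp only [goodPart, Pi.add_apply, Pi.smul_apply, Pi.sub_apply, smul_eq_mul]
    split_ifs <;> ring
  have hinner : ∑ z, star (b z) *
      (-(α : ℂ) • goodPart P b + (β : ℂ) • (b - goodPart P b)) z
      = -(α : ℂ) * (s : ℂ) ^ 2 + β * (1 - (s : ℂ) ^ 2) := by
    rw [← hgood, show 1 - ∑ z, star (b z) * goodPart P b z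
      = ∑ z, star (b z) * b z - ∑ z, star (b z) * goodPart P b z by rw [hnorm],
    ← Finset.sum_sub_distrib, Finset.mul_sum, Finset.mul_sum, ← Finset.sum_add_distrib]
    refine Finset.sum_congr rfl fun z _ => ?_
    simp only [Pi.add_apply, Pi.smul_apply, Pi.sub_apply, smul_eq_mul]
    ring
  rw [groverStep, Submonoid.coe_mul, ← mulVec_mulVec, hsg, hrefl, hinner]
  funext z
  simp only [Pi.add_apply, Pi.smul_apply, Pi.sub_apply, smul_eq_mul]
  push_cast
  ring

/-- One round is the rotation by `2 * θ` of that plane; the denominators account for the lengths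
`sin θ` and `cos θ` of the two parts. -/
theorem groverStep_pow_mulVec (B : unitaryGroup S ℂ) (z₀ : S) (P : S → Prop) [DecidablePred P]
    (b : S → ℂ) (hb : b = (B : Matrix S S ℂ) *ᵥ Pi.single z₀ 1) {θ : ℝ}
    (hsin : Real.sin θ ≠ 0) (hcos : Real.cos θ ≠ 0)
    (hs : ∑ z with P z, ‖b z‖ ^ 2 = Real.sin θ ^ 2) (j : ℕ) :
    ((groverStep B z₀ P ^ j : unitaryGroup S ℂ) : Matrix S S ℂ) *ᵥ b
      = ((Real.sin ((2 * j + 1) * θ) / Real.sin θ : ℝ) : ℂ) • goodPart P b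
        + ((Real.cos ((2 * j + 1) * θ) / Real.cos θ : ℝ) : ℂ) • (b - goodPart P b) := by
  induction j with
  | zero => simp [hsin, hcos]
  | succ j ih =>
    rw [pow_succ', Submonoid.coe_mul, ← mulVec_mulVec, ih, groverStep_mulVec B z₀ P b hb _ hs]
    have e : (2 * ((j + 1 : ℕ) : ℝ) + 1) * θ = (2 * j + 1) * θ + 2 * θ := by push_cast; ring
    have h1 := Real.sin_sq_add_cos_sq θ
    rw [e, Real.sin_add, Real.cos_add, Real.sin_two_mul, Real.cos_two_mul']
    congr 3
    · field_simp
      have : 1 - Real.sin θ ^ 2 = Real.cos θ ^ 2 := by linarith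
      rw [this, show 1 - 2 * Real.sin θ ^ 2 = Real.cos θ ^ 2 - Real.sin θ ^ 2 by linarith]
      field_simp
    · rw [show 1 - 2 * Real.sin θ ^ 2 = Real.cos θ ^ 2 - Real.sin θ ^ 2 by linarith]
      field_simp

/-- The sum telescopes after multiplication by `4 * sin (2 * θ)`. On average over the number of
rounds the success probability is at least `1 / 4`, and only a lower bound on the angle is needed.
-/
theorem sum_sin_sq_ge {θ : ℝ} {M : ℕ} (h : 1 ≤ M * Real.sin (2 * θ)) :
    (M : ℝ) / 4 ≤ ∑ j ∈ Finset.range M, Real.sin ((2 * j + 1) * θ) ^ 2 := by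
  have key : ∀ K : ℕ, 4 * Real.sin (2 * θ) * ∑ j ∈ Finset.range K, Real.sin ((2 * j + 1) * θ) ^ 2
      = 2 * K * Real.sin (2 * θ) - Real.sin (4 * K * θ) := by
    intro K
    induction K with
    | zero => simp
    | succ K ih =>
      rw [Finset.sum_range_succ, mul_add, ih, Real.sin_sq_eq_half_sub]
      push_cast
      have e1 : 4 * ((K : ℝ) + 1) * θ = 2 * ((2 * K + 1) * θ) + 2 * θ := by ring
      have e2 : 4 * (K : ℝ) * θ = 2 * ((2 * K + 1) * θ) - 2 * θ := by ring
      rw [e1, e2, Real.sin_add, Real.sin_sub]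
      ring
  have hM : (0 : ℝ) < M := by
    rcases Nat.eq_zero_or_pos M with rfl | hM
    · norm_num at h
    · exact_mod_cast hM
  have hs : 0 < Real.sin (2 * θ) := by
    by_contra hneg
    nlinarith
  have h1 := key M
  have h2 := Real.sin_le_one (4 * M * θ)
  have h3 : (M : ℝ) * Real.sin (2 * θ) ≤
      4 * Real.sin (2 * θ) * ∑ j ∈ Finset.range M, Real.sin ((2 * j + 1) * θ) ^ 2 := by linarith
  by_contra hlt
  push Not at hlt
  have := mul_lt_mul_of_pos_left hlt (show 0 < 4 * Real.sin (2 * θ) by linarith)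
  linarith

/-- A counter-controlled power is run as `M` rounds, of which the first `k` are active, so one fixed
circuit serves all values of the counter. -/
theorem prod_ofFn_ite_lt {G : Type*} [Monoid G] (q : G) {M k : ℕ} (hk : k ≤ M) :
    (List.ofFn fun i : Fin M => if (i : ℕ) < k then q else 1).prod = q ^ k := by
  induction M generalizing k with
  | zero => simp [Nat.le_zero.1 hk]
  | succ M ih =>
    rw [List.ofFn_succ, List.prod_cons]
    rcases k with _ | k
    · simp
    · simp only [Fin.val_zero, Nat.zero_lt_succ, if_true, Fin.val_succ, Nat.add_lt_add_iff_right]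
      rw [ih (by omega), pow_succ']

/-- Amplitude amplification with a number of rounds drawn uniformly from `0, …, M - 1`; `R`
prepares the uniform superposition. -/
def randomGrover {M : ℕ} (R : unitaryGroup (Fin M) ℂ) (B : unitaryGroup S ℂ) (z₀ : S)
    (P : S → Prop) [DecidablePred P] : unitaryGroup (S × Fin M) ℂ :=
  (List.ofFn fun i : Fin M => blockU fun j : Fin M =>
      if i < j then groverStep B z₀ P else 1).prod
    * (blockU fun _ => B) * tensorU S R

theorem randomGrover_apply {M : ℕ} [NeZero M] {R : unitaryGroup (Fin M) ℂ} (B : unitaryGroup S ℂ)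
    (z₀ : S) (P : S → Prop) [DecidablePred P]
    (hR : ∀ j, (R : Matrix (Fin M) (Fin M) ℂ) j 0 = (√(1 / M : ℝ) : ℝ)) (z : S) (j : Fin M) :
    ((randomGrover R B z₀ P : Matrix (S × Fin M) (S × Fin M) ℂ) *ᵥ Pi.single (z₀, 0) 1) (z, j)
      = (√(1 / M : ℝ) : ℝ) * (((groverStep B z₀ P ^ (j : ℕ) : unitaryGroup S ℂ) : Matrix S S ℂ) *ᵥ
          ((B : Matrix S S ℂ) *ᵥ Pi.single z₀ 1)) z := by
  have h1 : (List.ofFn fun i : Fin M => blockU fun j : Fin M =>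
      if i < j then groverStep B z₀ P else 1).prod
      = blockU fun j : Fin M => groverStep B z₀ P ^ (j : ℕ) := by
    rw [show (List.ofFn fun i : Fin M => blockU fun j : Fin M =>
      if i < j then groverStep B z₀ P else 1) = (List.ofFn fun i : Fin M => fun j : Fin M =>
      if i < j then groverStep B z₀ P else 1).map blockU by rw [List.map_ofFn]; rfl,
      ← map_list_prod]
    congr 1
    funext j
    rw [← prod_ofFn_ite_lt _ j.2.le]
    refine (map_list_prod (Pi.evalMonoidHom (fun _ : Fin M => unitaryGroup S ℂ) j) _).trans ?_
    rw [List.map_ofFn]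
    rfl
  rw [randomGrover, h1, Submonoid.coe_mul, ← mulVec_mulVec, ← map_mul]
  have h2 : (tensorU S R : Matrix (S × Fin M) (S × Fin M) ℂ) *ᵥ Pi.single (z₀, 0) 1
      = fun p => if p.1 = z₀ then ((√(1 / M : ℝ) : ℝ) : ℂ) else 0 := by
    rw [mulVec_single_one]
    funext ⟨z, j⟩
    change (tensorU S R : Matrix (S × Fin M) (S × Fin M) ℂ) (z, j) (z₀, 0) = _
    rw [tensorU_apply, hR]
  rw [h2, mulVec_mulVec, ← Submonoid.coe_mul, mulVec_single_one, blockU_apply]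
  simp only [mulVec, dotProduct, Fintype.sum_prod_type, blockDiagonal_apply, Pi.mul_apply]
  rw [Finset.sum_eq_single z₀ (by intro b _ hb; simp [hb]) (by simp)]
  simp [mul_comm]

theorem randomGrover_good {M : ℕ} [NeZero M] {R : unitaryGroup (Fin M) ℂ} (B : unitaryGroup S ℂ)
    (z₀ : S) (P : S → Prop) [DecidablePred P]
    (hR : ∀ j, (R : Matrix (Fin M) (Fin M) ℂ) j 0 = (√(1 / M : ℝ) : ℝ))
    {b : S → ℂ} (hb : b = (B : Matrix S S ℂ) *ᵥ Pi.single z₀ 1) {s : ℝ} (hs0 : 0 < s)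
    (hs1 : s ≤ 5 / 8) (hM : 1 ≤ M * s) (hs : ∑ z with P z, ‖b z‖ ^ 2 = s ^ 2) :
    ∃ c : Fin M → ℝ, 1 / 4 ≤ (∑ j, c j ^ 2) * s ^ 2 ∧ ∀ z j, P z →
      ((randomGrover R B z₀ P : Matrix (S × Fin M) (S × Fin M) ℂ) *ᵥ Pi.single (z₀, 0) 1) (z, j)
        = c j * b z := by
  set θ := Real.arcsin s with hθ
  have hsin : Real.sin θ = s := Real.sin_arcsin (by linarith) (by linarith)
  have hcos : Real.cos θ = √(1 - s ^ 2) := Real.cos_arcsin s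
  -- The bound `s ≤ 5 / 8` enters here: it yields `sin (2 * θ) ≥ s`, so `M * s ≥ 1` implies the
  -- hypothesis of `sum_sin_sq_ge`.
  have hc : 1 / 2 ≤ Real.cos θ := by
    rw [hcos]
    apply Real.le_sqrt_of_sq_le
    nlinarith
  refine ⟨fun j => √(1 / M : ℝ) * (Real.sin ((2 * j + 1) * θ) / s), ?_, ?_⟩
  · have h1 : (M : ℝ) / 4 ≤ ∑ j ∈ Finset.range M, Real.sin ((2 * j + 1) * θ) ^ 2 := by
      apply sum_sin_sq_ge
      rw [Real.sin_two_mul, hsin]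
      have : (0 : ℝ) ≤ M * s := by linarith
      nlinarith
    have hM0 : (0 : ℝ) < M := by exact_mod_cast Nat.pos_of_ne_zero (NeZero.ne M)
    have h2 : ∀ j : Fin M, (√(1 / M : ℝ) * (Real.sin ((2 * (j : ℕ) + 1) * θ) / s)) ^ 2
        = (1 / (M * s ^ 2)) * Real.sin ((2 * (j : ℕ) + 1) * θ) ^ 2 := by
      intro j
      rw [mul_pow, Real.sq_sqrt (by positivity), div_pow]
      field_simp
    simp only [h2]
    rw [← Finset.mul_sum, Fin.sum_univ_eq_sum_range (fun j => Real.sin ((2 * (j : ℕ) + 1) * θ) ^ 2)]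
    set total := ∑ j ∈ Finset.range M, Real.sin ((2 * j + 1) * θ) ^ 2
    have h3 : (1 / (M * s ^ 2)) * total * s ^ 2 = total / M := by
      field_simp
    rw [h3, le_div_iff₀ hM0]
    linarith
  · intro z j hz
    rw [randomGrover_apply B z₀ P hR, ← hb,
      groverStep_pow_mulVec B z₀ P b hb (θ := θ) (by rw [hsin]; exact hs0.ne') (by linarith)
        (by rw [hsin, hs])]
    simp only [goodPart, Pi.add_apply, Pi.smul_apply, Pi.sub_apply, hz, if_true, sub_self,
      smul_eq_mul, mul_zero, add_zero, hsin]
    push_cast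
    ring

end Grover

end CAP
end

noncomputable section
namespace CAP

open Matrix

/-! ### Unitary dilation of the damped evolution -/

section Dilation

variable {L : ℕ}

/-- Rotation of the plane spanned by `none` and `some j`, with cosine `c`. -/
def rot (j : Fin L) (c : ℝ) (hc : |c| ≤ 1) : unitaryGroup (Option (Fin L)) ℂ :=
  ⟨Matrix.of fun a b =>
    match a, b with
    | none, none => (c : ℂ)
    | none, some i => if i = j then -(√(1 - c ^ 2) : ℝ) else 0
    | some i, none => if i = j then ((√(1 - c ^ 2) : ℝ) : ℂ) else 0
    | some i, some k => if i = k then (if i = j then (c : ℂ) else 1) else 0, by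
    have h : ((√(1 - c ^ 2) : ℝ) : ℂ) * ((√(1 - c ^ 2) : ℝ) : ℂ) = 1 - (c : ℂ) ^ 2 := by
      rw [← Complex.ofReal_mul, Real.mul_self_sqrt (by nlinarith [abs_le.1 hc])]
      push_cast; ring
    rw [mem_unitaryGroup_iff, star_eq_conjTranspose]
    ext a b
    rw [mul_apply, Fintype.sum_option]
    rcases a with _ | a <;> rcases b with _ | b
    · simp [apply_ite, h]; ring
    · by_cases hb : b = j
      · subst hb; simp [apply_ite]; ring
      · simp [apply_ite, hb]
    · by_cases hb : a = j
      · subst hb; simp [apply_ite]; ring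
      · simp [apply_ite, hb]
    · by_cases ha : a = j <;> by_cases hb : b = j
      · subst ha; subst hb; simp [apply_ite, h]; ring
      · subst ha; simp [apply_ite, hb, one_apply, Ne.symm hb]
      · subst hb; simp [apply_ite, ha, one_apply]
      · by_cases hab : a = b
        · subst hab; simp [ha]
        · simp [ha, hab, Ne.symm hab]⟩

theorem rot_none_none (j : Fin L) (c : ℝ) (hc : |c| ≤ 1) :
    (rot j c hc : Matrix (Option (Fin L)) (Option (Fin L)) ℂ) none none = c := rfl

theorem rot_none_some (j : Fin L) (c : ℝ) (hc : |c| ≤ 1) (i : Fin L) :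
    (rot j c hc : Matrix (Option (Fin L)) (Option (Fin L)) ℂ) none (some i)
      = if i = j then -((√(1 - c ^ 2) : ℝ) : ℂ) else 0 := rfl

theorem rot_some_none (j : Fin L) (c : ℝ) (hc : |c| ≤ 1) (i : Fin L) :
    (rot j c hc : Matrix (Option (Fin L)) (Option (Fin L)) ℂ) (some i) none
      = if i = j then ((√(1 - c ^ 2) : ℝ) : ℂ) else 0 := rfl

theorem rot_some_some (j : Fin L) (c : ℝ) (hc : |c| ≤ 1) (i k : Fin L) :
    (rot j c hc : Matrix (Option (Fin L)) (Option (Fin L)) ℂ) (some i) (some k)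
      = if i = k then (if i = j then (c : ℂ) else 1) else 0 := rfl

/-- The rotation number `j`, and the identity from `j = L` on. -/
def rotSeq (L : ℕ) (c : ℝ) (hc : |c| ≤ 1) (j : ℕ) : unitaryGroup (Option (Fin L)) ℂ :=
  if h : j < L then rot ⟨j, h⟩ c hc else 1

variable {N : ℕ}

/-- An operator on the grid, acting on environment and grid. -/
def onGrid (L : ℕ) (F : Matrix (Fin N) (Fin N) ℂ) :
    Matrix (Option (Fin L) × Fin N) (Option (Fin L) × Fin N) ℂ :=
  kroneckerMap (· * ·) 1 F

theorem onGrid_mulVec (F : Matrix (Fin N) (Fin N) ℂ) (ψ : Option (Fin L) × Fin N → ℂ)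
    (a : Option (Fin L)) (r : Fin N) :
    (onGrid L F *ᵥ ψ) (a, r) = (F *ᵥ fun r' => ψ (a, r')) r := by
  simp only [onGrid, mulVec, dotProduct, kroneckerMap_apply, Fintype.sum_prod_type]
  rw [Finset.sum_eq_single a (by intro b _ hb; simp [one_apply, hb.symm]) (by simp)]
  simp

theorem onGrid_one : onGrid L (1 : Matrix (Fin N) (Fin N) ℂ) = 1 :=
  one_kronecker_one

theorem onGrid_add (F F' : Matrix (Fin N) (Fin N) ℂ) :
    onGrid L (F + F') = onGrid L F + onGrid L F' :=
  kronecker_add _ _ _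

theorem onGrid_smul (x : ℝ) (F : Matrix (Fin N) (Fin N) ℂ) : onGrid L (x • F) = x • onGrid L F :=
  kronecker_smul _ _ _

/-- The embedding of the grid in environment and grid. -/
def aliveVec (L : ℕ) (v : Fin N → ℂ) : Option (Fin L) × Fin N → ℂ :=
  fun p => if p.1 = none then v p.2 else 0

/-- Amplitude lost in step `j` goes to level `j`, which no other rotation touches. The second claim,
that the levels from `k` on are still empty, is the invariant which guarantees that nothing flows
back to `none`. -/
theorem dilation (c : Fin N → ℝ) (hc : ∀ r, |c r| ≤ 1) (F : ℕ → Matrix (Fin N) (Fin N) ℂ)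
    (v : Fin N → ℂ) {k : ℕ} (hk : k ≤ L) :
    (∀ r, (ordProd (fun j => (blockU (fun r => rotSeq L (c r) (hc r) j) :
        Matrix (Option (Fin L) × Fin N) (Option (Fin L) × Fin N) ℂ) * onGrid L (F j)) 0 k *ᵥ
          aliveVec L v) (none, r)
      = (ordProd (fun j => diagonal (fun r => (c r : ℂ)) * F j) 0 k *ᵥ v) r) ∧
    ∀ i : Fin L, k ≤ i → ∀ r, (ordProd (fun j => (blockU (fun r => rotSeq L (c r) (hc r) j) :
        Matrix (Option (Fin L) × Fin N) (Option (Fin L) × Fin N) ℂ) * onGrid L (F j)) 0 k *ᵥ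
          aliveVec L v) (some i, r) = 0 := by
  induction k with
  | zero => simp [ordProd_self, aliveVec]
  | succ k ih =>
    obtain ⟨ih1, ih2⟩ := ih (by omega)
    rw [ordProd_succ_top _ (Nat.zero_le _), ordProd_succ_top _ (Nat.zero_le _), ← mulVec_mulVec,
      ← mulVec_mulVec, ← mulVec_mulVec, ← mulVec_mulVec]
    set ψ := ordProd (fun j => (blockU (fun r => rotSeq L (c r) (hc r) j) :
        Matrix (Option (Fin L) × Fin N) (Option (Fin L) × Fin N) ℂ) * onGrid L (F j)) 0 k *ᵥ
          aliveVec L v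
    set φ := onGrid L (F k) *ᵥ ψ with hφ
    have hφ1 : ∀ r, φ (none, r)
        = (F k *ᵥ ordProd (fun j => diagonal (fun r => (c r : ℂ)) * F j) 0 k *ᵥ v) r := by
      intro r
      rw [hφ, onGrid_mulVec]
      congr 2
      funext r'
      exact ih1 r'
    have hφ2 : ∀ i : Fin L, k ≤ i → ∀ r, φ (some i, r) = 0 := by
      intro i hi r
      rw [hφ, onGrid_mulVec, show (fun r' => ψ (some i, r')) = 0 from funext fun r' => ih2 i hi r']
      simp
    have hb : ∀ a r, ((blockU (fun r => rotSeq L (c r) (hc r) k) :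
        Matrix (Option (Fin L) × Fin N) (Option (Fin L) × Fin N) ℂ) *ᵥ φ) (a, r)
        = ∑ b, (rot ⟨k, hk⟩ (c r) (hc r) : Matrix (Option (Fin L)) (Option (Fin L)) ℂ) a b
          * φ (b, r) := by
      intro a r
      simp only [mulVec, dotProduct, Fintype.sum_prod_type, blockU_apply, blockDiagonal_apply]
      refine Finset.sum_congr rfl fun b _ => ?_
      rw [Finset.sum_eq_single r (by intro b _ hb; simp [hb.symm]) (by simp)]
      simp [rotSeq, show k < L from hk]
    constructor
    · intro r
      rw [hb, Fintype.sum_option, rot_none_none, mulVec_diagonal, ← hφ1,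
        Finset.sum_eq_zero, add_zero]
      intro i _
      rw [rot_none_some]
      split_ifs with h
      · rw [hφ2 i (by simp [h]), mul_zero]
      · simp
    · intro i hi r
      rw [hb, Fintype.sum_option, rot_some_none, if_neg (by rintro rfl; simp at hi), zero_mul,
        zero_add]
      refine Finset.sum_eq_zero fun b _ => ?_
      rw [rot_some_some]
      by_cases h : i = b
      · subst h; rw [hφ2 i (by omega), mul_zero]
      · simp [h]

/-- The cumulative products of `W` telescope. With `W` the damping, all of it is moved to the end
and into conjugations, which do not change norms. -/
theorem interaction_picture {Y : Type} [Fintype Y] [DecidableEq Y] (W : ℕ → unitaryGroup Y ℂ)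
    (F : ℕ → Matrix Y Y ℂ) (k : ℕ) :
    ((ordProd W 0 k : unitaryGroup Y ℂ) : Matrix Y Y ℂ) *
        ordProd (fun j => ((ordProd W 0 j)⁻¹ : unitaryGroup Y ℂ) * F j *
          ((ordProd W 0 j : unitaryGroup Y ℂ) : Matrix Y Y ℂ)) 0 k
      = ordProd (fun j => (W j : Matrix Y Y ℂ) * F j) 0 k := by
  induction k with
  | zero => simp [ordProd_self]
  | succ k ih =>
    rw [ordProd_succ_top _ (Nat.zero_le k), ordProd_succ_top _ (Nat.zero_le k),
      ordProd_succ_top _ (Nat.zero_le k), ← ih, Submonoid.coe_mul]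
    have h : ((ordProd W 0 k : unitaryGroup Y ℂ) : Matrix Y Y ℂ) *
        ((ordProd W 0 k)⁻¹ : unitaryGroup Y ℂ) = 1 := mem_unitaryGroup_iff.1 (ordProd W 0 k).2
    simp only [Matrix.mul_assoc]
    rw [← Matrix.mul_assoc _ _ (F k * _), h, Matrix.one_mul]

end Dilation

end CAP
end

noncomputable section
namespace CAP

open Matrix

/-! ### The discretized Hamiltonian -/

section Hamiltonian

variable {N : ℕ}

/-- The kinetic energy `-Δ / 2`. -/
def kinetic (N : ℕ) : Matrix (Fin N) (Fin N) ℂ := -((1 / 2 : ℂ) • discreteLaplacian N)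

theorem hamiltonian_eq (V : Fin N → ℝ) : hamiltonian V = kinetic N + potential V := rfl

theorem norm_potential (V : Fin N → ℝ) : ‖potential V‖ = ‖V‖ := by
  rw [potential, l2_opNorm_diagonal]
  simp only [Pi.norm_def, Complex.nnnorm_real]

theorem potential_sub (V V' : Fin N → ℝ) : potential (V - V') = potential V - potential V' := by
  simp [potential, diagonal_sub]

theorem potential_isSelfAdjoint (V : Fin N → ℝ) : (potential V)ᴴ = potential V := by
  simp [potential, diagonal_conjTranspose]

theorem norm_entry_le {ι : Type} [Fintype ι] [DecidableEq ι] (M : Matrix ι ι ℂ) (i j : ι) :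
    ‖M i j‖ ≤ ‖M‖ := by
  have h := l2_opNorm_mulVec M (EuclideanSpace.single j 1)
  have h2 := (PiLp.norm_apply_le (WithLp.toLp 2 (M *ᵥ (EuclideanSpace.single j (1 : ℂ)))) i).trans h
  simpa [mulVec_single_one] using h2

/-- The shift of the grid. -/
def shiftUp (N : ℕ) : Matrix (Fin N) (Fin N) ℂ :=
  Matrix.of fun i j => if (i : ℕ) + 1 = j then 1 else 0

theorem norm_shiftUp_le : ‖shiftUp N‖ ≤ 1 := by
  have h1 := l2_opNorm_conjTranspose_mul_self (shiftUp N)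
  have h2 : (shiftUp N)ᴴ * shiftUp N
      = diagonal fun j : Fin N => if 0 < (j : ℕ) then (1 : ℂ) else 0 := by
    ext i j
    simp only [mul_apply, conjTranspose_apply, shiftUp, of_apply, diagonal_apply]
    by_cases hj : 0 < (j : ℕ)
    · rw [Finset.sum_eq_single (⟨(j : ℕ) - 1, by omega⟩ : Fin N)]
      · have e : (j : ℕ) - 1 + 1 = j := by omega
        by_cases hij : i = j
        · subst hij; simp [e, hj]
        · have : ¬ (j : ℕ) = i := fun h => hij (Fin.ext h.symm)
          simp [e, hij, this]
      · intro b _ hb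
        have : ¬ (b : ℕ) + 1 = j := fun h => hb (Fin.ext (by simp; omega))
        simp [this]
      · simp
    · rw [Finset.sum_eq_zero]
      · split_ifs <;> simp_all
      · intro b _
        have : ¬ (b : ℕ) + 1 = j := by omega
        simp [this]
  rw [h2, l2_opNorm_diagonal] at h1
  have h3 : ‖fun j : Fin N => if 0 < (j : ℕ) then (1 : ℂ) else 0‖ ≤ 1 := by
    rw [pi_norm_le_iff_of_nonneg zero_le_one]
    intro j
    split_ifs <;> simp
  nlinarith [norm_nonneg (shiftUp N)]

theorem kinetic_eq : kinetic N = ((N : ℂ) ^ 2) • (1 : Matrix (Fin N) (Fin N) ℂ)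
    - ((N : ℂ) ^ 2 / 2) • (shiftUp N + (shiftUp N)ᴴ) := by
  ext i j
  simp only [kinetic, discreteLaplacian, shiftUp, Matrix.smul_apply, of_apply,
    Matrix.sub_apply, Matrix.add_apply, conjTranspose_apply, smul_eq_mul, one_apply]
  by_cases h : i = j
  · subst h; simp; ring
  · by_cases h1 : (i : ℕ) + 1 = j
    · have : ¬ (j : ℕ) + 1 = i := by omega
      simp [h, h1, this]; ring
    · by_cases h2 : (j : ℕ) + 1 = i
      · simp [h, h1, h2]; ring
      · simp [h, h1, h2]

theorem norm_kinetic_le : ‖kinetic N‖ ≤ 2 * (N : ℝ) ^ 2 := by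
  have h1 : ‖(1 : Matrix (Fin N) (Fin N) ℂ)‖ ≤ 1 :=
    l2_opNorm_le_one_of_isometry (by simp)
  have h2 : ‖shiftUp N + (shiftUp N)ᴴ‖ ≤ 2 := by
    refine (norm_add_le _ _).trans ?_
    rw [l2_opNorm_conjTranspose]
    linarith [norm_shiftUp_le (N := N)]
  have h3 : ‖(N : ℂ) ^ 2‖ = (N : ℝ) ^ 2 := by simp
  have h4 : ‖(N : ℂ) ^ 2 / 2‖ = (N : ℝ) ^ 2 / 2 := by simp
  rw [kinetic_eq]
  refine (norm_sub_le _ _).trans ?_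
  rw [norm_smul, norm_smul, h3, h4]
  nlinarith [sq_nonneg (N : ℝ)]

theorem kinetic_isSelfAdjoint : (kinetic N)ᴴ = kinetic N := by
  rw [kinetic_eq]
  simp [conjTranspose_sub, conjTranspose_smul, conjTranspose_add, add_comm]

variable {T : ℝ}

theorem Problem.continuousOn_VR (P : Problem N T) : ContinuousOn P.VR (Set.Icc 0 T) :=
  P.contDiffOn_VR.continuousOn

theorem Problem.bddAbove_VR (P : Problem N T) :
    BddAbove ((fun t => ‖potential (P.VR t)‖) '' Set.Icc 0 T) := by
  simp only [norm_potential]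
  exact isCompact_Icc.bddAbove_image P.continuousOn_VR.norm

theorem Problem.bddAbove_H (P : Problem N T) :
    BddAbove ((fun t => ‖hamiltonian (P.VR t)‖) '' Set.Icc 0 T) := by
  obtain ⟨B, hB⟩ := P.bddAbove_VR
  refine ⟨‖kinetic N‖ + B, ?_⟩
  rintro _ ⟨t, ht, rfl⟩
  exact (norm_add_le _ _).trans (add_le_add le_rfl (hB ⟨t, ht, rfl⟩))

theorem Problem.norm_H_le (P : Problem N T) {h : ℝ} (hP : P.maxH ≤ h) {t : ℝ}
    (ht : t ∈ Set.Icc 0 T) : ‖hamiltonian (P.VR t)‖ ≤ h :=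
  (le_csSup P.bddAbove_H ⟨t, ht, rfl⟩).trans hP

theorem Problem.maxH_le (P : Problem N T) (hT : 0 < T) :
    P.maxH ≤ 2 * ((N : ℝ) ^ 2 + P.maxVR) := by
  refine csSup_le ⟨_, 0, ⟨le_rfl, hT.le⟩, rfl⟩ ?_
  rintro _ ⟨t, ht, rfl⟩
  have h1 : ‖potential (P.VR t)‖ ≤ P.maxVR := le_csSup P.bddAbove_VR ⟨t, ht, rfl⟩
  have h2 : ‖hamiltonian (P.VR t)‖ ≤ ‖kinetic N‖ + ‖potential (P.VR t)‖ := norm_add_le _ _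
  change ‖hamiltonian (P.VR t)‖ ≤ _
  linarith [norm_kinetic_le (N := N), norm_nonneg (potential (P.VR t))]

/-- An off-diagonal entry does not see the potential. Hence for `N ≥ 2` kinetic and potential energy
cannot cancel, and `h` bounds each of them up to a constant; for `N = 1` this fails. -/
theorem sq_le_of_norm_hamiltonian_le (hN : 2 ≤ N) {V : Fin N → ℝ} {h : ℝ}
    (hV : ‖hamiltonian V‖ ≤ h) : (N : ℝ) ^ 2 / 2 ≤ h := by
  have h1 := (norm_entry_le (hamiltonian V) ⟨0, by omega⟩ ⟨1, by omega⟩).trans hV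
  have h2 : hamiltonian V ⟨0, by omega⟩ ⟨1, by omega⟩ = -((N : ℂ) ^ 2 / 2) := by
    simp [hamiltonian, discreteLaplacian, potential]; ring
  rw [h2, norm_neg] at h1
  simpa using h1

theorem abs_potential_le (hN : 2 ≤ N) {V : Fin N → ℝ} {h : ℝ}
    (hV : ‖hamiltonian V‖ ≤ h) (r : Fin N) : |V r| ≤ 3 * h := by
  have h0 := sq_le_of_norm_hamiltonian_le hN hV
  have h1 := (norm_entry_le (hamiltonian V) r r).trans hV
  have h2 : hamiltonian V r r = (((N : ℝ) ^ 2 + V r : ℝ) : ℂ) := by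
    simp [hamiltonian, discreteLaplacian, potential]; ring
  rw [h2, Complex.norm_real, Real.norm_eq_abs] at h1
  rw [abs_le] at h1 ⊢
  constructor <;> nlinarith

theorem Problem.norm_VR_sub_le (P : Problem N T) (hT : 0 < T) {v : ℝ} (hP : P.maxVR' ≤ v)
    {s t : ℝ} (hs : s ∈ Set.Icc 0 T) (ht : t ∈ Set.Icc 0 T) : ‖P.VR t - P.VR s‖ ≤ v * |t - s| := by
  have hd : ContinuousOn (derivWithin P.VR (Set.Icc 0 T)) (Set.Icc 0 T) :=
    P.contDiffOn_VR.continuousOn_derivWithin (uniqueDiffOn_Icc hT) le_rfl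
  have hb : BddAbove
      ((fun t => ‖potential (derivWithin P.VR (Set.Icc 0 T) t)‖) '' Set.Icc 0 T) := by
    simp only [norm_potential]
    exact isCompact_Icc.bddAbove_image hd.norm
  have h1 : ∀ x ∈ Set.Icc 0 T, ‖derivWithin P.VR (Set.Icc 0 T) x‖ ≤ v := fun x hx => by
    rw [← norm_potential]
    exact (le_csSup hb ⟨x, hx, rfl⟩).trans hP
  have := (convex_Icc 0 T).norm_image_sub_le_of_norm_derivWithin_le
    (P.contDiffOn_VR.differentiableOn one_ne_zero) h1 hs ht
  simpa using this

theorem Problem.nonneg_of_maxVR'_le (P : Problem N T) (hT : 0 < T) {v : ℝ} (hv : P.maxVR' ≤ v) :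
    0 ≤ v := by
  have := (norm_nonneg _).trans (P.norm_VR_sub_le hT hv (s := 0) (t := T) ⟨le_rfl, hT.le⟩
    ⟨hT.le, le_rfl⟩)
  rw [sub_zero, abs_of_pos hT] at this
  exact nonneg_of_mul_nonneg_left this hT

end Hamiltonian

/-! ### Splitting a step into unitaries -/

section Splitting

theorem mem_unitary_of_norm_eq_one {z : ℂ} (hz : ‖z‖ = 1) : z ∈ unitary ℂ := by
  rw [Unitary.mem_iff_star_mul_self, RCLike.star_def, Complex.conj_mul', hz]
  simp

/-- The phase `-i exp (± i arccos a)`. -/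
def potentialPhase (a : ℝ) (b : Bool) : unitary ℂ :=
  ⟨-Complex.I * Complex.exp (((if b then 1 else -1) * Real.arccos a : ℝ) * Complex.I),
    mem_unitary_of_norm_eq_one (by rw [norm_mul, Complex.norm_exp_ofReal_mul_I]; simp)⟩

/-- Truncation to the interval `[-1, 1]`. -/
def truncate (a : ℝ) : ℝ := Real.cos (Real.arccos a)

theorem sum_potentialPhase (a : ℝ) :
    ∑ b, (potentialPhase a b : ℂ) = -Complex.I * (2 * truncate a : ℝ) := by
  simp only [Fintype.sum_bool, potentialPhase, if_true, Bool.false_eq_true, if_false, ← mul_add]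
  congr 1
  rw [truncate]
  push_cast
  rw [Complex.two_cos, one_mul, neg_one_mul]

theorem abs_truncate_le (a : ℝ) : |truncate a| ≤ 1 := Real.abs_cos_le_one _

/-- `Real.arccos` is constant beyond `±1`, so truncation is the nearest-point projection to an
interval containing `b`. The word of an oracle may thus be truncated without loss. -/
theorem abs_truncate_sub_le {a b : ℝ} (hb : |b| ≤ 1) : |truncate a - b| ≤ |a - b| := by
  rw [abs_le] at hb
  rcases le_total a (-1) with h1 | h1
  · rw [truncate, Real.arccos_of_le_neg_one h1, Real.cos_pi, abs_of_nonpos (by linarith),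
      abs_of_nonpos (by linarith)]
    linarith
  rcases le_total 1 a with h2 | h2
  · rw [truncate, Real.arccos_of_one_le h2, Real.cos_zero, abs_of_nonneg (by linarith),
      abs_of_nonneg (by linarith)]
    linarith
  · rw [truncate, Real.cos_arccos h1 h2]

-- A self-adjoint contraction is the real part of the unitary `a + i √(1 - a²)`; the factor `-i` is
-- put into both unitaries.
open scoped MatrixOrder in
theorem exists_unitary_split {ι : Type} [Fintype ι] [DecidableEq ι] {a : Matrix ι ι ℂ}
    (ha : aᴴ = a) (h1 : ‖a‖ ≤ 1) : ∃ U : Bool → unitaryGroup ι ℂ,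
      ∑ b, (U b : Matrix ι ι ℂ) = (-Complex.I) • ((2 : ℂ) • a) := by
  let a' : selfAdjoint (Matrix ι ι ℂ) := ⟨a, ha⟩
  let u : unitaryGroup ι ℂ := selfAdjoint.unitarySelfAddISMul a' h1
  let p : unitary ℂ := ⟨-Complex.I, mem_unitary_of_norm_eq_one (by simp)⟩
  refine ⟨fun b => if b then p • u else p • star u, ?_⟩
  have h2 := selfAdjoint.realPart_unitarySelfAddISMul a' h1
  have h3 := congrArg Subtype.val h2
  rw [realPart_apply_coe] at h3
  simp only [Fintype.sum_bool, if_true, Bool.false_eq_true, if_false, Unitary.coe_smul]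
  rw [← smul_add]
  change (-Complex.I) • ((u : Matrix ι ι ℂ) + ((star u : unitaryGroup ι ℂ) : Matrix ι ι ℂ)) = _
  congr 1
  change ((2 : ℝ)⁻¹) • ((u : Matrix ι ι ℂ) + star (u : Matrix ι ι ℂ)) = a at h3
  rw [← h3, Unitary.coe_star]
  ext i j
  simp
  ring

variable {N : ℕ}

/-- The Hamiltonian with the potential read off from the words of the oracle. -/
def encodedHamiltonian (N : ℕ) (h : ℝ) (a : Fin N → ℝ) : Matrix (Fin N) (Fin N) ℂ :=
  kinetic N + potential fun r => 4 * h * truncate (a r)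

/-- The unitaries into which `-i` times the encoded Hamiltonian is split. -/
def gridTerm (U : Bool → unitaryGroup (Fin N) ℂ) (a : Fin N → ℝ) : Kind → unitaryGroup (Fin N) ℂ
  | (false, b) => U b
  | (true, b) => phaseGate fun r => potentialPhase (a r) b

/-- The generator of a step, normalized to norm at most one. -/
def generator (N : ℕ) (h : ℝ) (a : Fin N → ℝ) : Matrix (Fin N) (Fin N) ℂ :=
  (-Complex.I / (8 * h : ℝ)) • encodedHamiltonian N h a

theorem encodedHamiltonian_isSelfAdjoint (h : ℝ) (a : Fin N → ℝ) :
    (encodedHamiltonian N h a)ᴴ = encodedHamiltonian N h a := by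
  rw [encodedHamiltonian, conjTranspose_add, kinetic_isSelfAdjoint, potential_isSelfAdjoint]

theorem generator_conjTranspose (h : ℝ) (a : Fin N → ℝ) :
    (generator N h a)ᴴ = -generator N h a := by
  rw [generator, conjTranspose_smul, encodedHamiltonian_isSelfAdjoint, ← neg_smul]
  congr 1
  simp [neg_div]

theorem norm_encodedHamiltonian_le {h : ℝ} (hh : (N : ℝ) ^ 2 / 2 ≤ h) (a : Fin N → ℝ) :
    ‖encodedHamiltonian N h a‖ ≤ 8 * h := by
  have h0 : 0 ≤ h := le_trans (by positivity) hh
  refine (norm_add_le _ _).trans ?_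
  have h1 : ‖potential fun r => 4 * h * truncate (a r)‖ ≤ 4 * h := by
    rw [norm_potential, pi_norm_le_iff_of_nonneg (by linarith)]
    intro r
    rw [Real.norm_eq_abs, abs_mul, abs_of_nonneg (by linarith : 0 ≤ 4 * h)]
    exact mul_le_of_le_one_right (by linarith) (abs_truncate_le _)
  linarith [norm_kinetic_le (N := N)]

theorem norm_generator_le {h : ℝ} (h0 : 0 < h) (hh : (N : ℝ) ^ 2 / 2 ≤ h) (a : Fin N → ℝ) :
    ‖generator N h a‖ ≤ 1 := by
  rw [generator, norm_smul, norm_div, norm_neg, Complex.norm_I, Complex.norm_real,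
    Real.norm_of_nonneg (by linarith), div_mul_eq_mul_div, one_mul, div_le_one (by linarith)]
  exact norm_encodedHamiltonian_le hh a

/-- Kinetic energy and truncated potential are both bounded by `4 * h`, so divided by it each is
half the sum of two unitaries; the average over all four produces the normalization `8 * h`. -/
theorem exists_kinetic_split {h : ℝ} (h0 : 0 < h) (hh : (N : ℝ) ^ 2 / 2 ≤ h) :
    ∃ U : Bool → unitaryGroup (Fin N) ℂ, ∀ a : Fin N → ℝ,
      generator N h a = (1 / 4 : ℝ) • ∑ t, (gridTerm U a t : Matrix (Fin N) (Fin N) ℂ) := by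
  obtain ⟨U, hU⟩ := exists_unitary_split (a := ((1 / (4 * h) : ℝ) : ℂ) • kinetic N)
    (by rw [conjTranspose_smul, kinetic_isSelfAdjoint]; simp) (by
      rw [norm_smul, Complex.norm_real, Real.norm_of_nonneg (by positivity), one_div_mul_eq_div,
        div_le_one (by linarith)]
      linarith [norm_kinetic_le (N := N)])
  refine ⟨U, fun a => ?_⟩
  have hV : ∑ b, (phaseGate (fun r => potentialPhase (a r) b) : Matrix (Fin N) (Fin N) ℂ)
      = diagonal fun r => -Complex.I * (2 * truncate (a r) : ℝ) := by
    ext i j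
    rw [Matrix.sum_apply]
    by_cases hij : i = j
    · subst hij
      simp only [phaseGate, diagonal_apply_eq]
      exact sum_potentialPhase _
    · simp [phaseGate, hij]
  rw [Fintype.sum_prod_type, Fintype.sum_bool]
  simp only [gridTerm]
  rw [hU, hV, generator, encodedHamiltonian, potential]
  have h0' : (h : ℂ) ≠ 0 := by exact_mod_cast h0.ne'
  ext i j
  by_cases hij : i = j
  · subst hij
    simp
    field_simp
    ring
  · simp [hij]
    field_simp
    ring

theorem one_add_generator {h : ℝ} (h0 : 0 < h) (τ : ℝ) (a : Fin N → ℝ) :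
    1 + (8 * h * τ) • generator N h a = 1 - (τ * Complex.I) • encodedHamiltonian N h a := by
  have h0' : (h : ℂ) ≠ 0 := by exact_mod_cast h0.ne'
  rw [sub_eq_add_neg, ← neg_smul, generator]
  congr 1
  ext i j
  simp
  field_simp

end Splitting

end CAP
end

noncomputable section
namespace CAP

open Matrix

/-! ### Time discretization of the Schrödinger equation -/

section Discretization

variable {N : ℕ} {T : ℝ}

/-- The matrix on the right-hand side of the Schrödinger equation. -/
def Problem.rhs (P : Problem N T) (t : ℝ) : Matrix (Fin N) (Fin N) ℂ :=
  -Complex.I • (hamiltonian (P.VR t) - Complex.I • potential P.VI)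

theorem Problem.hasDerivWithinAt (P : Problem N T) {t : ℝ} (ht : t ∈ Set.Icc 0 T) :
    HasDerivWithinAt P.u (toEuclideanCLM (n := Fin N) (𝕜 := ℂ) (P.rhs t) (P.u t))
      (Set.Icc 0 T) t := by
  have := P.solves t ht
  rwa [← _root_.smul_apply, ← map_smul] at this

theorem hamiltonian_isSelfAdjoint (V : Fin N → ℝ) : (hamiltonian V)ᴴ = hamiltonian V := by
  rw [hamiltonian_eq, conjTranspose_add, kinetic_isSelfAdjoint, potential_isSelfAdjoint]

theorem Problem.rhs_add_conjTranspose (P : Problem N T) (t : ℝ) :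
    P.rhs t + (P.rhs t)ᴴ = (-2 : ℂ) • potential P.VI := by
  rw [rhs, conjTranspose_smul, conjTranspose_sub, conjTranspose_smul, hamiltonian_isSelfAdjoint,
    potential_isSelfAdjoint]
  simp only [RCLike.star_def, map_neg, Complex.conj_I, neg_neg, smul_sub, smul_smul]
  simp only [mul_neg, neg_mul, Complex.I_mul_I, neg_neg, neg_smul, one_smul]
  module

/-- `H` is self-adjoint, so only the absorbing part contributes to the derivative of `‖u‖²`, which
is `-2 ⟨u, V_I u⟩ ≤ 0`. -/
theorem Problem.norm_u_le (P : Problem N T) {t : ℝ} (ht : t ∈ Set.Icc 0 T) :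
    ‖P.u t‖ ≤ ‖P.u 0‖ := by
  have hT : 0 ≤ T := ht.1.trans ht.2
  have hd : ∀ s ∈ Set.Icc 0 T, HasDerivWithinAt (fun s => (inner ℂ (P.u s) (P.u s)).re)
      (-2 * ∑ r, P.VI r * ‖P.u s r‖ ^ 2) (Set.Icc 0 T) s := by
    intro s hs
    have h1 := (P.hasDerivWithinAt hs).inner ℂ (P.hasDerivWithinAt hs)
    have h2 := Complex.reCLM.hasFDerivAt.comp_hasDerivWithinAt s h1
    refine h2.congr_deriv ?_
    rw [← ContinuousLinearMap.adjoint_inner_right, ← inner_add_right,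
      ← ContinuousLinearMap.star_eq_adjoint, ← map_star, star_eq_conjTranspose,
      ← _root_.add_apply, ← map_add, P.rhs_add_conjTranspose]
    rw [PiLp.inner_apply]
    simp only [Complex.reCLM_apply, Complex.re_sum, Finset.mul_sum]
    refine Finset.sum_congr rfl fun r _ => ?_
    rw [ofLp_toEuclideanCLM]
    simp only [potential, smul_mulVec, Pi.smul_apply, mulVec_diagonal]
    rw [← Complex.normSq_eq_norm_sq, Complex.normSq_apply]
    simp [Complex.mul_re]
    ring
  have hanti : AntitoneOn (fun s => (inner ℂ (P.u s) (P.u s)).re) (Set.Icc 0 T) := by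
    refine antitoneOn_of_hasDerivWithinAt_nonpos (convex_Icc 0 T)
      (fun s hs => (hd s hs).continuousWithinAt)
      (fun s hs => (hd s (interior_subset hs)).mono interior_subset) ?_
    intro s _
    have : 0 ≤ ∑ r, P.VI r * ‖P.u s r‖ ^ 2 :=
      Finset.sum_nonneg fun r _ => mul_nonneg (P.VI_nonneg r) (sq_nonneg _)
    linarith
  have h := hanti ⟨le_rfl, hT⟩ ht ht.1
  have e : ∀ s, (inner ℂ (P.u s) (P.u s)).re = ‖P.u s‖ ^ 2 := fun s =>
    inner_self_eq_norm_sq (𝕜 := ℂ) _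
  simp only [e] at h
  exact pow_le_pow_iff_left₀ (norm_nonneg _) (norm_nonneg _) two_ne_zero |>.1 h

theorem Problem.norm_rhs_le (P : Problem N T) {h w : ℝ} (hH : P.maxH ≤ h)
    (hw : ‖potential P.VI‖ ≤ w) {t : ℝ} (ht : t ∈ Set.Icc 0 T) : ‖P.rhs t‖ ≤ h + w := by
  rw [rhs, norm_smul, norm_neg, Complex.norm_I, one_mul]
  refine (norm_sub_le _ _).trans ?_
  rw [norm_smul, Complex.norm_I, one_mul]
  exact add_le_add (P.norm_H_le hH ht) hw

theorem norm_clm_apply_le (M : Matrix (Fin N) (Fin N) ℂ) (x : EuclideanSpace ℂ (Fin N)) :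
    ‖toEuclideanCLM (n := Fin N) (𝕜 := ℂ) M x‖ ≤ ‖M‖ * ‖x‖ := by
  rw [← l2_opNorm_toEuclideanCLM M]
  exact ContinuousLinearMap.le_opNorm _ _

/-- No second derivative is needed: `u'` is Lipschitz up to the factor `‖u(0)‖`, with a contribution
`v` from the change of `V_R` and `(h + w) ^ 2` from the change of `u`. -/
theorem Problem.norm_euler_sub_le (P : Problem N T) {h v w : ℝ} (hT : 0 < T) (hH : P.maxH ≤ h)
    (hv : P.maxVR' ≤ v) (hw : ‖potential P.VI‖ ≤ w) {t d : ℝ} (ht : 0 ≤ t) (hd : 0 ≤ d)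
    (htd : t + d ≤ T) :
    ‖P.u (t + d) - P.u t - d • toEuclideanCLM (n := Fin N) (𝕜 := ℂ) (P.rhs t) (P.u t)‖
      ≤ d ^ 2 * (v + (h + w) ^ 2) * ‖P.u 0‖ := by
  have hsub : Set.Icc t (t + d) ⊆ Set.Icc 0 T := fun s hs => ⟨ht.trans hs.1, hs.2.trans htd⟩
  have htT : t ∈ Set.Icc 0 T := ⟨ht, by linarith⟩
  have hhw : 0 ≤ h + w := (norm_nonneg _).trans (P.norm_rhs_le hH hw htT)
  have hv0 : 0 ≤ v := P.nonneg_of_maxVR'_le hT hv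
  have hu : ∀ s ∈ Set.Icc 0 T, ‖toEuclideanCLM (n := Fin N) (𝕜 := ℂ) (P.rhs s) (P.u s)‖
      ≤ (h + w) * ‖P.u 0‖ := fun s hs => (norm_clm_apply_le _ _).trans
    (mul_le_mul (P.norm_rhs_le hH hw hs) (P.norm_u_le hs) (norm_nonneg _) hhw)
  have h1 : ∀ s ∈ Set.Icc t (t + d), ‖P.u s - P.u t‖ ≤ (h + w) * ‖P.u 0‖ * (s - t) :=
    norm_image_sub_le_of_norm_deriv_le_segment'
      (fun s hs => (P.hasDerivWithinAt (hsub hs)).mono hsub)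
      (fun s hs => hu s (hsub (Set.Ico_subset_Icc_self hs)))
  have h2 : ∀ s ∈ Set.Icc t (t + d),
      ‖toEuclideanCLM (n := Fin N) (𝕜 := ℂ) (P.rhs s) (P.u s)
        - toEuclideanCLM (n := Fin N) (𝕜 := ℂ) (P.rhs t) (P.u t)‖
        ≤ d * (v + (h + w) ^ 2) * ‖P.u 0‖ := by
    intro s hs
    have hst : |s - t| ≤ d := by rw [abs_le]; constructor <;> linarith [hs.1, hs.2]
    have e : toEuclideanCLM (n := Fin N) (𝕜 := ℂ) (P.rhs s) (P.u s)
        - toEuclideanCLM (n := Fin N) (𝕜 := ℂ) (P.rhs t) (P.u t)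
        = toEuclideanCLM (n := Fin N) (𝕜 := ℂ) (P.rhs s) (P.u s - P.u t)
          + toEuclideanCLM (n := Fin N) (𝕜 := ℂ) (P.rhs s - P.rhs t) (P.u t) := by
      rw [map_sub, map_sub, _root_.sub_apply]; abel
    have e2 : ‖P.rhs s - P.rhs t‖ ≤ v * d := by
      have : P.rhs s - P.rhs t = -Complex.I • potential (P.VR s - P.VR t) := by
        rw [rhs, rhs, hamiltonian_eq, hamiltonian_eq, potential_sub]; module
      rw [this, norm_smul, norm_neg, Complex.norm_I, one_mul, norm_potential]
      exact (P.norm_VR_sub_le hT hv htT (hsub hs)).trans (mul_le_mul_of_nonneg_left hst hv0)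
    rw [e]
    refine (norm_add_le _ _).trans ?_
    have e3 : ‖P.u s - P.u t‖ ≤ (h + w) * ‖P.u 0‖ * d :=
      (h1 s hs).trans (mul_le_mul_of_nonneg_left (by linarith [hs.2]) (by positivity))
    have e4 := (norm_clm_apply_le (P.rhs s) (P.u s - P.u t)).trans
      (mul_le_mul (P.norm_rhs_le hH hw (hsub hs)) e3 (norm_nonneg _) hhw)
    have e5 := (norm_clm_apply_le (P.rhs s - P.rhs t) (P.u t)).trans
      (mul_le_mul e2 (P.norm_u_le htT) (norm_nonneg _) (by positivity))
    calc _ ≤ _ := add_le_add e4 e5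
      _ = _ := by ring
  -- Mean value inequality for `u` minus its tangent at time `t`.
  have h3 := norm_image_sub_le_of_norm_deriv_le_segment'
    (f := fun s => P.u s - s • toEuclideanCLM (n := Fin N) (𝕜 := ℂ) (P.rhs t) (P.u t))
    (fun s hs => ((P.hasDerivWithinAt (hsub hs)).mono hsub).sub
      ((hasDerivWithinAt_id s _).smul_const _))
    (fun s hs => by
      rw [one_smul]
      exact h2 s (Set.Ico_subset_Icc_self hs)) (t + d) ⟨by linarith, le_rfl⟩
  calc _ = ‖P.u (t + d) - (t + d) • toEuclideanCLM (n := Fin N) (𝕜 := ℂ) (P.rhs t) (P.u t)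
        - (P.u t - t • toEuclideanCLM (n := Fin N) (𝕜 := ℂ) (P.rhs t) (P.u t))‖ := by
        congr 1; module
    _ ≤ _ := h3
    _ = _ := by ring

/-- One damped step of the discretization. -/
def dampedStep (d : ℝ) (ω : Fin N → ℝ) (K : Matrix (Fin N) (Fin N) ℂ) : Matrix (Fin N) (Fin N) ℂ :=
  diagonal (fun r => ((1 - d * ω r : ℝ) : ℂ)) * (1 - (d * Complex.I) • K)

theorem Problem.norm_dampedStep_sub_le (P : Problem N T) {d δ δ' w k : ℝ} (hd : 0 ≤ d)
    {ω : Fin N → ℝ} {K : Matrix (Fin N) (Fin N) ℂ} {t : ℝ} (hδ : ‖P.VI - ω‖ ≤ δ)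
    (hδ' : ‖hamiltonian (P.VR t) - K‖ ≤ δ') (hω : ‖ω‖ ≤ w) (hK : ‖K‖ ≤ k) :
    ‖dampedStep d ω K - (1 + d • P.rhs t)‖ ≤ d * (δ + δ') + d ^ 2 * (w * k) := by
  have h1 : diagonal (fun r => ((1 - d * ω r : ℝ) : ℂ)) = 1 - (d : ℂ) • potential ω := by
    ext i j
    by_cases hij : i = j
    · subst hij; simp [potential]
    · simp [potential, hij]
  have h2 : dampedStep d ω K - (1 + d • P.rhs t)
      = (d : ℂ) • potential (P.VI - ω) + (d * Complex.I) • (hamiltonian (P.VR t) - K)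
        + (d ^ 2 * Complex.I) • (potential ω * K) := by
    have e : (d : ℝ) • P.rhs t = (d : ℂ) • P.rhs t := by
      ext i j; simp
    rw [dampedStep, h1, e, rhs, potential_sub]
    simp only [sub_mul, mul_sub, one_mul, mul_one, smul_mul_assoc, mul_smul_comm, smul_smul,
      smul_sub]
    rw [show (d : ℂ) * (-Complex.I * Complex.I) = d by rw [neg_mul, Complex.I_mul_I]; ring]
    module
  have n1 : ‖(d : ℂ)‖ = d := by rw [Complex.norm_real, Real.norm_of_nonneg hd]
  rw [h2]
  refine (norm_add_le _ _).trans (add_le_add ((norm_add_le _ _).trans ?_) ?_)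
  · rw [norm_smul, norm_smul, norm_mul, Complex.norm_I, n1, mul_one, norm_potential, mul_add]
    exact add_le_add (mul_le_mul_of_nonneg_left hδ hd) (mul_le_mul_of_nonneg_left hδ' hd)
  · rw [norm_smul, norm_mul, norm_pow, Complex.norm_I, n1, mul_one]
    refine mul_le_mul_of_nonneg_left ((norm_mul_le _ _).trans ?_) (sq_nonneg d)
    rw [norm_potential]
    exact mul_le_mul hω hK (norm_nonneg _) ((norm_nonneg _).trans hω)

/-- Local errors are transported by the later steps. These are not contractions but have norm at
most `C`, whence `C ^ k`. -/
theorem norm_ordProd_apply_sub_le {E : Type*} [NormedAddCommGroup E] [NormedSpace ℂ E]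
    (Φ : ℕ → E →L[ℂ] E) (u : ℕ → E) {C η : ℝ} (hC : 1 ≤ C) (hη : 0 ≤ η) {k : ℕ}
    (hΦ : ∀ j < k, ‖Φ j‖ ≤ C) (hu : ∀ j < k, ‖Φ j (u j) - u (j + 1)‖ ≤ η) :
    ‖ordProd Φ 0 k (u 0) - u k‖ ≤ k * (η * C ^ k) := by
  induction k with
  | zero => simp [ordProd_self]
  | succ k ih =>
    have ih' := ih (fun j hj => hΦ j (by omega)) (fun j hj => hu j (by omega))
    rw [ordProd_succ_top _ (Nat.zero_le _), mul_apply_eq_comp]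
    have e : Φ k (ordProd Φ 0 k (u 0)) - u (k + 1)
        = Φ k (ordProd Φ 0 k (u 0) - u k) + (Φ k (u k) - u (k + 1)) := by
      rw [map_sub]; abel
    rw [e]
    refine (norm_add_le _ _).trans ?_
    have h1 := (ContinuousLinearMap.le_opNorm (Φ k) (ordProd Φ 0 k (u 0) - u k)).trans
      (mul_le_mul (hΦ k (by omega)) ih' (norm_nonneg _) (by linarith))
    have h2 := hu k (by omega)
    have h3 : 1 ≤ C ^ (k + 1) := one_le_pow₀ hC
    push_cast
    have h4 : C * (k * (η * C ^ k)) = k * (η * C ^ (k + 1)) := by ring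
    nlinarith

theorem map_ordProd {A B F : Type*} [Monoid A] [Monoid B] [FunLike F A B] [MonoidHomClass F A B]
    (f : F) (G : ℕ → A) (a b : ℕ) : f (ordProd G a b) = ordProd (fun j => f (G j)) a b := by
  rw [ordProd, ordProd, map_list_prod, List.map_reverse, List.map_map]
  rfl

theorem Problem.norm_discrete_sub_le (P : Problem N T) {h v w δ δ' k d C : ℝ} (hT : 0 < T)
    (hH : P.maxH ≤ h) (hv : P.maxVR' ≤ v) (hw : ‖potential P.VI‖ ≤ w) {L : ℕ} (hd : 0 ≤ d)
    (hL : L * d = T)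
    {ω : Fin N → ℝ} {K : ℕ → Matrix (Fin N) (Fin N) ℂ} (hδ : ‖P.VI - ω‖ ≤ δ)
    (hδ' : ∀ j < L, ‖hamiltonian (P.VR (j * d)) - K j‖ ≤ δ') (hω : ‖ω‖ ≤ w)
    (hK : ∀ j, ‖K j‖ ≤ k) (hC : 1 ≤ C) (hC' : ∀ j, ‖dampedStep d ω (K j)‖ ≤ C) :
    ‖toEuclideanCLM (n := Fin N) (𝕜 := ℂ) (ordProd (fun j => dampedStep d ω (K j)) 0 L) (P.u 0)
        - P.u T‖
      ≤ (T * (δ + δ') + T * d * (v + (h + w) ^ 2 + w * k)) * C ^ L * ‖P.u 0‖ := by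
  rcases Nat.eq_zero_or_pos L with rfl | hLpos
  · simp at hL; linarith
  have hmem : ∀ j ≤ L, (j : ℝ) * d ∈ Set.Icc 0 T := fun j hj => by
    have : (j : ℝ) ≤ L := by exact_mod_cast hj
    exact ⟨by positivity, hL ▸ mul_le_mul_of_nonneg_right this hd⟩
  have hloc : ∀ j < L, ‖toEuclideanCLM (n := Fin N) (𝕜 := ℂ) (dampedStep d ω (K j))
      (P.u (j * d)) - P.u ((j + 1 : ℕ) * d)‖
      ≤ (d * (δ + δ') + d ^ 2 * (v + (h + w) ^ 2 + w * k)) * ‖P.u 0‖ := by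
    intro j hj
    have h1 := P.norm_euler_sub_le hT hH hv hw (hmem j hj.le).1 hd
      (by have := (hmem (j + 1) hj).2; push_cast at this; linarith)
    have h2 := P.norm_dampedStep_sub_le hd hδ (hδ' j hj) hω (hK j)
    have h3 := (norm_clm_apply_le (dampedStep d ω (K j) - (1 + d • P.rhs (j * d)))
      (P.u (j * d))).trans (mul_le_mul h2 (P.norm_u_le (hmem j hj.le)) (norm_nonneg _)
        ((norm_nonneg _).trans h2))
    have e1 : ((j + 1 : ℕ) : ℝ) * d = j * d + d := by push_cast; ring
    have e2 : toEuclideanCLM (n := Fin N) (𝕜 := ℂ) (dampedStep d ω (K j)) (P.u (j * d))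
        - P.u ((j + 1 : ℕ) * d)
        = toEuclideanCLM (n := Fin N) (𝕜 := ℂ) (dampedStep d ω (K j) - (1 + d • P.rhs (j * d)))
            (P.u (j * d))
          - (P.u (j * d + d) - P.u (j * d)
            - d • toEuclideanCLM (n := Fin N) (𝕜 := ℂ) (P.rhs (j * d)) (P.u (j * d))) := by
      have e3 : (d : ℝ) • P.rhs (j * d) = (d : ℂ) • P.rhs (j * d) := by
        ext i j; simp
      have e4 : d • toEuclideanCLM (n := Fin N) (𝕜 := ℂ) (P.rhs (j * d)) (P.u (j * d))
          = (d : ℂ) • toEuclideanCLM (n := Fin N) (𝕜 := ℂ) (P.rhs (j * d)) (P.u (j * d)) := by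
        ext i; simp
      rw [e1, e3, e4, map_sub, map_add, map_one, map_smul, _root_.sub_apply,
        _root_.add_apply, _root_.smul_apply,
        one_apply_eq_self]
      abel
    rw [e2]
    refine (norm_sub_le _ _).trans ((add_le_add h3 h1).trans (le_of_eq ?_))
    ring
  have := norm_ordProd_apply_sub_le
    (fun j => toEuclideanCLM (n := Fin N) (𝕜 := ℂ) (dampedStep d ω (K j))) (fun j => P.u (j * d))
    hC ((norm_nonneg _).trans (hloc 0 hLpos))
    (fun j _ => by rw [l2_opNorm_toEuclideanCLM]; exact hC' j) hloc
  rw [← map_ordProd, Nat.cast_zero, zero_mul, hL] at this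
  refine this.trans (le_of_eq ?_)
  linear_combination ((δ + δ') + d * (v + (h + w) ^ 2 + w * k)) * C ^ L * ‖P.u 0‖ * hL

end Discretization

end CAP
end

noncomputable section
namespace CAP

open Matrix

/-! ### The circuit for the dilated evolution -/

section ImplProducts

variable {N m D a : ℕ} {S : Type} {e : S ≃ Fin N × Fin (a + 1)} [NeZero m] [NeZero D] [Fintype S]
  [DecidableEq S]

theorem Impl.one : Impl (m := m) (D := D) e (fun _ => 1) 0 0 := Impl.gate 1

theorem Impl.ofFn_prod {k b c : ℕ} {G : Fin k → OracleData N m D → unitaryGroup S ℂ}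
    (h : ∀ i, Impl e (G i) b c) :
    Impl e (fun d => (List.ofFn fun i => G i d).prod) (k * b) (k * c) := by
  induction k with
  | zero => simpa using Impl.one
  | succ k ih =>
    refine (((h 0).mul (ih fun i => h i.succ)).mono (by ring_nf; exact le_rfl)
      (by ring_nf; exact le_rfl)).of_eq fun d => ?_
    rw [List.ofFn_succ, List.prod_cons]

theorem Impl.ofFn_reverse_prod {k b c : ℕ} {G : Fin k → OracleData N m D → unitaryGroup S ℂ}
    (h : ∀ i, Impl e (G i) b c) :
    Impl e (fun d => (List.ofFn fun i => G i d).reverse.prod) (k * b) (k * c) := by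
  induction k with
  | zero => simpa using Impl.one
  | succ k ih =>
    refine (((ih fun i => h i.succ).mul (h 0)).mono (by ring_nf; exact le_rfl)
      (by ring_nf; exact le_rfl)).of_eq fun d => ?_
    simp [List.ofFn_succ]

theorem Impl.ordProd {k b c : ℕ} {G : ℕ → OracleData N m D → unitaryGroup S ℂ}
    (h : ∀ i, Impl e (G i) b c) :
    Impl e (fun d => CAP.ordProd (fun i => G i d) 0 k) (k * b) (k * c) := by
  induction k with
  | zero => simpa [ordProd_self] using Impl.one
  | succ k ih =>
    refine (((h k).mul ih).mono (by ring_nf; exact le_rfl)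
      (by ring_nf; exact le_rfl)).of_eq fun d => ?_
    rw [ordProd_succ_top _ (Nat.zero_le _)]

end ImplProducts

/-! ### Placement of the registers and costs of the elementary controlled operations. -/

section Layout

/-- The registers: environment, grid, slots, round counter. -/
abbrev Space (N L n κ M : ℕ) := ((Option (Fin L) × Fin N) × Slots n κ) × Fin M

/-- The registers other than the grid. -/
abbrev Work (L n κ M : ℕ) := Option (Fin L) × Slots n κ × Fin M

variable {N m D a L n κ M : ℕ}

/-- The layout of the registers in the machine. -/
def layout (N : ℕ) (f : Work L n κ M ≃ Fin (a + 1)) : Space N L n κ M ≃ Fin N × Fin (a + 1) where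
  toFun z := (z.1.1.2, f (z.1.1.1, z.1.2, z.2))
  invFun p := ((((f.symm p.2).1, p.1), (f.symm p.2).2.1), (f.symm p.2).2.2)
  left_inv z := by simp
  right_inv p := by simp

variable {f : Work L n κ M ≃ Fin (a + 1)} [NeZero m] [NeZero D]

/-- `X ⊗ 1`, with the counter as the second factor. -/
def liftU {S : Type} [Fintype S] [DecidableEq S] (M : ℕ) :
    unitaryGroup S ℂ →* unitaryGroup (S × Fin M) ℂ :=
  blockU.comp (Pi.constMonoidHom (Fin M) (unitaryGroup S ℂ))

theorem liftU_apply {S : Type} [Fintype S] [DecidableEq S] (X : unitaryGroup S ℂ) (z z' : S)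
    (j j' : Fin M) : (liftU M X : Matrix (S × Fin M) (S × Fin M) ℂ) (z, j) (z', j')
      = if j = j' then (X : Matrix S S ℂ) z z' else 0 := by
  change (blockDiagonal fun _ : Fin M => (X : Matrix S S ℂ)) (z, j) (z', j') = _
  rw [blockDiagonal_apply]

/-- The unitary on the environment is an arbitrary function of the word and the slots, so any number
of rotations is covered by one computation and one erasure of the word. -/
theorem impl_damping (w : Slots n κ → Fin D → unitaryGroup (Option (Fin L)) ℂ) :
    Impl (m := m) (layout N f) (fun d => liftU M (blockU fun σ => blockU fun r => w σ (d.yI r)))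
      2 0 := by
  refine Impl.queryVI (fun y => liftU M (blockU fun σ => blockU fun _ => w σ y)) ?_ ?_
  · rintro y ⟨⟨⟨a, r⟩, σ⟩, j⟩ ⟨⟨⟨a', r'⟩, σ'⟩, j'⟩ h
    change r ≠ r' at h
    rw [liftU_apply, blockU_apply, blockDiagonal_apply, blockU_apply, blockDiagonal_apply]
    simp [h]
  · rintro d ⟨⟨⟨a, r⟩, σ⟩, j⟩ ⟨⟨⟨a', r'⟩, σ'⟩, j'⟩
    rw [liftU_apply, liftU_apply]
    rw [blockU_apply, blockDiagonal_apply, blockU_apply, blockDiagonal_apply, blockU_apply,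
      blockDiagonal_apply, blockU_apply, blockDiagonal_apply]
    rfl

theorem impl_phase (s : Slots n κ → Fin m) (φ : Slots n κ → Fin D → unitary ℂ) :
    Impl (layout N f) (fun d => liftU M (blockU fun σ => tensorU (Option (Fin L))
      (phaseGate fun r => φ σ (d.yR r (s σ))))) 2 0 := by
  refine (Impl.queryVR (e := layout N f) (fun z => s z.1.2) (fun y z => φ z.1.2 y)).of_eq
    fun d => Subtype.ext ?_
  ext ⟨⟨⟨a, r⟩, σ⟩, j⟩ ⟨⟨⟨a', r'⟩, σ'⟩, j'⟩
  rw [liftU_apply, blockU_apply, blockDiagonal_apply]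
  simp only [tensorU_apply, phaseGate, diagonal_apply, Prod.mk.injEq]
  have : ((layout N f) (((a, r), σ), j)).1 = r := rfl
  rw [this]
  by_cases h1 : j = j' <;> by_cases h2 : σ = σ' <;> by_cases h3 : a = a' <;>
    by_cases h4 : r = r' <;> simp [h1, h2, h3, h4]

theorem impl_prep : Impl (m := m) (D := D) (layout N f) (fun d => liftU M (blockU fun _ =>
    tensorU (Option (Fin L)) d.prep)) 0 1 := by
  refine Impl.queryPrep ?_
  rintro d ⟨⟨⟨a, r⟩, σ⟩, j⟩ ⟨⟨⟨a', r'⟩, σ'⟩, j'⟩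
  rw [liftU_apply, blockU_apply, blockDiagonal_apply, tensorU_apply]
  have h1 : ((layout N f) (((a, r), σ), j)).1 = r := rfl
  have h2 : ((layout N f) (((a', r'), σ'), j')).1 = r' := rfl
  have h3 : ((layout N f) (((a, r), σ), j)).2 = f (a, σ, j) := rfl
  have h4 : ((layout N f) (((a', r'), σ'), j')).2 = f (a', σ', j') := rfl
  rw [h1, h2, h3, h4]
  by_cases h1 : j = j' <;> by_cases h2 : σ = σ' <;> by_cases h3 : a = a' <;>
    simp [h1, h2, h3, f.injective.eq_iff]

end Layout

/-! ### The evolution circuit and its query count. -/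

section Evolution

/-- Parameters of the algorithm: the damping factors `c` and the normalized potentials `v`
represented by the words, the unitaries `U` for the kinetic energy, and the time at which the
potential is read off in each step. -/
structure Scheme (N m D : ℕ) where
  c : Fin D → ℝ
  abs_c_le : ∀ y, |c y| ≤ 1
  v : Fin D → ℝ
  U : Bool → unitaryGroup (Fin N) ℂ
  time : ℕ → Fin m

variable {N m D : ℕ} (A : Scheme N m D) (d : OracleData N m D)

/-- Damping in step `j`. -/
def Scheme.damp (L j : ℕ) : unitaryGroup (Option (Fin L) × Fin N) ℂ :=
  blockU fun r => rotSeq L (A.c (d.yI r)) (A.abs_c_le _) j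

/-- Damping in the first `j` steps. -/
def Scheme.cumDamp (L j : ℕ) : unitaryGroup (Option (Fin L) × Fin N) ℂ :=
  ordProd (A.damp d L) 0 j

/-- The unitaries of step `j` in the interaction picture. -/
def Scheme.term (L j : ℕ) (t : Kind) : unitaryGroup (Option (Fin L) × Fin N) ℂ :=
  (A.cumDamp d L j)⁻¹
    * tensorU (Option (Fin L)) (gridTerm A.U (fun r => A.v (d.yR r (A.time j))) t)
    * A.cumDamp d L j

/-- One segment of `n` steps. -/
def Scheme.segment {n κ : ℕ} (R : unitaryGroup (Slots n κ) ℂ) (L k : ℕ) :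
    unitaryGroup ((Option (Fin L) × Fin N) × Slots n κ) ℂ :=
  amplify (slot₀ n κ) (lcu R (segmentTerm fun j t => A.term d L (k * n + j) t))

/-- State preparation followed by `r` segments. -/
def Scheme.evolution {n κ : ℕ} (R : unitaryGroup (Slots n κ) ℂ) (L r : ℕ) :
    unitaryGroup ((Option (Fin L) × Fin N) × Slots n κ) ℂ :=
  blockU (fun _ => A.cumDamp d L L) * ordProd (A.segment d R L) 0 r
    * blockU (fun _ => tensorU (Option (Fin L)) d.prep)

/-- Block-diagonal unitaries multiply blockwise, so the product over all steps is again controlled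
by the single word `d.yI r`. The cost of damping is therefore independent of the number of steps. -/
theorem Scheme.cumDamp_eq (L j : ℕ) : A.cumDamp d L j
    = blockU fun r => ordProd (rotSeq L (A.c (d.yI r)) (A.abs_c_le _)) 0 j := by
  have : A.cumDamp d L j
      = blockU (ordProd (fun j r => rotSeq L (A.c (d.yI r)) (A.abs_c_le _) j) 0 j) := by
    rw [map_ordProd]; rfl
  rw [this]
  congr 1
  funext r
  exact map_ordProd (Pi.evalMonoidHom (fun _ : Fin N => unitaryGroup (Option (Fin L)) ℂ) r) _ 0 j

variable {a L n κ M : ℕ} {f : Work L n κ M ≃ Fin (a + 1)}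

/-- The kinetic part of a slot. -/
def Scheme.slotKinetic : Option (Fin n × Kind) → unitaryGroup (Fin N) ℂ
  | some (_, (false, b)) => A.U b
  | _ => 1

/-- The phases in a slot for the word `y`. -/
def Scheme.slotPhase (o : Option (Fin n × Kind)) (y : Fin D) : unitary ℂ :=
  match o with
  | some (_, (true, b)) => potentialPhase (A.v y) b
  | _ => 1

/-- The number of the step a slot refers to. -/
def slotPos (k : ℕ) : Option (Fin n × Kind) → ℕ
  -- The value is immaterial: in an empty slot nothing stands between the two dampings, and they
  -- cancel.
  | none => 0
  | some (j, _) => k * n + j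

/-- All slot contents are brought to one form, with trivial factors where necessary, so that one
circuit serves a superposition of them. -/
theorem Scheme.slotOp_term (k : ℕ) (o : Option (Fin n × Kind)) :
    slotOp (fun j t => A.term d L (k * n + j) t) o
      = (A.cumDamp d L (slotPos k o))⁻¹
        * (tensorU (Option (Fin L)) (A.slotKinetic o) * tensorU (Option (Fin L))
          (phaseGate fun r => A.slotPhase o (d.yR r (A.time (slotPos k o)))))
        * A.cumDamp d L (slotPos k o) := by
  have h1 : tensorU (Option (Fin L)) (phaseGate fun _ : Fin N => (1 : unitary ℂ)) = 1 := by
    apply Subtype.ext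
    ext ⟨x, r⟩ ⟨x', r'⟩
    rw [tensorU_apply]
    by_cases hx : x = x' <;> by_cases hr : r = r' <;> simp [phaseGate, hx, hr, one_apply]
  have h2 : tensorU (Option (Fin L)) (1 : unitaryGroup (Fin N) ℂ) = 1 :=
    Subtype.ext one_kronecker_one
  rcases o with _ | ⟨j, _ | _, b⟩
  · simp [slotOp, slotKinetic, slotPhase, h1, h2]
  · simp only [slotOp, slotKinetic, slotPhase, h1, mul_one]; rfl
  · simp only [slotOp, slotKinetic, slotPhase, h2, one_mul]; rfl

variable [NeZero m] [NeZero D]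

theorem Scheme.impl_cumDamp (pos : Slots n κ → ℕ) :
    Impl (layout N f) (fun d => liftU M (blockU fun σ => A.cumDamp d L (pos σ))) 2 0 :=
  (impl_damping fun σ y => ordProd (rotSeq L (A.c y) (A.abs_c_le _)) 0 (pos σ)).of_eq fun d => by
    simp only [cumDamp_eq]

/-- Two queries for each of the two cumulative dampings and two for the phases, at positions read
from the slot. -/
theorem Scheme.impl_slot (k : ℕ) (i : Fin κ) :
    Impl (layout N f) (fun d => liftU M (blockU fun σ : Slots n κ =>
      slotOp (fun j t => A.term d L (k * n + j) t) (σ.1 i))) 6 0 := by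
  have h1 := A.impl_cumDamp (f := f) (fun σ => slotPos k (σ.1 i))
  have h2 := Impl.gate (m := m) (D := D) (e := layout N f) (liftU M (blockU fun σ =>
    tensorU (Option (Fin L)) (A.slotKinetic (σ.1 i))))
  have h3 := impl_phase (N := N) (f := f) (fun σ => A.time (slotPos k (σ.1 i))) (fun σ y =>
    A.slotPhase (σ.1 i) y)
  refine ((h1.inv.mul (h2.mul h3)).mul h1).of_eq fun d => ?_
  simp only [← map_mul, ← map_inv]
  congr 2
  funext σ
  exact A.slotOp_term d k (σ.1 i)

theorem Scheme.impl_lcu (R : unitaryGroup (Slots n κ) ℂ) (k : ℕ) :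
    Impl (layout N f) (fun d => liftU M
      (lcu R (segmentTerm fun j t => A.term d L (k * n + j) t))) (6 * κ) 0 := by
  have h1 := Impl.ofFn_reverse_prod fun i => A.impl_slot (f := f) k i
  have h2 := Impl.gate (m := m) (D := D) (e := layout N f) (liftU M (tensorU _ R))
  have h3 := Impl.gate (m := m) (D := D) (e := layout N f)
    (liftU M (blockU fun σ : Slots n κ => if σ.2 then -1 else 1))
  refine (((h2.inv.mul (h3.mul h1)).mul h2).mono (by omega) (by omega)).of_eq fun d => ?_
  rw [lcu, map_mul, map_mul, map_inv]
  congr 2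
  have : (segmentTerm fun j t => A.term d L (k * n + j) t)
      = (fun σ : Slots n κ => if σ.2 then -1 else 1)
        * (List.ofFn fun i => fun σ : Slots n κ =>
          slotOp (fun j t => A.term d L (k * n + j) t) (σ.1 i)).reverse.prod := by
    funext σ
    rw [segmentTerm, Pi.mul_apply, slotProd]
    congr 1
    refine Eq.trans ?_ (map_list_prod (Pi.evalMonoidHom
      (fun _ : Slots n κ => unitaryGroup (Option (Fin L) × Fin N) ℂ) σ) _).symm
    rw [List.map_reverse, List.map_ofFn]
    rfl
  rw [this, map_mul, map_mul, map_list_prod, map_list_prod, List.map_reverse, List.map_reverse,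
    List.map_ofFn, List.map_ofFn]
  rfl

/-- Amplification uses the block encoding or its inverse three times. -/
theorem Scheme.impl_segment (R : unitaryGroup (Slots n κ) ℂ) (k : ℕ) :
    Impl (layout N f) (fun d => liftU M (A.segment d R L k)) (18 * κ) 0 := by
  have h1 := A.impl_lcu (f := f) R k
  have h2 := Impl.gate (m := m) (D := D) (e := layout N f)
    (liftU M (zeroReflection (Option (Fin L) × Fin N) (slot₀ n κ)))
  have h3 := Impl.gate (m := m) (D := D) (e := layout N f) (liftU M
    (-1 : unitaryGroup ((Option (Fin L) × Fin N) × Slots n κ) ℂ))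
  refine ((h3.mul ((((h1.mul h2).mul h1.inv).mul h2).mul h1)).mono (by omega) (by omega)).of_eq
    fun d => ?_
  rw [segment, amplify, ← neg_one_mul]
  simp only [map_mul, map_inv]

theorem Scheme.impl_evolution (R : unitaryGroup (Slots n κ) ℂ) (r : ℕ) :
    Impl (layout N f) (fun d => liftU M (A.evolution d R L r)) (18 * κ * r + 2) 1 := by
  have h1 := A.impl_cumDamp (f := f) (fun _ => L)
  have h2 := Impl.ordProd (k := r) fun k => A.impl_segment (f := f) (M := M) R k
  have h3 := impl_prep (N := N) (m := m) (D := D) (f := f)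
  refine (((h1.mul h2).mul h3).mono (by ring_nf; exact le_rfl) (by omega)).of_eq fun d => ?_
  rw [evolution, map_mul, map_mul, map_ordProd]

/-- Only the reflections are controlled by the counter. In an inactive round `B d` and its inverse
cancel, so the queries need no control; each of the `M` rounds uses `B d` twice, and the preparation
once. -/
theorem impl_randomGrover {R : unitaryGroup (Fin M) ℂ}
    {B : OracleData N m D → unitaryGroup ((Option (Fin L) × Fin N) × Slots n κ) ℂ} {b c : ℕ}
    (hB : Impl (layout N f) (fun d => liftU M (B d)) b c)
    (z₀ : (Option (Fin L) × Fin N) × Slots n κ)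
    (P : (Option (Fin L) × Fin N) × Slots n κ → Prop) [DecidablePred P] :
    Impl (layout N f) (fun d => randomGrover R (B d) z₀ P) ((2 * M + 1) * b) ((2 * M + 1) * c) := by
  have h1 : ∀ i : Fin M, Impl (layout N f) (fun d => blockU fun j : Fin M =>
      if i < j then groverStep (B d) z₀ P else 1) (2 * b) (2 * c) := by
    intro i
    have g1 := Impl.gate (m := m) (D := D) (e := layout N f)
      (blockU fun j : Fin M => if i < j then -signGate (· = z₀) else 1)
    have g2 := Impl.gate (m := m) (D := D) (e := layout N f)
      (blockU fun j : Fin M => if i < j then signGate P else 1)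
    refine ((((hB.mul g1).mul hB.inv).mul g2).mono (by omega) (by omega)).of_eq fun d => ?_
    change _ = blockU (fun _ => B d) * _ * (blockU fun _ => B d)⁻¹ * _
    rw [← map_inv, ← map_mul, ← map_mul, ← map_mul]
    congr 1
    funext j
    simp only [Pi.mul_apply, Pi.inv_apply]
    split_ifs
    · rfl
    · simp
  have h2 := Impl.ofFn_prod h1
  refine (((h2.mul hB).mul (Impl.gate (tensorU _ R))).mono (by ring_nf; exact le_rfl)
    (by ring_nf; exact le_rfl)).of_eq fun d => rfl

end Evolution

end CAP
end

noncomputable section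
namespace CAP

open Matrix

/-! ### Accuracy of the circuit -/

section Accuracy

variable {N m D : ℕ} (A : Scheme N m D) (d : OracleData N m D)

/-- The normalized potential read off in step `j`. -/
def Scheme.pot (j : ℕ) (r : Fin N) : ℝ := A.v (d.yR r (A.time j))

theorem onGrid_sum {L : ℕ} (F : Kind → Matrix (Fin N) (Fin N) ℂ) :
    onGrid L (∑ t, F t) = ∑ t, onGrid L (F t) := by
  simp only [Fintype.sum_prod_type, Fintype.sum_bool, onGrid_add]

theorem onGrid_conjTranspose {L : ℕ} (F : Matrix (Fin N) (Fin N) ℂ) :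
    (onGrid L F)ᴴ = onGrid L Fᴴ := by
  rw [onGrid, conjTranspose_kronecker, conjTranspose_one]; rfl

/-- The generator of step `j` in the interaction picture. -/
def Scheme.interGenerator (h : ℝ) (L j : ℕ) :
    Matrix (Option (Fin L) × Fin N) (Option (Fin L) × Fin N) ℂ :=
  ((A.cumDamp d L j)⁻¹ : unitaryGroup (Option (Fin L) × Fin N) ℂ)
    * onGrid L (generator N h (A.pot d j)) * (A.cumDamp d L j).1

theorem Scheme.interGenerator_eq {h : ℝ}
    (hU : ∀ a : Fin N → ℝ, generator N h a
      = (1 / 4 : ℝ) • ∑ t, (gridTerm A.U a t : Matrix (Fin N) (Fin N) ℂ)) (L j : ℕ) :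
    A.interGenerator d h L j = (1 / 4 : ℝ) • ∑ t, (A.term d L j t).1 := by
  rw [interGenerator, hU, onGrid_smul, onGrid_sum, mul_smul_comm, smul_mul_assoc, Finset.mul_sum,
    Finset.sum_mul]
  rfl

theorem Scheme.interGenerator_conjTranspose (h : ℝ) (L j : ℕ) :
    (A.interGenerator d h L j)ᴴ = -A.interGenerator d h L j := by
  have e : ((A.cumDamp d L j)⁻¹ : unitaryGroup (Option (Fin L) × Fin N) ℂ).1
      = (A.cumDamp d L j).1ᴴ := rfl
  rw [interGenerator, e, conjTranspose_mul, conjTranspose_mul, conjTranspose_conjTranspose,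
    onGrid_conjTranspose, generator_conjTranspose]
  have : onGrid L (-generator N h (A.pot d j)) = -onGrid L (generator N h (A.pot d j)) := by
    have := onGrid_smul (L := L) (-1) (generator N h (A.pot d j))
    simpa using this
  rw [this]
  simp only [Matrix.mul_neg, Matrix.neg_mul, Matrix.mul_assoc]

theorem Scheme.cumDamp_mul_ordProd (h x : ℝ) (L : ℕ) :
    (A.cumDamp d L L).1 * ordProd (fun j => 1 + x • A.interGenerator d h L j) 0 L
      = ordProd (fun j => (A.damp d L j).1
          * onGrid L (1 + x • generator N h (A.pot d j))) 0 L := by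
  rw [← interaction_picture]
  congr 2
  funext j
  have e : ((A.cumDamp d L j)⁻¹ : unitaryGroup (Option (Fin L) × Fin N) ℂ).1
      * (A.cumDamp d L j).1 = 1 := mem_unitaryGroup_iff'.1 (A.cumDamp d L j).2
  rw [onGrid_add, onGrid_one, onGrid_smul, mul_add, add_mul, mul_one]
  change _ = ((A.cumDamp d L j)⁻¹ : unitaryGroup (Option (Fin L) × Fin N) ℂ).1
      * (A.cumDamp d L j).1 + _
  rw [e, interGenerator, mul_smul_comm, smul_mul_assoc]
  rfl

theorem ordProd_segments {B : Type*} [Monoid B] (F : ℕ → B) (n k : ℕ) :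
    ordProd (fun i => ordProd (fun j => F (i * n + j)) 0 n) 0 k = ordProd F 0 (k * n) := by
  induction k with
  | zero => simp [ordProd_self]
  | succ k ih =>
    rw [ordProd_succ_top _ (Nat.zero_le _), ih, ordProd_shift, ordProd_mul_ordProd _ (Nat.zero_le _)
      (Nat.le_add_right _ _), Nat.succ_mul]

theorem blockU_const_mul_inj {Y I : Type} [Fintype Y] [DecidableEq Y] [Fintype I] [DecidableEq I]
    (i₀ : I) (X : unitaryGroup Y ℂ) :
    (blockU (fun _ : I => X) : Matrix (Y × I) (Y × I) ℂ) * inj Y i₀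
      = inj Y i₀ * (X : Matrix Y Y ℂ) := by
  ext ⟨y, i⟩ y'
  rw [mul_inj_apply, blockU_apply, blockDiagonal_apply, mul_apply]
  by_cases hi : i = i₀
  · subst hi
    simp [inj]
  · simp [inj, hi]

/-- The final factor `2` bounds the exact products over the preceding segments, as `(1 + x ^ 2) ^ L
≤ 4` bounds their squared norms. -/
theorem Scheme.norm_evolution_sub_le [NeZero N] {h x : ℝ}
    (hU : ∀ a : Fin N → ℝ, generator N h a
      = (1 / 4 : ℝ) • ∑ t, (gridTerm A.U a t : Matrix (Fin N) (Fin N) ℂ))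
    {n κ r : ℕ} (hx : 0 ≤ x) (hn : n * x ≤ 1 / 2)
    {R : unitaryGroup (Slots n κ) ℂ}
    (hR : ∀ (Y : Type) [Fintype Y] [DecidableEq Y] (g : ℕ → Kind → unitaryGroup Y ℂ),
      (inj Y (slot₀ n κ))ᴴ * (lcu R (segmentTerm g) : Matrix (Y × Slots n κ) (Y × Slots n κ) ℂ) *
        inj Y (slot₀ n κ)
      = (1 / 2 : ℂ) • dysonSum n x (fun j t => (g j t : Matrix Y Y ℂ)) κ 0)
    {L : ℕ} (hL : L = r * n) (hxL : (1 + x ^ 2) ^ L ≤ 4) :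
    ‖((blockU (fun _ => A.cumDamp d L L) * ordProd (A.segment d R L) 0 r :
          unitaryGroup ((Option (Fin L) × Fin N) × Slots n κ) ℂ)).1
        * inj (Option (Fin L) × Fin N) (slot₀ n κ)
      - inj (Option (Fin L) × Fin N) (slot₀ n κ) * ordProd (fun j => (A.damp d L j).1
          * onGrid L (1 + x • generator N h (A.pot d j))) 0 L‖
      ≤ r * ((((1 + x ^ 2) ^ n - 1) + 6 * (1 / 2) ^ κ) * 2) := by
  set i := inj (Option (Fin L) × Fin N) (slot₀ n κ)
  set F : ℕ → Matrix (Option (Fin L) × Fin N) (Option (Fin L) × Fin N) ℂ :=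
    fun j => 1 + x • A.interGenerator d h L j with hF
  set E : ℕ → Matrix (Option (Fin L) × Fin N) (Option (Fin L) × Fin N) ℂ :=
    fun k => ordProd (fun j => F (k * n + j)) 0 n with hE
  have hx1 : 1 ≤ 1 + x ^ 2 := by nlinarith [sq_nonneg x]
  have hseg : ∀ k < r, ‖(A.segment d R L k).1 * i - i * E k‖
      ≤ ((1 + x ^ 2) ^ n - 1) + 6 * (1 / 2) ^ κ := by
    intro k _
    exact norm_amplify_segment_le hx hn (hR _ fun j t => A.term d L (k * n + j) t)
      (G := fun j => A.interGenerator d h L (k * n + j))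
      (fun j => A.interGenerator_eq d hU L _) (fun j => A.interGenerator_conjTranspose d h L _)
  have hG1 : ∀ j, ‖A.interGenerator d h L j‖ ≤ 1 := fun j => by
    have h2 : (∑ t : Kind, (1 : ℝ)) = 4 := by simp [Fintype.card_prod]
    have : ‖∑ t, (A.term d L j t).1‖ ≤ 4 :=
      h2 ▸ norm_sum_le_of_le _ fun t _ => l2_opNorm_unitary_le_one _
    rw [A.interGenerator_eq d hU, norm_smul, Real.norm_of_nonneg (by norm_num)]
    linarith
  have hEk : ∀ k < r, ‖ordProd E 0 k‖ ≤ 2 := by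
    intro k hk
    rw [hE, ordProd_segments]
    have h1 := norm_sq_ordProd_le (F := F) (fun j =>
      norm_star_one_add_smul_mul_sub_one_le (A.interGenerator_conjTranspose d h L j) (hG1 j))
      (Nat.zero_le (k * n))
    have h2 : (1 + x ^ 2) ^ (k * n - 0) ≤ (1 + x ^ 2) ^ L :=
      pow_le_pow_right₀ hx1 (by rw [hL]; simpa using Nat.mul_le_mul_right n hk.le)
    nlinarith [norm_nonneg (ordProd F 0 (k * n))]
  have hη : 0 ≤ ((1 + x ^ 2) ^ n - 1) + 6 * (1 / 2 : ℝ) ^ κ :=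
    add_nonneg (by linarith [one_le_pow₀ hx1 (n := n)]) (by positivity)
  have key := norm_ordProd_mul_inj_le (slot₀ n κ) (A.segment d R L) E hseg hEk hη
  have e1 : ordProd E 0 r = ordProd F 0 L := by
    rw [hE, ordProd_segments, ← hL]
  rw [← A.cumDamp_mul_ordProd d h x L, ← e1]
  set Q := ((ordProd (A.segment d R L) 0 r :
    unitaryGroup ((Option (Fin L) × Fin N) × Slots n κ) ℂ)).1
  have e2 : ((blockU (fun _ => A.cumDamp d L L) * ordProd (A.segment d R L) 0 r :
          unitaryGroup ((Option (Fin L) × Fin N) × Slots n κ) ℂ)).1 * i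
      - i * ((A.cumDamp d L L).1 * ordProd E 0 r)
      = (blockU fun _ : Slots n κ => A.cumDamp d L L).1
        * (Q * i - i * ordProd E 0 r) := by
    have e3 := blockU_const_mul_inj (slot₀ n κ) (A.cumDamp d L L)
    rw [Matrix.mul_sub, ← Matrix.mul_assoc i, ← e3, Submonoid.coe_mul]
    simp only [Matrix.mul_assoc]
    rfl
  rw [e2]
  refine (l2_opNorm_mul _ _).trans ?_
  have := mul_le_mul (l2_opNorm_unitary_le_one (blockU (fun _ : Slots n κ => A.cumDamp d L L))) key
    (norm_nonneg _) zero_le_one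
  linarith

/-! ### The amplitude of the successful branch. -/

theorem norm_restrict_le {ι ι' : Type} [Fintype ι] [Fintype ι'] (g : ι → ι')
    (hg : Function.Injective g) (ψ : ι' → ℂ) :
    ‖(WithLp.toLp 2 fun i => ψ (g i) : EuclideanSpace ℂ ι)‖
      ≤ ‖(WithLp.toLp 2 ψ : EuclideanSpace ℂ ι')‖ := by
  classical
  rw [EuclideanSpace.norm_eq, EuclideanSpace.norm_eq]
  apply Real.sqrt_le_sqrt
  have h1 : ∑ i, ‖ψ (g i)‖ ^ 2 = ∑ j ∈ Finset.univ.image g, ‖ψ j‖ ^ 2 := by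
    rw [Finset.sum_image fun _ _ _ _ h => hg h]
  change ∑ i, ‖ψ (g i)‖ ^ 2 ≤ ∑ j, ‖ψ j‖ ^ 2
  rw [h1]
  exact Finset.sum_le_univ_sum_of_nonneg fun _ => sq_nonneg _

/-- The initial basis state of environment, grid and slots. -/
def start (N L n κ : ℕ) [NeZero N] : (Option (Fin L) × Fin N) × Slots n κ :=
  ((none, 0), slot₀ n κ)

/-- The amplitudes of the grid when environment and slots are in their initial state. -/
def goodVec {L n κ : ℕ} [NeZero N] (B : unitaryGroup ((Option (Fin L) × Fin N) × Slots n κ) ℂ) :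
    EuclideanSpace ℂ (Fin N) :=
  WithLp.toLp 2 fun r => (B.1 *ᵥ Pi.single (start N L n κ) 1) ((none, r), slot₀ n κ)

/-- The final amplification with random rounds needs an amplitude bounded away from `1`. It is
halved by sending the rest to another basis state, the one with the sign bit set. -/
theorem exists_halving (n κ : ℕ) : ∃ H : unitaryGroup (Slots n κ) ℂ,
    H.1 (slot₀ n κ) (slot₀ n κ) = 1 / 2 := by
  obtain ⟨H, hH⟩ := exists_unitary_sqrt (slot₀ n κ)
    (fun σ => if σ = slot₀ n κ then 1 / 4 else if σ = ((fun _ => none, true) : Slots n κ) then 3 / 4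
      else 0) (by intro σ; split_ifs <;> norm_num) (by
      have h : ((fun _ => none, true) : Slots n κ) ≠ slot₀ n κ := by simp [slot₀]
      rw [Finset.sum_ite, Finset.sum_const, Finset.filter_eq' Finset.univ,
        if_pos (Finset.mem_univ _),
        Finset.sum_ite_eq' , if_pos (by simp [h])]
      norm_num)
  refine ⟨H, ?_⟩
  rw [hH, if_pos rfl]
  have : √(1 / 4 : ℝ) = 1 / 2 := by
    rw [show (1 / 4 : ℝ) = (1 / 2) ^ 2 by norm_num, Real.sqrt_sq (by norm_num)]
  rw [this]
  norm_num

/-- Ideally the slots end in `slot₀ n κ`, where `H` acts by the factor `1 / 2`. A deviation may lie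
in any slot state, but `H` is unitary and reading off one block does not increase norms. -/
theorem Scheme.norm_goodVec_sub_le [NeZero N] {n κ r L : ℕ} {R H : unitaryGroup (Slots n κ) ℂ}
    (hH : H.1 (slot₀ n κ) (slot₀ n κ) = 1 / 2)
    (F : ℕ → Matrix (Fin N) (Fin N) ℂ) {η : ℝ}
    (hη : ‖((blockU (fun _ => A.cumDamp d L L) * ordProd (A.segment d R L) 0 r :
          unitaryGroup ((Option (Fin L) × Fin N) × Slots n κ) ℂ)).1
        * inj (Option (Fin L) × Fin N) (slot₀ n κ)
      - inj (Option (Fin L) × Fin N) (slot₀ n κ)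
        * ordProd (fun j => (A.damp d L j).1 * onGrid L (F j)) 0 L‖
      ≤ η)
    (p : EuclideanSpace ℂ (Fin N)) (hp : ‖p‖ = 1)
    (hp' : ∀ r, (d.prep : Matrix (Fin N) (Fin N) ℂ) r 0 = p r) :
    ‖goodVec (tensorU _ H * A.evolution d R L r) - (1 / 2 : ℂ) •
      toEuclideanCLM (n := Fin N) (𝕜 := ℂ)
        (ordProd (fun j => diagonal (fun r => (A.c (d.yI r) : ℂ)) * F j) 0 L) p‖ ≤ η := by
  set i := inj (Option (Fin L) × Fin N) (slot₀ n κ)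
  set Q := ((blockU (fun _ => A.cumDamp d L L) * ordProd (A.segment d R L) 0 r :
          unitaryGroup ((Option (Fin L) × Fin N) × Slots n κ) ℂ)).1
  set X := ordProd (fun j => (A.damp d L j).1 * onGrid L (F j)) 0 L with hX
  have hstart : ((A.evolution d R L r).1 *ᵥ Pi.single (start N L n κ) 1)
      = (Q * i) *ᵥ aliveVec L p := by
    have e1 : (A.evolution d R L r).1
        = Q * ((blockU (fun _ => tensorU (Option (Fin L)) d.prep) :
          unitaryGroup ((Option (Fin L) × Fin N) × Slots n κ) ℂ)).1 := rfl
    rw [e1, ← mulVec_mulVec, ← mulVec_mulVec]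
    congr 1
    rw [mulVec_single_one]
    funext ⟨⟨o, r⟩, σ⟩
    change ((blockU (fun _ => tensorU (Option (Fin L)) d.prep) :
      unitaryGroup ((Option (Fin L) × Fin N) × Slots n κ) ℂ)).1 ((o, r), σ)
        ((none, 0), slot₀ n κ) = ∑ y, i ((o, r), σ) y * aliveVec L p y
    rw [blockU_apply, blockDiagonal_apply, tensorU_apply, hp']
    by_cases hσ : σ = slot₀ n κ
    · subst hσ
      by_cases ho : o = none
      · subst ho
        simp [i, inj, aliveVec, Fintype.sum_prod_type]
      · simp [i, inj, aliveVec, Fintype.sum_prod_type, ho]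
    · simp [i, inj, hσ]
  have halive :
      ‖(WithLp.toLp 2 (aliveVec L p) : EuclideanSpace ℂ (Option (Fin L) × Fin N))‖ = 1 := by
    rw [← hp, EuclideanSpace.norm_eq, EuclideanSpace.norm_eq]
    congr 1
    change ∑ z, ‖aliveVec L p z‖ ^ 2 = _
    rw [Fintype.sum_prod_type, Fintype.sum_option]
    simp [aliveVec]
  have hgood : goodVec (tensorU _ H * A.evolution d R L r) = WithLp.toLp 2 fun y : Fin N =>
      ((tensorU _ H : unitaryGroup ((Option (Fin L) × Fin N) × Slots n κ) ℂ).1 *ᵥ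
        ((A.evolution d R L r).1 *ᵥ Pi.single (start N L n κ) 1))
          ((none, y), slot₀ n κ) := by
    rw [goodVec, Submonoid.coe_mul]
    simp only [mulVec_mulVec]
  have hideal : (1 / 2 : ℂ) • toEuclideanCLM (n := Fin N) (𝕜 := ℂ)
        (ordProd (fun j => diagonal (fun r => (A.c (d.yI r) : ℂ)) * F j) 0 L) p
      = WithLp.toLp 2 fun r : Fin N =>
        ((tensorU _ H : unitaryGroup ((Option (Fin L) × Fin N) × Slots n κ) ℂ).1 *ᵥ
          ((i * X) *ᵥ aliveVec L p)) ((none, r), slot₀ n κ) := by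
    ext r
    have h1 := (dilation (L := L) (fun r => A.c (d.yI r)) (fun r => A.abs_c_le _) F p le_rfl).1 r
    change (1 / 2 : ℂ) * (toEuclideanCLM (n := Fin N) (𝕜 := ℂ) _ p) r = _
    rw [ofLp_toEuclideanCLM, ← h1]
    change _ = ((tensorU _ H : unitaryGroup ((Option (Fin L) × Fin N) × Slots n κ) ℂ).1 *ᵥ
      ((i * X) *ᵥ aliveVec L p)) ((none, r), slot₀ n κ)
    rw [← mulVec_mulVec]
    have h2 : ∀ (ψ : Option (Fin L) × Fin N → ℂ) y, (((tensorU _ H :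
        unitaryGroup ((Option (Fin L) × Fin N) × Slots n κ) ℂ)).1 *ᵥ (i *ᵥ ψ)) (y, slot₀ n κ)
          = 1 / 2 * ψ y := by
      intro ψ y
      rw [mulVec_mulVec]
      simp only [mulVec, dotProduct, i, mul_inj_apply, tensorU_apply, hH]
      simp
    rw [h2]
    rfl
  rw [hgood, hideal, hstart]
  have hsub : (WithLp.toLp 2 (fun r =>
      ((tensorU _ H : unitaryGroup ((Option (Fin L) × Fin N) × Slots n κ) ℂ).1 *ᵥ
        ((Q * i) *ᵥ aliveVec L p)) ((none, r), slot₀ n κ)) : EuclideanSpace ℂ (Fin N))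
      - WithLp.toLp 2 (fun r =>
      ((tensorU _ H : unitaryGroup ((Option (Fin L) × Fin N) × Slots n κ) ℂ).1 *ᵥ
        ((i * X) *ᵥ aliveVec L p)) ((none, r), slot₀ n κ))
      = WithLp.toLp 2 (fun r =>
      ((tensorU _ H : unitaryGroup ((Option (Fin L) × Fin N) × Slots n κ) ℂ).1 *ᵥ
        ((Q * i - i * X) *ᵥ aliveVec L p)) ((none, r), slot₀ n κ)) := by
    ext r
    rw [sub_mulVec, mulVec_sub]
    rfl
  rw [hsub]
  refine (norm_restrict_le (fun r : Fin N => (((none, r), slot₀ n κ) :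
    (Option (Fin L) × Fin N) × Slots n κ)) (fun a b hab => by simpa using hab) _).trans ?_
  have h3 := l2_opNorm_mulVec ((tensorU _ H :
    unitaryGroup ((Option (Fin L) × Fin N) × Slots n κ) ℂ)).1
    (WithLp.toLp 2 ((Q * i - i * X) *ᵥ aliveVec L p))
  have h4 := l2_opNorm_mulVec (Q * i - i * X) (WithLp.toLp 2 (aliveVec L p))
  rw [halive, mul_one] at h4
  have h5 := l2_opNorm_unitary_le_one (tensorU (Option (Fin L) × Fin N) H)
  refine h3.trans ((mul_le_mul h5 (h4.trans hη) (norm_nonneg _) zero_le_one).trans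
    (by rw [one_mul]))

end Accuracy

end CAP
end

noncomputable section
namespace CAP

open Matrix

/-! ### From circuits to algorithms -/

section Algorithms

variable {N m D L n κ M : ℕ}

theorem exists_layout (L n κ M : ℕ) [NeZero M] :
    ∃ (a : ℕ) (f : Work L n κ M ≃ Fin (a + 1)), f (none, slot₀ n κ, 0) = 0 := by
  obtain ⟨a, ha⟩ : ∃ a, Fintype.card (Work L n κ M) = a + 1 :=
    Nat.exists_eq_succ_of_ne_zero (@Fintype.card_ne_zero _ _ ⟨(none, slot₀ n κ, 0)⟩)
  have g := Fintype.equivFinOfCardEq ha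
  exact ⟨a, g.trans (Equiv.swap (g (none, slot₀ n κ, 0)) 0), by simp⟩

theorem norm_normalize_sub_normalize_le {E : Type*} [NormedAddCommGroup E] [NormedSpace ℂ E]
    {v w : E} (hv : v ≠ 0) (hw : w ≠ 0) :
    ‖((‖v‖⁻¹ : ℝ) : ℂ) • v - ((‖w‖⁻¹ : ℝ) : ℂ) • w‖ ≤ 2 * ‖v - w‖ / ‖w‖ := by
  have hv' : 0 < ‖v‖ := norm_pos_iff.2 hv
  have hw' : 0 < ‖w‖ := norm_pos_iff.2 hw
  have e : ((‖v‖⁻¹ : ℝ) : ℂ) • v - ((‖w‖⁻¹ : ℝ) : ℂ) • w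
      = ((‖w‖⁻¹ : ℝ) : ℂ) • (v - w) + ((‖v‖⁻¹ - ‖w‖⁻¹ : ℝ) : ℂ) • v := by
    rw [Complex.ofReal_sub, sub_smul, smul_sub]
    abel
  have h1 : |‖v‖⁻¹ - ‖w‖⁻¹| * ‖v‖ = |‖w‖ - ‖v‖| / ‖w‖ := by
    rw [inv_sub_inv hv'.ne' hw'.ne', abs_div, abs_mul, abs_norm, abs_norm]
    field_simp
  rw [e]
  refine (norm_add_le _ _).trans ?_
  rw [norm_smul, norm_smul, Complex.norm_real, Complex.norm_real, Real.norm_eq_abs,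
    Real.norm_eq_abs, h1, abs_inv, abs_norm, inv_mul_eq_div, ← add_div]
  gcongr
  have := abs_norm_sub_norm_le w v
  rw [norm_sub_rev] at this
  linarith

/-- The real factor `c` left by the amplification may be negative; its sign is the global phase. -/
theorem exists_phase_norm_sub_le {E : Type*} [NormedAddCommGroup E] [NormedSpace ℂ E]
    {g v : E} {c μ ε : ℝ} (hc : (c : ℂ) • g ≠ 0) (hμ : 0 < μ) (hv : v ≠ 0)
    (h : 2 * ‖g - (μ : ℂ) • v‖ ≤ ε * (μ * ‖v‖)) :
    ∃ z : ℂ, ‖z‖ = 1 ∧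
      ‖z • ((‖(c : ℂ) • g‖⁻¹ : ℝ) : ℂ) • (c : ℂ) • g - ((‖v‖⁻¹ : ℝ) : ℂ) • v‖ ≤ ε := by
  have hc0 : c ≠ 0 := by rintro rfl; simp at hc
  have hg : g ≠ 0 := by rintro rfl; simp at hc
  have hμv : (μ : ℂ) • v ≠ 0 := smul_ne_zero (by exact_mod_cast hμ.ne') hv
  have hca : (|c| : ℝ) ≠ 0 := abs_ne_zero.2 hc0
  refine ⟨((c / |c| : ℝ) : ℂ), ?_, ?_⟩
  · rw [Complex.norm_real, Real.norm_eq_abs, abs_div, abs_abs, div_self hca]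
  · have e1 : ((c / |c| : ℝ) : ℂ) • ((‖(c : ℂ) • g‖⁻¹ : ℝ) : ℂ) • (c : ℂ) • g
        = ((‖g‖⁻¹ : ℝ) : ℂ) • g := by
      rw [smul_smul, smul_smul, ← Complex.ofReal_mul, ← Complex.ofReal_mul, norm_smul,
        Complex.norm_real, Real.norm_eq_abs]
      congr 2
      have hg' : ‖g‖ ≠ 0 := norm_ne_zero_iff.2 hg
      have : c * c = |c| * |c| := (abs_mul_abs_self c).symm
      field_simp
      nlinarith
    have e2 : ((‖v‖⁻¹ : ℝ) : ℂ) • v = ((‖(μ : ℂ) • v‖⁻¹ : ℝ) : ℂ) • (μ : ℂ) • v := by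
      rw [smul_smul, ← Complex.ofReal_mul, norm_smul, Complex.norm_real, Real.norm_eq_abs,
        abs_of_pos hμ, mul_inv, mul_right_comm, inv_mul_cancel₀ hμ.ne', one_mul]
    rw [e1, e2]
    refine (norm_normalize_sub_normalize_le hg hμv).trans ?_
    rw [div_le_iff₀ (norm_pos_iff.2 hμv), norm_smul, Complex.norm_real, Real.norm_eq_abs,
      abs_of_pos hμ]
    exact h

/-- The flag leaves the round counter free: for each of its values the grid holds a real multiple of
`goodVec (B d)`, so the error does not depend on the outcome, and the probabilities add up to at
least `1 / 4`. -/
theorem exists_algorithm [NeZero N] [NeZero m] [NeZero D] [NeZero M] {a : ℕ}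
    {f : Work L n κ M ≃ Fin (a + 1)} (hf : f (none, slot₀ n κ, 0) = 0)
    {B : OracleData N m D → unitaryGroup ((Option (Fin L) × Fin N) × Slots n κ) ℂ} {b c : ℕ}
    (hB : Impl (layout N f) (fun d => liftU M (B d)) b c) :
    ∃ A : Algorithm N m D, A.potentialQueries ≤ (2 * M + 1) * b ∧
      A.prepQueries ≤ (2 * M + 1) * c ∧
      ∀ O d, O.Matches d → ‖goodVec (B d)‖ ≤ 5 / 8 → 1 ≤ M * ‖goodVec (B d)‖ →
      ∀ (v : EuclideanSpace ℂ (Fin N)) (ε μ : ℝ), 0 < μ → v ≠ 0 →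
        2 * ‖goodVec (B d) - (μ : ℂ) • v‖ ≤ ε * (μ * ‖v‖) → A.Prepares O v ε (1 / 4) := by
  have hM0 : (M : ℝ) ≠ 0 := by exact_mod_cast NeZero.ne M
  obtain ⟨R, hR⟩ := exists_unitary_sqrt (0 : Fin M) (fun _ => 1 / (M : ℝ))
    (fun _ => by positivity) (by simp [hM0])
  obtain ⟨l, -, hl, -, hl1, -, hl2, -⟩ := impl_randomGrover (R := R) hB (start N L n κ)
    (fun z => z.1.1 = none ∧ z.2 = slot₀ n κ)
  refine ⟨⟨a, l, fun x => decide (x.1 = 0 ∧ x.2.1 = 0 ∧ (f.symm x.2.2).1 = none ∧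
    (f.symm x.2.2).2.1 = slot₀ n κ)⟩, hl1, hl2, ?_⟩
  intro O d hO hg hMg v ε μ hμ hv hε
  set A : Algorithm N m D := ⟨a, l, fun x => decide (x.1 = 0 ∧ x.2.1 = 0 ∧
    (f.symm x.2.2).1 = none ∧ (f.symm x.2.2).2.1 = slot₀ n κ)⟩
  have hg0 : 0 < ‖goodVec (B d)‖ := by
    rcases (norm_nonneg (goodVec (B d))).eq_or_lt with h | h
    · rw [← h] at hMg; simp at hMg; linarith
    · exact h
  have hsum : ∑ z with (fun z : (Option (Fin L) × Fin N) × Slots n κ =>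
      z.1.1 = none ∧ z.2 = slot₀ n κ) z,
        ‖((B d).1 *ᵥ Pi.single (start N L n κ) 1) z‖ ^ 2 = ‖goodVec (B d)‖ ^ 2 := by
    rw [EuclideanSpace.norm_sq_eq]
    refine Finset.sum_nbij' (fun z => z.1.2) (fun r => ((none, r), slot₀ n κ)) ?_ ?_ ?_ ?_ ?_
    · simp
    · simp
    · rintro ⟨⟨o, r⟩, σ⟩ h
      simp only [Finset.mem_filter, Finset.mem_univ, true_and] at h
      simp [h.1, h.2]
    · simp
    · rintro ⟨⟨o, r⟩, σ⟩ h
      simp only [Finset.mem_filter, Finset.mem_univ, true_and] at h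
      obtain ⟨rfl, rfl⟩ := h
      rfl
  obtain ⟨k, hk, hkz⟩ := randomGrover_good (B d) (start N L n κ)
    (fun z => z.1.1 = none ∧ z.2 = slot₀ n κ) hR rfl hg0 hg hMg hsum
  have hinit : (Pi.single (0, 0, 0, 0) 1 : Basis N m D a → ℂ)
      = spread (layout N f) 0 0 (Pi.single (start N L n κ, 0) 1) := by
    funext ⟨r, t, y, w⟩
    have h1 : (layout N f).symm (r, w) = (start N L n κ, 0) ↔ r = 0 ∧ w = 0 := by
      rw [Equiv.symm_apply_eq]
      change (r, w) = (0, f (none, slot₀ n κ, 0)) ↔ _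
      rw [hf, Prod.mk.injEq]
    simp only [spread, Pi.single_apply, h1, Prod.mk.injEq, Pi.zero_apply]
    by_cases h2 : t = 0 <;> by_cases h3 : y = 0 <;> simp [h2, h3]
  have hout : ∀ x, A.flag x = true →
      A.outcome O x = (k (f.symm x.2.2).2.2 : ℂ) • goodVec (B d) := by
    rintro ⟨t, y, w⟩ hx
    obtain ⟨rfl, rfl, hx1, hx2⟩ := of_decide_eq_true hx
    ext r
    change A.finalState O (r, 0, 0, w) = (k (f.symm w).2.2 : ℂ) * (goodVec (B d)) r
    rw [Algorithm.finalState]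
    change List.foldl (fun ψ s => s.act O ψ) (Pi.single (0, 0, 0, 0) 1) l _ = _
    rw [hinit, hl O d hO]
    have h1 : (layout N f).symm (r, w) = (((none, r), slot₀ n κ), (f.symm w).2.2) := by
      change ((((f.symm w).1, r), (f.symm w).2.1), (f.symm w).2.2) = _
      simp only at hx1 hx2
      rw [hx1, hx2]
    simp only [spread, Pi.zero_apply, and_self, if_true, h1]
    exact hkz _ _ ⟨rfl, rfl⟩
  refine ⟨?_, ?_⟩
  · let g : Fin M → Fin m × Fin D × Fin (a + 1) := fun j => (0, 0, f (none, slot₀ n κ, j))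
    have hginj : Function.Injective g := fun i j h => by simpa [g] using h
    have hgflag : ∀ j, A.flag (g j) = true := fun j =>
      decide_eq_true ⟨rfl, rfl, by simp [g], by simp [g]⟩
    have h1 : ∑ j, ‖A.outcome O (g j)‖ ^ 2 ≤ A.successProb O := by
      rw [Algorithm.successProb,
        ← Finset.sum_image (f := fun x => ‖A.outcome O x‖ ^ 2) (fun i _ j _ h => hginj h)]
      refine Finset.sum_le_sum_of_subset_of_nonneg ?_ fun _ _ _ => sq_nonneg _
      intro x hx
      obtain ⟨j, -, rfl⟩ := Finset.mem_image.1 hx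
      simp [hgflag]
    refine hk.trans (le_trans (le_of_eq ?_) h1)
    rw [Finset.sum_mul]
    refine Finset.sum_congr rfl fun j _ => ?_
    rw [hout _ (hgflag j), norm_smul, mul_pow, Complex.norm_real, Real.norm_eq_abs, sq_abs]
    simp [g]
  · intro x hx hx0
    rw [hout x hx] at hx0 ⊢
    exact exists_phase_norm_sub_le hx0 hμ hv hε

end Algorithms

/-! ### What the encodings determine, and the trivial algorithm for degenerate cases. -/

section Data

variable {N m D : ℕ} [NeZero N] [NeZero D] {T : ℝ} {O : Oracles N m D} {P : Problem N T}
  {val : Fin D → ℝ} {δ : ℝ}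

theorem Oracles.Encodes.exists_data (h : O.Encodes P val δ) : ∃ d : OracleData N m D,
    O.Matches d ∧ (∀ r, |val (d.yI r) - P.VI r| ≤ δ) ∧
    (∀ r s, |val (d.yR r s) - P.VR ((s : ℝ) * T / (m : ℝ)) r| ≤ δ) ∧
    ∀ r, d.prep.1 r 0 = P.u 0 r / (‖P.u 0‖ : ℂ) := by
  choose yI hI using h.VI_spec
  choose yR hR using h.VR_spec
  refine ⟨⟨yI, yR, O.prep⟩, ⟨fun r => (hI r).2, fun r s => (hR r s).2, rfl⟩, fun r => (hI r).1,
    fun r s => (hR r s).1, fun r => ?_⟩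
  rw [← h.prep_spec r, mulVec_single_one]
  rfl

/-- The algorithm without steps. -/
def idle (N m D : ℕ) : Algorithm N m D := ⟨0, [], fun _ => true⟩

theorem idle_prepares [NeZero m] {v : EuclideanSpace ℂ (Fin N)} {ε : ℝ}
    (hv : ∃ z : ℂ, ‖z‖ = 1 ∧
      ‖z • EuclideanSpace.single (0 : Fin N) (1 : ℂ) - ((‖v‖⁻¹ : ℝ) : ℂ) • v‖ ≤ ε) :
    (idle N m D).Prepares O v ε (1 / 4) := by
  have hout : ∀ x, (idle N m D).outcome O x
      = if x = 0 then EuclideanSpace.single 0 1 else 0 := by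
    intro x
    ext r
    change (Pi.single (0, 0, 0, 0) 1 : Basis N m D 0 → ℂ) (r, x) = _
    by_cases hx : x = 0
    · subst hx
      by_cases hr : r = 0
      · subst hr; simp; rfl
      · rw [if_pos rfl]
        refine (Pi.single_eq_of_ne (fun h => hr (Prod.mk.inj h).1) _).trans ?_
        simp [hr]
    · rw [if_neg hx]
      exact (Pi.single_eq_of_ne (fun h => hx (Prod.mk.inj h).2) _).trans rfl
  refine ⟨?_, ?_⟩
  · rw [Algorithm.successProb]
    refine le_trans ?_ (Finset.single_le_sum (f := fun x => ‖(idle N m D).outcome O x‖ ^ 2)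
      (fun _ _ => sq_nonneg _) (a := 0)
      (Finset.mem_filter.2 ⟨Finset.mem_univ _, rfl⟩))
    simp only [hout, if_true, PiLp.norm_single]
    norm_num
  · intro x _ hx
    rw [hout] at hx ⊢
    have h0 : x = 0 := by by_contra h; simp [h] at hx
    obtain ⟨z, hz, hzv⟩ := hv
    refine ⟨z, hz, ?_⟩
    simpa [h0] using hzv

end Data

end CAP
end

noncomputable section
namespace CAP

open Matrix

/-! ### Accuracy in terms of the problem -/

section Encoding

variable {N m D : ℕ} {T : ℝ}

/-- By uniqueness backwards in time, a linear equation with bounded coefficients cannot bring a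
nonzero solution to zero. -/
theorem Problem.u_ne_zero (P : Problem N T) (hT : 0 < T) : P.u T ≠ 0 := by
  intro h0
  have hmem : ∀ t ∈ Set.Ioc 0 T, t ∈ Set.Icc 0 T := fun t ht => ⟨ht.1.le, ht.2⟩
  have := ODE_solution_unique_of_mem_Icc_left
    (v := fun t x => toEuclideanCLM (n := Fin N) (𝕜 := ℂ) (P.rhs t) x) (s := fun _ => Set.univ)
    (K := (P.maxH + ‖potential P.VI‖).toNNReal) (f := P.u) (g := fun _ => 0) (a := 0) (b := T)
    (fun t ht => ((toEuclideanCLM (n := Fin N) (𝕜 := ℂ) (P.rhs t)).lipschitz.weaken (by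
      refine NNReal.le_toNNReal_of_coe_le ?_
      rw [coe_nnnorm, l2_opNorm_toEuclideanCLM]
      exact P.norm_rhs_le le_rfl le_rfl (hmem t ht))).lipschitzOnWith)
    (fun t ht => (P.hasDerivWithinAt ht).continuousWithinAt)
    (fun t ht => ((P.hasDerivWithinAt (hmem t ht)).mono_of_mem_nhdsWithin
      (Icc_mem_nhdsLE_of_mem ht))) (fun _ _ => Set.mem_univ _)
    continuousOn_const (fun t _ => by
      simpa using hasDerivWithinAt_const t (Set.Iic t) (0 : EuclideanSpace ℂ (Fin N)))
    (fun _ _ => Set.mem_univ _) h0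
  exact P.u_zero_ne (this ⟨le_rfl, hT.le⟩)

/-- A number clipped to the interval `[0, w]`. -/
def clip (w x : ℝ) : ℝ := max 0 (min w x)

theorem clip_nonneg (w x : ℝ) : 0 ≤ clip w x := le_max_left _ _

theorem clip_le {w : ℝ} (hw : 0 ≤ w) (x : ℝ) : clip w x ≤ w := max_le hw (min_le_left _ _)

theorem abs_sub_clip_le {w x y : ℝ} (hy0 : 0 ≤ y) (hy : y ≤ w) : |y - clip w x| ≤ |x - y| := by
  rw [clip]
  rcases max_cases 0 (min w x) with h1 | h1 <;> rcases min_cases w x with h2 | h2 <;>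
    rcases abs_cases (x - y) with h3 | h3 <;> rw [abs_le] <;> constructor <;> linarith

/-- The scheme for the number format `val`, with `L` steps of length `τ`. -/
def scheme [NeZero m] (val : Fin D → ℝ) (U : Bool → unitaryGroup (Fin N) ℂ) {h w τ : ℝ} (L : ℕ)
    (hw : 0 ≤ w) (hτ : 0 ≤ τ) (hτw : τ * w ≤ 1) : Scheme N m D where
  -- Clipping makes this a cosine for every word, including words that no admissible oracle writes.
  c y := 1 - τ * clip w (val y)
  abs_c_le y := by
    have h1 := mul_nonneg hτ (clip_nonneg w (val y))
    have h2 := (mul_le_mul_of_nonneg_left (clip_le hw (val y)) hτ).trans hτw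
    rw [abs_le]
    constructor <;> linarith
  v y := val y / (4 * h)
  U := U
  -- The last grid time not after step `j`; for `j < L` the reduction modulo `m` has no effect.
  time j := Fin.ofNat m (j * m / L)

theorem abs_time_sub_le [NeZero m] {L j : ℕ} (hj : j < L) (hT : 0 ≤ T) {τ : ℝ} (hL : L * τ = T) :
    |((Fin.ofNat m (j * m / L) : Fin m) : ℝ) * T / m - j * τ| ≤ T / m := by
  have hL0 : (0 : ℝ) < L := by exact_mod_cast (Nat.zero_le j).trans_lt hj
  have hm0 : 0 < m := Nat.pos_of_ne_zero (NeZero.ne m)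
  have hm : (0 : ℝ) < m := by exact_mod_cast hm0
  have h1 : j * m / L < m := Nat.div_lt_of_lt_mul (Nat.mul_lt_mul_of_pos_right hj hm0)
  have h2 : ((Fin.ofNat m (j * m / L) : Fin m) : ℕ) = j * m / L := Nat.mod_eq_of_lt h1
  rw [h2]
  set s := j * m / L
  have h3 : (s : ℝ) * L ≤ j * m := by exact_mod_cast Nat.div_mul_le_self (j * m) L
  have h4 : (j * m : ℝ) < (s + 1) * L := by
    have := Nat.lt_div_mul_add (a := j * m) (b := L) ((Nat.zero_le j).trans_lt hj)
    have h5 : j * m < (s + 1) * L := by rw [add_mul, one_mul]; exact this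
    exact_mod_cast h5
  have h6 : (s : ℝ) * T / m - j * τ = (s * L - j * m) * τ / m := by
    rw [← hL]
    field_simp
  have h7 : T / m = L * τ / m := by rw [hL]
  have hτ : 0 ≤ τ := by
    by_contra h
    nlinarith
  rw [h6, h7, abs_div, abs_of_pos hm, abs_mul, abs_of_nonneg hτ]
  gcongr
  rw [abs_le]
  constructor <;> linarith

variable [NeZero m] {val : Fin D → ℝ} {U : Bool → unitaryGroup (Fin N) ℂ}
  {h w τ : ℝ} {L : ℕ} {hw : 0 ≤ w} {hτ : 0 ≤ τ} {hτw : τ * w ≤ 1}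

theorem damped_generator (h0 : 0 < h) (d : OracleData N m D) (j : ℕ) :
    diagonal (fun r => ((scheme val U (h := h) L hw hτ hτw : Scheme N m D).c (d.yI r) : ℂ))
        * (1 + (8 * h * τ) • generator N h
          ((scheme val U (h := h) L hw hτ hτw : Scheme N m D).pot d j))
      = dampedStep τ (fun r => clip w (val (d.yI r))) (encodedHamiltonian N h
          ((scheme val U (h := h) L hw hτ hτw : Scheme N m D).pot d j)) := by
  rw [one_add_generator h0, dampedStep]
  rfl

theorem norm_dampedStep_le (h0 : 0 < h) (hh : (N : ℝ) ^ 2 / 2 ≤ h) (hτ : 0 ≤ τ)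
    (hτw : τ * w ≤ 1) {ω : Fin N → ℝ} (hω : ∀ r, 0 ≤ ω r ∧ ω r ≤ w) (a : Fin N → ℝ) :
    ‖dampedStep τ ω (encodedHamiltonian N h a)‖ ≤ 1 + (8 * h * τ) ^ 2 := by
  rw [dampedStep, ← one_add_generator h0]
  have h1 : ‖(diagonal (fun r => ((1 - τ * ω r : ℝ) : ℂ)) : Matrix (Fin N) (Fin N) ℂ)‖ ≤ 1 := by
    change ‖potential fun r => 1 - τ * ω r‖ ≤ 1
    rw [norm_potential, pi_norm_le_iff_of_nonneg zero_le_one]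
    intro r
    have h1 := mul_nonneg hτ (hω r).1
    have h2 := (mul_le_mul_of_nonneg_left (hω r).2 hτ).trans hτw
    rw [Real.norm_eq_abs, abs_le]
    constructor <;> linarith
  have h2 : ‖1 + (8 * h * τ) • generator N h a‖ ^ 2 ≤ 1 + (8 * h * τ) ^ 2 := by
    have h3 := norm_star_one_add_smul_mul_sub_one_le (x := 8 * h * τ)
      (generator_conjTranspose h a) (norm_generator_le h0 hh a)
    have h4 := l2_opNorm_conjTranspose_mul_self (1 + (8 * h * τ) • generator N h a)
    have h5 : ‖(1 : Matrix (Fin N) (Fin N) ℂ)‖ ≤ 1 :=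
      l2_opNorm_unitary_le_one (1 : unitaryGroup (Fin N) ℂ)
    have h6 := norm_sub_norm_le ((1 + (8 * h * τ) • generator N h a)ᴴ
      * (1 + (8 * h * τ) • generator N h a)) 1
    rw [star_eq_conjTranspose] at h3
    nlinarith
  have h3 : ‖1 + (8 * h * τ) • generator N h a‖ ≤ 1 + (8 * h * τ) ^ 2 := by
    nlinarith [sq_nonneg (‖1 + (8 * h * τ) • generator N h a‖ - 1),
      norm_nonneg (1 + (8 * h * τ) • generator N h a)]
  exact (l2_opNorm_mul _ _).trans ((mul_le_mul h1 h3 (norm_nonneg _) zero_le_one).trans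
    (by rw [one_mul]))

theorem norm_hamiltonian_sub_encoded_le (hN : 2 ≤ N) (hT : 0 < T) (P : Problem N T)
    (h0 : 0 < h) (hH : P.maxH ≤ h) {v δ : ℝ} (hv : P.maxVR' ≤ v) (d : OracleData N m D)
    (hd : ∀ r s, |val (d.yR r s) - P.VR ((s : ℝ) * T / (m : ℝ)) r| ≤ δ) (hL : L * τ = T)
    {j : ℕ} (hj : j < L) :
    ‖hamiltonian (P.VR (j * τ)) - encodedHamiltonian N h
      ((scheme val U (h := h) L hw hτ hτw : Scheme N m D).pot d j)‖ ≤ δ + v * (T / m) := by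
  rw [hamiltonian_eq, encodedHamiltonian, add_sub_add_left_eq_sub, ← potential_sub, norm_potential]
  set s : Fin m := Fin.ofNat m (j * m / L) with hs
  have hm : (0 : ℝ) < m := by exact_mod_cast Nat.pos_of_ne_zero (NeZero.ne m)
  have hjT : (j : ℝ) * τ ∈ Set.Icc 0 T := by
    have : (j : ℝ) ≤ L := by exact_mod_cast hj.le
    exact ⟨by positivity, hL ▸ mul_le_mul_of_nonneg_right this hτ⟩
  have hsT : (s : ℝ) * T / m ∈ Set.Icc 0 T := by
    have : (s : ℝ) ≤ m := by exact_mod_cast s.2.le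
    refine ⟨by positivity, ?_⟩
    rw [div_le_iff₀ hm]
    nlinarith
  have hv0 : 0 ≤ v := P.nonneg_of_maxVR'_le hT hv
  have h1 : ‖P.VR ((s : ℝ) * T / m) - P.VR (j * τ)‖ ≤ v * (T / m) :=
    (P.norm_VR_sub_le hT hv hjT hsT).trans
      (mul_le_mul_of_nonneg_left (abs_time_sub_le hj hT.le hL) hv0)
  have hδ : 0 ≤ δ := (abs_nonneg _).trans (hd ⟨0, by omega⟩ s)
  rw [pi_norm_le_iff_of_nonneg (by positivity)]
  intro r
  have h2 : |P.VR (j * τ) r| ≤ 3 * h := abs_potential_le hN (P.norm_H_le hH hjT) r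
  have h3 := abs_truncate_sub_le (a := val (d.yR r s) / (4 * h)) (b := P.VR (j * τ) r / (4 * h))
    (by
      rw [abs_div, abs_of_pos (by linarith : 0 < 4 * h), div_le_one (by linarith)]
      linarith)
  have h4 : |P.VR ((s : ℝ) * T / m) r - P.VR (j * τ) r| ≤ v * (T / m) :=
    (norm_le_pi_norm (P.VR ((s : ℝ) * T / m) - P.VR (j * τ)) r).trans h1
  have h5 : |val (d.yR r s) - P.VR (j * τ) r| ≤ δ + v * (T / m) :=
    (abs_sub_le _ (P.VR ((s : ℝ) * T / m) r) _).trans (add_le_add (hd r s) h4)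
  change |P.VR (j * τ) r - 4 * h * truncate (val (d.yR r s) / (4 * h))| ≤ _
  refine le_trans (le_of_eq ?_) ((mul_le_mul_of_nonneg_left h3 (by linarith : 0 ≤ 4 * h)).trans
    (le_trans (le_of_eq ?_) h5))
  · rw [abs_sub_comm, ← abs_of_pos (by linarith : 0 < 4 * h), ← abs_mul,
      abs_of_pos (by linarith : 0 < 4 * h)]
    congr 1
    field_simp
  · rw [← abs_of_pos (by linarith : 0 < 4 * h), ← abs_mul, abs_of_pos (by linarith : 0 < 4 * h)]
    congr 1
    field_simp

/-- In the target factor `1 / (2 * ‖P.u 0‖)`, one half comes from the halving and the rest from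
preparing a normalized vector. The factor `2` of the discretization error is this half times the
bound `4` for the growth of the steps. -/
theorem norm_goodVec_sub_solution_le [NeZero N] (hN : 2 ≤ N) (hT : 0 < T) (P : Problem N T)
    (hh : (N : ℝ) ^ 2 / 2 ≤ h) (hH : P.maxH ≤ h) {v δ : ℝ} (hv : P.maxVR' ≤ v)
    (hVI : ‖potential P.VI‖ ≤ w) (d : OracleData N m D)
    (hdI : ∀ r, |val (d.yI r) - P.VI r| ≤ δ)
    (hd : ∀ r s, |val (d.yR r s) - P.VR ((s : ℝ) * T / (m : ℝ)) r| ≤ δ)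
    (hp : ∀ r, d.prep.1 r 0 = P.u 0 r / (‖P.u 0‖ : ℂ))
    (hU : ∀ a : Fin N → ℝ, generator N h a
      = (1 / 4 : ℝ) • ∑ t, (gridTerm U a t : Matrix (Fin N) (Fin N) ℂ))
    {n κ r : ℕ} (hn : n * (8 * h * τ) ≤ 1 / 2) {R H : unitaryGroup (Slots n κ) ℂ}
    (hR : ∀ (Y : Type) [Fintype Y] [DecidableEq Y] (g : ℕ → Kind → unitaryGroup Y ℂ),
      (inj Y (slot₀ n κ))ᴴ * (lcu R (segmentTerm g) : Matrix (Y × Slots n κ) (Y × Slots n κ) ℂ) *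
        inj Y (slot₀ n κ)
      = (1 / 2 : ℂ) • dysonSum n (8 * h * τ) (fun j t => (g j t : Matrix Y Y ℂ)) κ 0)
    (hHs : H.1 (slot₀ n κ) (slot₀ n κ) = 1 / 2)
    (hLr : L = r * n) (hL : L * τ = T) (hxL : (1 + (8 * h * τ) ^ 2) ^ L ≤ 4) :
    ‖goodVec (tensorU _ H *
        (scheme val U (h := h) L hw hτ hτw : Scheme N m D).evolution d R L r)
        - ((1 / (2 * ‖P.u 0‖) : ℝ) : ℂ) • P.u T‖
      ≤ r * ((((1 + (8 * h * τ) ^ 2) ^ n - 1) + 6 * (1 / 2) ^ κ) * 2)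
        + 2 * (T * (δ + (δ + v * (T / m))) + T * τ * (v + (h + w) ^ 2 + w * (8 * h))) := by
  have h0 : 0 < h := by
    have : (2 : ℝ) ≤ N := by exact_mod_cast hN
    nlinarith
  set A : Scheme N m D := scheme val U (h := h) L hw hτ hτw with hA
  set u₀ := P.u 0 with hu₀
  have hu : 0 < ‖u₀‖ := norm_pos_iff.2 P.u_zero_ne
  have hx : 0 ≤ 8 * h * τ := by positivity
  set p : EuclideanSpace ℂ (Fin N) := ((‖u₀‖⁻¹ : ℝ) : ℂ) • u₀ with hpdef
  have hp1 : ‖p‖ = 1 := by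
    rw [hpdef, norm_smul, Complex.norm_real, norm_inv, norm_norm, inv_mul_cancel₀ hu.ne']
  have h1 := A.norm_goodVec_sub_le d hHs
    (fun j => 1 + (8 * h * τ) • generator N h (A.pot d j))
    (A.norm_evolution_sub_le d hU hx hn hR hLr hxL) p hp1 (fun r => by
      rw [hp, hpdef]
      change _ = ((‖u₀‖⁻¹ : ℝ) : ℂ) * u₀ r
      rw [Complex.ofReal_inv, div_eq_inv_mul])
  have e1 : (fun j => diagonal (fun r => (A.c (d.yI r) : ℂ))
      * (1 + (8 * h * τ) • generator N h (A.pot d j)))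
      = fun j => dampedStep τ (fun r => clip w (val (d.yI r))) (encodedHamiltonian N h
          (A.pot d j)) := funext fun j => damped_generator h0 d j
  rw [e1] at h1
  have hVIw : ∀ r, P.VI r ≤ w := fun r => by
    rw [norm_potential] at hVI
    exact (le_abs_self _).trans ((norm_le_pi_norm P.VI r).trans hVI)
  have hδ : 0 ≤ δ := (abs_nonneg _).trans (hdI 0)
  have h2 := P.norm_discrete_sub_le (ω := fun r => clip w (val (d.yI r)))
    (K := fun j => encodedHamiltonian N h (A.pot d j)) (δ := δ) (C := 1 + (8 * h * τ) ^ 2)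
    hT hH hv hVI hτ hL
    (by
      rw [pi_norm_le_iff_of_nonneg hδ]
      exact fun r => (abs_sub_clip_le (P.VI_nonneg r) (hVIw r)).trans (hdI r))
    (fun j hj => norm_hamiltonian_sub_encoded_le hN hT P h0 hH hv d hd hL hj)
    (by
      rw [pi_norm_le_iff_of_nonneg hw]
      intro r
      rw [Real.norm_eq_abs, abs_of_nonneg (clip_nonneg _ _)]
      exact clip_le hw _)
    (fun j => norm_encodedHamiltonian_le hh _) (by nlinarith [sq_nonneg (8 * h * τ)])
    (fun j => norm_dampedStep_le h0 hh hτ hτw (fun r => ⟨clip_nonneg _ _, clip_le hw _⟩) _)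
  set X := toEuclideanCLM (n := Fin N) (𝕜 := ℂ)
    (ordProd (fun j => dampedStep τ (fun r => clip w (val (d.yI r))) (encodedHamiltonian N h
          (A.pot d j))) 0 L) with hX
  have e2 : (1 / 2 : ℂ) • X p - ((1 / (2 * ‖u₀‖) : ℝ) : ℂ) • P.u T
      = ((1 / (2 * ‖u₀‖) : ℝ) : ℂ) • (X u₀ - P.u T) := by
    rw [hpdef, map_smul, smul_smul, smul_sub]
    congr 2
    push_cast
    ring
  have h3 : ‖(1 / 2 : ℂ) • X p - ((1 / (2 * ‖u₀‖) : ℝ) : ℂ) • P.u T‖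
      ≤ 2 * (T * (δ + (δ + v * (T / m))) + T * τ * (v + (h + w) ^ 2 + w * (8 * h))) := by
    rw [e2, norm_smul, Complex.norm_real, Real.norm_of_nonneg (by positivity), one_div_mul_eq_div,
      div_le_iff₀ (by positivity)]
    have hv0 : 0 ≤ v := P.nonneg_of_maxVR'_le hT hv
    have hE : 0 ≤ T * (δ + (δ + v * (T / m))) + T * τ * (v + (h + w) ^ 2 + w * (8 * h)) := by
      positivity
    calc _ ≤ _ := h2
      _ ≤ (T * (δ + (δ + v * (T / m))) + T * τ * (v + (h + w) ^ 2 + w * (8 * h))) * 4 * ‖u₀‖ := by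
        gcongr
      _ = _ := by ring
  refine (norm_sub_le_norm_sub_add_norm_sub _ ((1 / 2 : ℂ) • X p) _).trans (add_le_add h1 h3)

end Encoding

end CAP
end

noncomputable section
namespace CAP

open Matrix

/-! ### Choice of the parameters -/

section Parameters

-- All these errors tend to zero as `n` grows with `r` fixed: `x` is of order `1 / n`, so `L * x ^
-- 2` is too. No rate is needed, because the query count involves `r` and `κ` but not `n`.
open Filter Topology in
theorem exists_step_count {r : ℕ} (hr : 0 < r) (T h w b : ℝ) {η : ℝ} (hη : 0 < η) :
    ∃ n : ℕ, 0 < n ∧ (1 + (8 * h * (T / (r * n))) ^ 2) ^ (r * n) ≤ 4 ∧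
      r * (((1 + (8 * h * (T / (r * n))) ^ 2) ^ n - 1) * 2) ≤ η ∧
      2 * (T * (T / (r * n)) * b) ≤ η ∧ T / (r * n) * w ≤ 1 := by
  have hr' : (r : ℝ) ≠ 0 := by exact_mod_cast hr.ne'
  have h1 : Tendsto (fun n : ℕ => T / (r * n)) atTop (𝓝 0) := by
    have := tendsto_const_div_atTop_nhds_zero_nat (T / r)
    simpa only [div_div] using this
  have h2 : Tendsto (fun n : ℕ => (8 * h * T / r) ^ 2 / n) atTop (𝓝 0) :=
    tendsto_const_div_atTop_nhds_zero_nat _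
  have h3 : Tendsto (fun n : ℕ => Real.exp ((8 * h * T / r) ^ 2 / n)) atTop (𝓝 1) :=
    (Real.continuous_exp.tendsto' 0 1 Real.exp_zero).comp h2
  have h4 : Tendsto (fun n : ℕ => Real.exp ((8 * h * T / r) ^ 2 / n) ^ r) atTop (𝓝 1) := by
    simpa using h3.pow r
  have h5 : Tendsto (fun n : ℕ => r * ((Real.exp ((8 * h * T / r) ^ 2 / n) - 1) * 2)) atTop
      (𝓝 0) := by
    simpa using ((h3.sub_const 1).mul_const 2).const_mul (r : ℝ)
  have h6 : Tendsto (fun n : ℕ => 2 * (T * (T / (r * n)) * b)) atTop (𝓝 0) := by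
    simpa using ((h1.const_mul T).mul_const b).const_mul 2
  have h7 : Tendsto (fun n : ℕ => T / (r * n) * w) atTop (𝓝 0) := by
    simpa using h1.mul_const w
  obtain ⟨n, hn4, hn5, hn6, hn7, hn⟩ := ((h4.eventually_le_const (by norm_num : (1 : ℝ) < 4)).and
    ((h5.eventually_le_const hη).and ((h6.eventually_le_const hη).and
      ((h7.eventually_le_const one_pos).and (eventually_gt_atTop 0))))).exists
  have hn' : (n : ℝ) ≠ 0 := by exact_mod_cast hn.ne'
  have key : (1 + (8 * h * (T / (r * n))) ^ 2) ^ n ≤ Real.exp ((8 * h * T / r) ^ 2 / n) := by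
    calc _ ≤ Real.exp ((8 * h * (T / (r * n))) ^ 2) ^ n := by
          gcongr
          rw [add_comm]
          exact Real.add_one_le_exp _
      _ = _ := by
          rw [← Real.exp_nat_mul]
          congr 1
          field_simp
  refine ⟨n, hn, ?_, ?_, hn6, hn7⟩
  · rw [mul_comm r n, pow_mul]
    exact (pow_le_pow_left₀ (by positivity) key r).trans hn4
  · refine le_trans ?_ hn5
    gcongr

variable {N : ℕ} {T ε q h v w : ℝ}

theorem cost_le (hq : 1 ≤ q) (hTh : 0 ≤ T * h) {X : ℝ} (hX : 2 ≤ X) :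
    (((2 * ⌈4 * q⌉₊ + 1) * (18 * ⌈30 * Real.log X⌉₊ * ⌈16 * (T * h)⌉₊ + 2) : ℕ) : ℝ)
      ≤ 10 ^ 6 * (q * (1 + T * h) * Real.log X ^ 4) := by
  have hΛ : 1 / 2 ≤ Real.log X := by
    have := Real.log_two_gt_d9
    have := Real.log_le_log (by norm_num) hX
    linarith
  set Λ := Real.log X
  have hM : (⌈4 * q⌉₊ : ℝ) ≤ 5 * q := by
    have := Nat.ceil_lt_add_one (by linarith : 0 ≤ 4 * q)
    linarith
  have hκ : (⌈30 * Λ⌉₊ : ℝ) ≤ 32 * Λ := by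
    have := Nat.ceil_lt_add_one (by linarith : 0 ≤ 30 * Λ)
    linarith
  have hr : (⌈16 * (T * h)⌉₊ : ℝ) ≤ 16 * (1 + T * h) := by
    have := Nat.ceil_lt_add_one (by linarith : 0 ≤ 16 * (T * h))
    linarith
  push_cast
  have h1 : 2 * (⌈4 * q⌉₊ : ℝ) + 1 ≤ 11 * q := by linarith
  -- `9220 = 18 * 32 * 16 + 4`, the summand `2` being absorbed by means of `Λ ≥ 1 / 2`.
  have h2 : 18 * (⌈30 * Λ⌉₊ : ℝ) * ⌈16 * (T * h)⌉₊ + 2 ≤ 9220 * ((1 + T * h) * Λ) := by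
    have h3 : (⌈30 * Λ⌉₊ : ℝ) * ⌈16 * (T * h)⌉₊ ≤ 32 * Λ * (16 * (1 + T * h)) := by gcongr
    nlinarith
  -- One logarithm would do; the exponent `4` is shared with the power of `X` in the precision of
  -- the oracles.
  have h4 : Λ ≤ 8 * Λ ^ 4 := by
    have : (1 / 2) ^ 3 ≤ Λ ^ 3 := by gcongr
    nlinarith
  calc _ ≤ 11 * q * (9220 * ((1 + T * h) * Λ)) := by gcongr
    _ ≤ 11 * q * (9220 * ((1 + T * h) * (8 * Λ ^ 4))) := by gcongr
    _ ≤ _ := by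
      have : 0 ≤ q * (1 + T * h) * Λ ^ 4 := by positivity
      nlinarith

theorem truncation_error_le (hε : 0 < ε) (hq : 1 ≤ q) (hTh : 0 ≤ T * h) {X : ℝ} (hX : 2 ≤ X)
    (hX' : q * (1 + T * h) / ε ≤ X) :
    (⌈16 * (T * h)⌉₊ : ℝ) * (6 * (1 / 2) ^ ⌈30 * Real.log X⌉₊ * 2) ≤ ε / (64 * q) := by
  have hX0 : 0 < X := by linarith
  have hr : (⌈16 * (T * h)⌉₊ : ℝ) ≤ 16 * (1 + T * h) := by
    have := Nat.ceil_lt_add_one (by linarith : 0 ≤ 16 * (T * h))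
    linarith
  -- `log 2 ≥ 1 / 2` halves the exponent `30`. Of the fifteen powers, fourteen supply the constant
  -- `2 ^ 14 ≥ 12288` and one the decay in `X`.
  have hpow : X ^ 15 ≤ 2 ^ ⌈30 * Real.log X⌉₊ := by
    rw [← Real.log_le_log_iff (by positivity) (by positivity), Real.log_pow, Real.log_pow]
    have h1 := Nat.le_ceil (30 * Real.log X)
    have h2 := Real.log_two_gt_d9
    have h3 : 0 ≤ Real.log X := Real.log_nonneg (by linarith)
    push_cast
    nlinarith
  have h14 : (2 : ℝ) ^ 14 ≤ X ^ 14 := by gcongr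
  have h15 : 12288 * X ≤ 2 ^ ⌈30 * Real.log X⌉₊ := by
    refine le_trans ?_ hpow
    nlinarith
  have h16 : (1 / 2 : ℝ) ^ ⌈30 * Real.log X⌉₊ ≤ 1 / (12288 * X) := by
    rw [_root_.one_div_pow]
    exact one_div_le_one_div_of_le (by positivity) h15
  rw [div_le_iff₀ hε] at hX'
  calc _ ≤ 16 * (1 + T * h) * (6 * (1 / (12288 * X)) * 2) := by gcongr
    _ = (1 + T * h) / (64 * X) := by field_simp; norm_num
    _ ≤ ε / (64 * q) := by
      rw [div_le_div_iff₀ (by positivity) (by positivity)]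
      nlinarith

/-- The worst term is the time-grid error `T * v * T / m`, of order `X ^ 3 / m`. To make it of order
`1 / X` the fourth power of `X` is required. -/
theorem encoding_error_le (hT : 0 < T) (hε : 0 < ε) (hq : 1 ≤ q) (hv : 0 ≤ v) {X : ℝ}
    (hX : 2 ≤ X) (hTX : T ≤ 2 * X) (hvX : v ≤ 2 * X) (hqX : q / ε ≤ X) {m : ℝ}
    (hm : 10 ^ 6 * X ^ 4 ≤ m) :
    2 * (T * ((10 ^ 6 * X ^ 4)⁻¹ + ((10 ^ 6 * X ^ 4)⁻¹ + v * (T / m)))) ≤ ε / (64 * q) := by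
  have hX0 : 0 < X := by linarith
  rw [div_le_iff₀ hε] at hqX
  have hm0 : 0 < m := lt_of_lt_of_le (by positivity) hm
  have h1 : T / m ≤ 2 * X * (10 ^ 6 * X ^ 4)⁻¹ := by
    rw [div_eq_mul_inv]
    gcongr
  calc _ ≤ 2 * (2 * X * ((10 ^ 6 * X ^ 4)⁻¹ + ((10 ^ 6 * X ^ 4)⁻¹
          + 2 * X * (2 * X * (10 ^ 6 * X ^ 4)⁻¹)))) := by
        gcongr
    _ = (8 * X + 16 * X ^ 3) / (10 ^ 6 * X ^ 4) := by field_simp; ring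
    _ ≤ 1 / (64 * X) := by
      rw [div_le_div_iff₀ (by positivity) (by positivity)]
      have : X ^ 2 * 4 ≤ X ^ 4 := by nlinarith [sq_nonneg X, mul_self_nonneg (X ^ 2 - 4)]
      nlinarith
    _ ≤ ε / (64 * q) := by
      rw [div_le_div_iff₀ (by positivity) (by positivity)]
      nlinarith

/-- The ideal amplitude `‖v‖ / (2 * a)` lies between `1 / (2 * q)` and `1 / 2`, and the error is at
most `1 / (8 * q) ≤ 1 / 8`. -/
theorem bounds_of_error_le {E : Type*} [NormedAddCommGroup E] [NormedSpace ℂ E] {g v : E} {a : ℝ}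
    (hε : 0 < ε) (hε2 : ε < 2) (hq : 1 ≤ q) (ha : 0 < a) (hv : 0 < ‖v‖) (hva : ‖v‖ ≤ a)
    (haq : a / ‖v‖ ≤ q) (herr : ‖g - ((1 / (2 * a) : ℝ) : ℂ) • v‖ ≤ ε / (16 * q)) :
    ‖g‖ ≤ 5 / 8 ∧ 3 / (8 * q) ≤ ‖g‖ ∧
      2 * ‖g - ((1 / (2 * a) : ℝ) : ℂ) • v‖ ≤ ε * (1 / (2 * a) * ‖v‖) := by
  have hnorm : ‖((1 / (2 * a) : ℝ) : ℂ) • v‖ = 1 / (2 * a) * ‖v‖ := by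
    rw [norm_smul, Complex.norm_real, Real.norm_of_nonneg (by positivity)]
  have hlo : 1 / (2 * q) ≤ 1 / (2 * a) * ‖v‖ := by
    rw [div_le_iff₀ hv] at haq
    rw [div_mul_eq_mul_div, one_mul, div_le_div_iff₀ (by positivity) (by positivity)]
    linarith
  have hhi : 1 / (2 * a) * ‖v‖ ≤ 1 / 2 := by
    rw [div_mul_eq_mul_div, one_mul, div_le_div_iff₀ (by positivity) (by positivity)]
    linarith
  have hη1 : ε / (16 * q) ≤ 1 / (8 * q) := by
    rw [div_le_div_iff₀ (by positivity) (by positivity)]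
    nlinarith
  have hη2 : 1 / (8 * q) ≤ 1 / 8 := one_div_le_one_div_of_le (by norm_num) (by linarith)
  have hη3 : 1 / (2 * q) - 1 / (8 * q) = 3 / (8 * q) := by field_simp; norm_num
  have ht1 := norm_sub_norm_le g (((1 / (2 * a) : ℝ) : ℂ) • v)
  have ht2 := norm_sub_norm_le (((1 / (2 * a) : ℝ) : ℂ) • v) g
  rw [norm_sub_rev] at ht2
  rw [hnorm] at ht1 ht2
  refine ⟨by linarith, by linarith, ?_⟩
  calc _ ≤ 2 * (ε / (16 * q)) := by gcongr
    _ = ε * (1 / (8 * q)) := by field_simp; norm_num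
    _ ≤ ε * (1 / (2 * a) * ‖v‖) := by
      gcongr
      exact (one_div_le_one_div_of_le (by positivity) (by linarith)).trans hlo

theorem exists_algorithm_of_two_le [NeZero N] (hN : 2 ≤ N) (hT : 0 < T) (hε : 0 < ε)
    (hε2 : ε < 2) (hq : 1 ≤ q) (hh : (N : ℝ) ^ 2 / 2 ≤ h) (hv : 0 ≤ v) (hw : 0 ≤ w)
    (m D : ℕ) [NeZero m] [NeZero D] (val : Fin D → ℝ)
    (hm : 10 ^ 6 * sizeParam T ε q h v w ^ 4 ≤ (m : ℝ)) :
    ∃ A : Algorithm N m D,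
      (A.potentialQueries : ℝ) ≤ 10 ^ 6 * (q * (1 + T * h) * Real.log (sizeParam T ε q h v w) ^ 4) ∧
      (A.prepQueries : ℝ) ≤ 10 ^ 6 * q ∧
      ∀ (P : Problem N T) (O : Oracles N m D), ‖P.u 0‖ / ‖P.u T‖ ≤ q → P.maxH ≤ h →
        P.maxVR' ≤ v → ‖potential P.VI‖ ≤ w →
        O.Encodes P val (10 ^ 6 * sizeParam T ε q h v w ^ 4)⁻¹ →
        A.Prepares O (P.u T) ε (1 / 4) := by
  have hN' : (2 : ℝ) ≤ N := by exact_mod_cast hN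
  have hh2 : 2 ≤ h := by nlinarith
  have h0 : 0 < h := by linarith
  have hTh : 0 < T * h := mul_pos hT h0
  set X := sizeParam T ε q h v w with hXdef
  have hXeq : X = 2 + q * (1 + T * h) * (1 + v) * (1 + w) / ε := rfl
  have hX : 2 ≤ X := by
    have : 0 ≤ q * (1 + T * h) * (1 + v) * (1 + w) / ε := by positivity
    linarith
  have hX1 : q * (1 + T * h) * (1 + v) / ε ≤ X := by
    rw [hXeq]
    have : q * (1 + T * h) * (1 + v) * 1 / ε ≤ q * (1 + T * h) * (1 + v) * (1 + w) / ε := by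
      gcongr; linarith
    rw [mul_one] at this
    linarith
  have hX2 : q * (1 + T * h) / ε ≤ X := by
    refine le_trans ?_ hX1
    have : q * (1 + T * h) * 1 / ε ≤ q * (1 + T * h) * (1 + v) / ε := by
      gcongr; linarith
    rw [mul_one] at this
    linarith
  have hX3 : q / ε ≤ X := by
    refine le_trans ?_ hX2
    have : q * 1 / ε ≤ q * (1 + T * h) / ε := by
      gcongr; linarith
    rw [mul_one] at this
    linarith
  have hvX : v ≤ 2 * X := by
    rw [div_le_iff₀ hε] at hX1
    have h1 : 1 ≤ q * (1 + T * h) := by nlinarith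
    nlinarith
  -- `X` contains `T` only in the product `T * h`; here `h ≥ 2`, because `N ≥ 2`.
  have hTX : T ≤ 2 * X := by
    rw [div_le_iff₀ hε] at hX2
    nlinarith
  set M := ⌈4 * q⌉₊ with hM
  set κ := ⌈30 * Real.log X⌉₊ with hκ
  -- Chosen so that `n * (8 * h * τ) = 8 * (T * h) / r ≤ 1 / 2` in each segment.
  set r := ⌈16 * (T * h)⌉₊ with hr
  have hM0 : 0 < M := Nat.ceil_pos.2 (by linarith)
  have hr0 : 0 < r := Nat.ceil_pos.2 (by linarith)
  have hr0' : (0 : ℝ) < r := by exact_mod_cast hr0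
  have hη : 0 < ε / (64 * q) := by positivity
  obtain ⟨n, hn, hn1, hn2, hn3, hn4⟩ := exists_step_count hr0 T h w
    (v + (h + w) ^ 2 + w * (8 * h)) hη
  have hn0 : (0 : ℝ) < n := by exact_mod_cast hn
  set τ := T / (r * n) with hτ
  have hτ0 : 0 ≤ τ := by positivity
  have hL : ((r * n : ℕ) : ℝ) * τ = T := by
    rw [hτ]; push_cast; field_simp
  have hnx : n * (8 * h * τ) ≤ 1 / 2 := by
    have h1 : n * (8 * h * τ) = 8 * (T * h) / r := by rw [hτ]; field_simp
    rw [h1, div_le_iff₀ hr0']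
    have := Nat.le_ceil (16 * (T * h))
    linarith
  obtain ⟨U, hU⟩ := exists_kinetic_split (N := N) h0 hh
  obtain ⟨R, hR⟩ := exists_segment_prep n κ (x := 8 * h * τ) (by positivity) hnx
  obtain ⟨H, hH⟩ := exists_halving n κ
  set S : Scheme N m D := scheme val U (h := h) (r * n) hw hτ0 hn4 with hS
  have : NeZero M := ⟨hM0.ne'⟩
  obtain ⟨a, f, hf⟩ := exists_layout (r * n) n κ M
  have hB := (Impl.gate (m := m) (D := D) (e := layout N f) (liftU M
    (tensorU (Option (Fin (r * n)) × Fin N) H))).mul (S.impl_evolution (f := f) (M := M) R r)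
  obtain ⟨A, hA1, hA2, hA3⟩ := exists_algorithm hf
    (B := fun d => tensorU (Option (Fin (r * n)) × Fin N) H * S.evolution d R (r * n) r)
    (hB.of_eq fun d => map_mul _ _ _)
  refine ⟨A, ?_, ?_, ?_⟩
  · refine le_trans ?_ (cost_le hq hTh.le hX)
    exact_mod_cast hA1.trans (by rw [Nat.zero_add])
  · have h1 : (A.prepQueries : ℝ) ≤ ((2 * M + 1) * (0 + 1) : ℕ) := by exact_mod_cast hA2
    have h2 := Nat.ceil_lt_add_one (by linarith : 0 ≤ 4 * q)
    push_cast at h1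
    linarith
  · intro P O hPq hPh hPv hPw hO
    obtain ⟨d, hd, hdI, hdR, hdp⟩ := hO.exists_data
    have hu0 : 0 < ‖P.u 0‖ := norm_pos_iff.2 P.u_zero_ne
    have huT : 0 < ‖P.u T‖ := norm_pos_iff.2 (P.u_ne_zero hT)
    have hle := P.norm_u_le ⟨hT.le, le_rfl⟩
    have key := norm_goodVec_sub_solution_le (hw := hw) (hτ := hτ0) (hτw := hn4) hN hT P hh hPh
      hPv hPw d hdI hdR hdp hU hnx hR hH rfl hL hn1
    set g := goodVec (tensorU (Option (Fin (r * n)) × Fin N) H * S.evolution d R (r * n) r) with hg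
    have e1 := truncation_error_le hε hq hTh.le hX hX2
    have e2 := encoding_error_le hT hε hq hv hX hTX hvX hX3 hm
    have herr : ‖g - ((1 / (2 * ‖P.u 0‖) : ℝ) : ℂ) • P.u T‖ ≤ ε / (16 * q) := by
      refine key.trans ?_
      -- Four equal shares: non-unitarity of the Euler steps, truncation, encoding and time
      -- discretization.
      have e3 : ε / (16 * q) = 4 * (ε / (64 * q)) := by field_simp; norm_num
      rw [e3]
      linarith
    have hμ : 0 < 1 / (2 * ‖P.u 0‖) := by positivity
    obtain ⟨h1, h2, h3⟩ := bounds_of_error_le hε hε2 hq hu0 huT hle hPq herr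
    have h4 : 4 * q ≤ M := Nat.le_ceil _
    refine hA3 O d hd h1 ?_ (P.u T) ε _ hμ (P.u_ne_zero hT) h3
    calc (1 : ℝ) ≤ 4 * q * (3 / (8 * q)) := by
          have : 4 * q * (3 / (8 * q)) = 3 / 2 := by field_simp; norm_num
          rw [this]; norm_num
      _ ≤ M * ‖g‖ := by gcongr

theorem exists_phase_of_subsingleton {v : EuclideanSpace ℂ (Fin 1)} (hv : v ≠ 0) :
    ∃ z : ℂ, ‖z‖ = 1 ∧
      z • EuclideanSpace.single (0 : Fin 1) (1 : ℂ) = ((‖v‖⁻¹ : ℝ) : ℂ) • v := by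
  have hn : ‖v‖ = ‖v 0‖ := by rw [EuclideanSpace.norm_eq]; simp
  have hv0 : ‖v‖ ≠ 0 := norm_ne_zero_iff.2 hv
  refine ⟨((‖v‖⁻¹ : ℝ) : ℂ) * v 0, ?_, ?_⟩
  · rw [norm_mul, ← hn, Complex.norm_real, norm_inv, norm_norm, inv_mul_cancel₀ hv0]
  · ext i
    rw [Subsingleton.elim i 0]
    simp

theorem norm_single_sub_normalize_le {N : ℕ} [NeZero N] (v : EuclideanSpace ℂ (Fin N)) :
    ‖EuclideanSpace.single (0 : Fin N) (1 : ℂ) - ((‖v‖⁻¹ : ℝ) : ℂ) • v‖ ≤ 2 := by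
  refine (norm_sub_le _ _).trans ?_
  rw [PiLp.norm_single, norm_one, norm_smul, Complex.norm_real, norm_inv, norm_norm]
  have := inv_mul_le_one (a := ‖v‖)
  linarith

end Parameters

end CAP
end

theorem theorem3 :
    -- the constants are universal
    ∃ (C p : ℝ) (k : ℕ), 0 < C ∧ 0 < p ∧
      -- the algorithm and its cost
      (∀ (N : ℕ) [NeZero N] (T ε q h vR' vI : ℝ), 0 < T → 0 < ε →
        1 ≤ q → 0 ≤ h → 0 ≤ vR' → 0 ≤ vI →
        -- the time grid and the number format of the oracles
        ∀ (m D : ℕ) [NeZero m] [NeZero D] (val : Fin D → ℝ),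
          C * CAP.sizeParam T ε q h vR' vI ^ k ≤ (m : ℝ) →
          ∃ A : CAP.Algorithm N m D,
            (A.potentialQueries : ℝ) ≤
              C * (q * (1 + T * h) * Real.log (CAP.sizeParam T ε q h vR' vI) ^ k) ∧
            (A.prepQueries : ℝ) ≤ C * q ∧
            -- the same algorithm works for all problems with these parameters
            ∀ (P : CAP.Problem N T) (O : CAP.Oracles N m D),
              ‖P.u 0‖ / ‖P.u T‖ ≤ q → P.maxH ≤ h → P.maxVR' ≤ vR' →
              ‖CAP.potential P.VI‖ ≤ vI →
              O.Encodes P val (C * CAP.sizeParam T ε q h vR' vI ^ k)⁻¹ →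
              A.Prepares O (P.u T) ε p) ∧
      -- the size of the Hamiltonian
      (∀ (N : ℕ) [NeZero N] (T : ℝ), 0 < T → ∀ P : CAP.Problem N T,
        P.maxH ≤ C * ((N : ℝ) ^ 2 + P.maxVR)) := by
  refine ⟨10 ^ 6, 1 / 4, 4, by norm_num, by norm_num, ?_, ?_⟩
  · intro N _ T ε q h vR' vI hT hε hq hh hv hw m D _ _ val hm
    -- Otherwise the algorithm without steps suffices: normalized states have distance at most `2`,
    -- for `N = 1` they agree up to phase, and for `N ≥ 2` the bound `P.maxH ≤ h` forces `N ^ 2 / 2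
    -- ≤ h`.
    by_cases hmain : 2 ≤ N ∧ ε < 2 ∧ (N : ℝ) ^ 2 / 2 ≤ h
    · exact CAP.exists_algorithm_of_two_le hmain.1 hT hε hmain.2.1 hq hmain.2.2 hv hw m D val hm
    have hq0 : 0 ≤ q := by linarith
    have hΛ : 0 ≤ Real.log (CAP.sizeParam T ε q h vR' vI) ^ 4 := by positivity
    refine ⟨CAP.idle N m D, ?_, ?_, ?_⟩
    · have : (CAP.idle N m D).potentialQueries = 0 := rfl
      rw [this, Nat.cast_zero]
      positivity
    · have : (CAP.idle N m D).prepQueries = 0 := rfl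
      rw [this, Nat.cast_zero]
      positivity
    · intro P O _ hP _ _ _
      refine CAP.idle_prepares ?_
      by_cases hε2 : ε < 2
      · by_cases hN : 2 ≤ N
        · exact absurd ⟨hN, hε2, CAP.sq_le_of_norm_hamiltonian_le hN
            (P.norm_H_le hP ⟨le_rfl, hT.le⟩)⟩ hmain
        · obtain rfl : N = 1 := by have := NeZero.pos N; omega
          obtain ⟨z, hz, hzv⟩ := CAP.exists_phase_of_subsingleton (P.u_ne_zero hT)
          exact ⟨z, hz, by rw [hzv, sub_self, norm_zero]; exact hε.le⟩
      · refine ⟨1, norm_one, ?_⟩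
        rw [one_smul]
        exact (CAP.norm_single_sub_normalize_le _).trans (not_lt.1 hε2)
  · intro N _ T hT P
    refine (P.maxH_le hT).trans ?_
    have : 0 ≤ P.maxVR := Real.sSup_nonneg fun x hx => by
      obtain ⟨t, -, rfl⟩ := hx
      exact norm_nonneg _
    gcongr
    norm_num
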